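/- **Setting.** Let $\mathcal X$ be a small Grothendieck site with a set $X$ of enough points (the stalk functors at the points $x\in X$ jointly reflect isomorphisms of sheaves of sets). Let $(\mathcal D,\mathrm E,\mathbf s,\mu,\lambda)$ be a monoidal descent category, that is: $\mathcal D$ is a symmetric monoidal category with finite products; $\mathrm E$ is a saturated class of morphisms (the *equivalences*; $f\in\mathrm E$ iff $f$ is invertible in $\mathcal D[\mathrm E^{-1}]$) closed under binary products; $\mathbf s:\Delta\mathcal D\to\mathcal D$ (the *simple functor*, on cosimplicial objects) is lax symmetric monoidal; $\mu:\mathbf s\mathbf s\to\mathbf s\,\mathrm{diag}$ and $\lambda:\mathrm{id}_{\mathcal D}\to\mathbf s c$ ($c$ = constant cosimplicial object) are monoidal natural transformations with components in $\mathrm E$; for every cosimplicial object $A$ the composites of $\mu$ with $\lambda_{\mathbf s A}$ and with $\mathbf s(\lambda_{A})$ are the identity of $\mathbf s A$ in $\mathcal D[\mathrm E^{-1}]$; the maps $\mathbf s(A\times B)\to\mathbf s A\times\mathbf s B$ are in $\mathrm E$; $\mathbf s$ sends degree-wise equivalences to equivalences; and for each object $A$ the map $\mathbf s(A^{\Delta[1]})\to\mathbf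 s(cA)$ given by a vertex of $\Delta[1]$ is in $\mathrm E$, where $A^{\Delta[1]}$ is $\prod_{\Delta[1]_n}A$ in degree $n$. Assume moreover that $\mathcal D$ has (small) filtered colimits and products, that both preserve equivalences, and that $A\otimes-$ preserves filtered colimits for every object $A$. **Operads and algebras.** $\mathrm{Op}^{\mathcal D}$ is the category of unital symmetric operads $(P(l))_{l\ge1}$ in $\mathcal D$; $\mathrm{Alg}^{\mathcal D}$ is the category of pairs $(P,A)$ of an operad $P$ and a $P$-algebra $A$, a morphism $(P,A)\to(Q,B)$ being a morphism of operads $f:P\to Q$ and a morphism of $P$-algebras $A\to f^*B$; $\mathrm{Alg}^{\mathcal D}_P$ is the category of algebras over a fixed operad $P$ in $\mathcal D$. The components of an object are, respectively, the $P(l)$, $l\ge 1$; the $P(l)$ together with $A$; and $A$. The functor $\mathbf s$, being lax symmetric monoidal, and $\lambda$ induce component-wise functors $\mathbf s$ and natural transformations $\lambda:\mathrm{id}\to\mathbf s c$ on these categories; for $\mathrm{Alg}^{\mathcal D}_P$ the $\mathbf s(cP)$-algebra $\mathbf s(A)$ is restricted along $\lambda_P:P\to\mathbf s(cP)$. Equivalences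 are defined component-wise. **Sheaves.** Let $\mathcal E$ be $\mathcal D$, $\mathrm{Op}^{\mathcal D}$, $\mathrm{Alg}^{\mathcal D}$ or $\mathrm{Alg}^{\mathcal D}_P$. $\mathrm{Sh}(\mathcal X,\mathcal E)$ is the category of functors $\mathcal X^{\mathrm{op}}\to\mathcal E$ all of whose components are sheaves with values in $\mathcal D$. $\mathcal S$ is the class of object-wise equivalences, $\mathcal W$ the class of morphisms whose components induce equivalences on the stalks at all $x\in X$. If $\mathcal E$ has filtered colimits and products, let $p^*F=(F_x)_{x\in X}$, let $p_*$ be its right adjoint $(p_*E)(U)=\prod_{x}\prod_{u\in x^*U}E_x$, let $T=p_*p^*$ be the associated monad, $G^pF=T^{p+1}F$ the cosimplicial Godement resolution, $\mathbb H_{\mathcal X}(F)=\mathbf s(G^\bullet F)$ (object-wise), and $\rho_F:F\to\mathbb H_{\mathcal X}(F)$ the composite of $\lambda$ with $\mathbf s$ of the coaugmentation $F\to G^\bullet F$. **Compatibility.** A sheaf $M\in\mathrm{Sh}(\mathcal X,\mathcal D)$ is *fibrant* if every $w:F\to F'$ in $\mathcal W$ induces a bijection $\mathrm{Hom}(F',M)\to\mathrm{Hom}(F,M)$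 in $\mathrm{Sh}(\mathcal X,\mathcal D)[\mathcal S^{-1}]$. A *fibrant model* of $F$ is a fibrant $M$ with a morphism $F\to M$ of $\mathrm{Sh}(\mathcal X,\mathcal D)[\mathcal S^{-1}]$ which becomes invertible in $\mathrm{Sh}(\mathcal X,\mathcal D)[\mathcal W^{-1}]$. $\mathcal D$ is *compatible* with $\mathcal X$ if $\mathcal S\subset\mathcal W$, every sheaf has a fibrant model (i.e. $(\mathrm{Sh}(\mathcal X,\mathcal D),\mathcal S,\mathcal W)$ is a right Cartan–Eilenberg category), and for every sheaf $F$ the presheaf $\mathbb H_{\mathcal X}(F)$ is a sheaf and $\rho_F$ is a fibrant model of $F$. **Statement.** Assume that $\mathcal D$ is compatible with $\mathcal X$, and let $\mathcal E$ be $\mathrm{Op}^{\mathcal D}$, $\mathrm{Alg}^{\mathcal D}$, or $\mathrm{Alg}^{\mathcal D}_P$ for an operad $P$ in $\mathcal D$. Then $\mathcal E$ has filtered colimits and products, $\mathbb H_{\mathcal X}$ maps $\mathrm{Sh}(\mathcal X,\mathcal E)$ to itself, and: 1. For every small site $\mathcal Y$ with a set of points (defining the local equivalences $\mathcal W$ of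 sheaves on $\mathcal Y$) and every continuous morphism of sites $f:\mathcal X\to\mathcal Y$, given by a continuous functor $f^{-1}$ from the category underlying $\mathcal Y$ to that underlying $\mathcal X$, the direct image functor $f_*:\mathrm{Sh}(\mathcal X,\mathcal E)\to\mathrm{Sh}(\mathcal Y,\mathcal E)$, $(f_*F)(V)=F(f^{-1}V)$, admits a right derived functor $\mathbb R f_*:\mathrm{Sh}(\mathcal X,\mathcal E)[\mathcal W^{-1}]\to\mathrm{Sh}(\mathcal Y,\mathcal E)[\mathcal W^{-1}]$, given by $\mathbb R f_*(F)=f_*\mathbb H_{\mathcal X}(F)$ with universal morphism $f_*(\rho_F):f_*F\to f_*\mathbb H_{\mathcal X}(F)$. 2. For every object $U$ of $\mathcal X$, the sections functor $\Gamma(U,-):\mathrm{Sh}(\mathcal X,\mathcal E)\to\mathcal E$ admits a right derived functor $\mathbb R\Gamma(U,-):\mathrm{Sh}(\mathcal X,\mathcal E)[\mathcal W^{-1}]\to\mathcal E[\mathrm E^{-1}]$, given by $\mathbb R\Gamma(U,F)=\Gamma(U,\mathbb H_{\mathcal X}(F))$ with universal morphism $\Gamma(U,\rho_F)$. 3. In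 particular, if $\mathcal X$ has a final object $X_0$, any right derived functor $\mathbb R\Gamma(X_0,-)$ of $\Gamma(X_0,-)$ satisfies $\mathbb R\Gamma(X_0,F)\cong\Gamma(X_0,\mathbb H_{\mathcal X}(F))$, naturally in $F$ and compatibly with the universal morphisms. Here a right derived functor of $\Phi:\mathcal A\to\mathcal B$ is a left Kan extension along $\mathcal A\to\mathcal A[\mathcal W^{-1}]$ of the composite $\mathcal A\to\mathcal B\to\mathcal B[\mathcal W'^{-1}]$ of $\Phi$ and the localization of $\mathcal B$ at its (weak) equivalences. -/

import Mathlib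

set_option linter.unusedSectionVars false

open CategoryTheory MonoidalCategory Limits Opposite

namespace OperadSheaf

section Tensor

variable {C : Type*} [Category* C] [MonoidalCategory C] {ι : Type*}

/-- The tensor product `X i₁ ⊗ (X i₂ ⊗ (⋯ ⊗ 𝟙))` over a list of indices `[i₁, i₂, …]`. -/
def tl (X : ι → C) : List ι → C
  | [] => 𝟙_ C
  | i :: L => X i ⊗ tl X L

/-- Functoriality of the tensor product over a list. -/
def tlMap {X Y : ι → C} (f : ∀ i, X i ⟶ Y i) : ∀ L : List ι, tl X L ⟶ tl Y L
  | [] => 𝟙 (𝟙_ C)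
  | i :: L => f i ⊗ₘ tlMap f L

/-- The associativity isomorphism from the tensor product over a concatenation. -/
def tlSplit (X : ι → C) : ∀ L L' : List ι, tl X (L ++ L') ⟶ tl X L ⊗ tl X L'
  | [], L' => (λ_ (tl X L')).inv
  | i :: L, L' => X i ◁ tlSplit X L L' ≫ (α_ (X i) (tl X L) (tl X L')).inv

/-- Permutations of a list, written as composites of adjacent transpositions. -/
inductive Shuffle {ι : Type*} : List ι → List ι → Type _
  | nil : Shuffle [] []
  | cons (i : ι) {L L' : List ι} (w : Shuffle L L') : Shuffle (i :: L) (i :: L')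
  | swap (i j : ι) (L : List ι) : Shuffle (i :: j :: L) (j :: i :: L)
  | trans {L L' L'' : List ι} (w : Shuffle L L') (w' : Shuffle L' L'') : Shuffle L L''

/-- The permutation of the factors of a tensor product given by the symmetry. -/
def tlShuffle [BraidedCategory C] (X : ι → C) :
    ∀ {L L' : List ι}, Shuffle L L' → (tl X L ⟶ tl X L')
  | _, _, .nil => 𝟙 (𝟙_ C)
  | _, _, .cons i w => X i ◁ tlShuffle X w
  | _, _, .swap i j L =>
      (α_ (X i) (X j) (tl X L)).inv ≫ (β_ (X i) (X j)).hom ▷ tl X L ≫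
        (α_ (X j) (X i) (tl X L)).hom
  | _, _, .trans w w' => tlShuffle X w ≫ tlShuffle X w'

/-- The sum of the weights of the entries of a list. -/
def tot (wt : ι → ℕ) : List ι → ℕ
  | [] => 0
  | i :: L => wt i + tot wt L

/-- The bijection between positions induced by a permutation of a list in which the entry `i`
occupies a block of `wt i` consecutive positions. -/
def blockEquiv (wt : ι → ℕ) :
    ∀ {L L' : List ι}, Shuffle L L' → (Fin (tot wt L) ≃ Fin (tot wt L'))
  | _, _, .nil => Equiv.refl _
  | _, _, .cons _ w =>
      finSumFinEquiv.symm.trans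
        ((Equiv.sumCongr (Equiv.refl _) (blockEquiv wt w)).trans finSumFinEquiv)
  | _, _, .swap i j L =>
      (finSumFinEquiv.symm.trans (Equiv.sumCongr (Equiv.refl (Fin (wt i)))
          (finSumFinEquiv (m := wt j) (n := tot wt L)).symm)).trans <|
        ((Equiv.sumAssoc _ _ _).symm.trans
          ((Equiv.sumCongr (Equiv.sumComm _ _) (Equiv.refl _)).trans
            (Equiv.sumAssoc _ _ _))).trans <|
        (Equiv.sumCongr (Equiv.refl (Fin (wt j)))
          (finSumFinEquiv (m := wt i) (n := tot wt L))).trans finSumFinEquiv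
  | _, _, .trans w w' => (blockEquiv wt w).trans (blockEquiv wt w')

/-- The number of entries of a list. -/
abbrev cnt : List ι → ℕ := tot (fun _ => 1)

/-- A bijection between sets of `n` elements, as a permutation of `Fin n`. -/
def toPerm {a b n : ℕ} (e : Fin a ≃ Fin b) (ha : a = n) (hb : b = n) : Equiv.Perm (Fin n) :=
  (finCongr ha).symm.trans (e.trans (finCongr hb))

/-- Concatenation of a list of lists. -/
def flat {β : Type*} (inp : β → List ι) : List β → List ι
  | [] => []
  | b :: B => inp b ++ flat inp B

/-- Given operations `g b : P (dom b) ⊗ X (i₁) ⊗ ⋯ ⊗ X (iₖ) ⟶ X (out b)`, where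
`[i₁, …, iₖ] = inp b`, apply them simultaneously, after a reordering of the factors. -/
def applyAll [BraidedCategory C] {κ β : Type*} {P : κ → C} {X : ι → C}
    {dom : β → κ} {inp : β → List ι} {out : β → ι}
    (g : ∀ b, P (dom b) ⊗ tl X (inp b) ⟶ X (out b)) :
    ∀ B : List β, tl P (B.map dom) ⊗ tl X (flat inp B) ⟶ tl X (B.map out)
  | [] => (λ_ (𝟙_ C)).hom
  | b :: B =>
      (P (dom b) ⊗ tl P (B.map dom)) ◁ tlSplit X (inp b) (flat inp B) ≫
        tensorμ (P (dom b)) (tl P (B.map dom)) (tl X (inp b)) (tl X (flat inp B)) ≫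
          (g b ⊗ₘ applyAll g B)

/-- Tensor powers of a morphism from the unit object. -/
def unitPow {X : ι → C} {i : ι} (η : 𝟙_ C ⟶ X i) :
    ∀ k : ℕ, 𝟙_ C ⟶ tl X (List.replicate k i)
  | 0 => 𝟙 (𝟙_ C)
  | k + 1 => (λ_ (𝟙_ C)).inv ≫ (η ⊗ₘ unitPow η k)

/-- Apply to each factor the endomorphism given by the second component. -/
def actAll {G : ι → Type*} {X : ι → C} (ρ : ∀ i, G i → (X i ⟶ X i)) :
    ∀ T : List (Σ i, G i), tl X (T.map Sigma.fst) ⟶ tl X (T.map Sigma.fst)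
  | [] => 𝟙 (𝟙_ C)
  | t :: T => ρ t.1 t.2 ⊗ₘ actAll ρ T

/-- The block sum of permutations. -/
def sumPerm {wt : ι → ℕ} : ∀ T : List (Σ i, Equiv.Perm (Fin (wt i))),
    Equiv.Perm (Fin (tot wt (T.map Sigma.fst)))
  | [] => Equiv.refl _
  | t :: T => finSumFinEquiv.symm.trans ((Equiv.sumCongr t.2 (sumPerm T)).trans finSumFinEquiv)

end Tensor

section Operad

/-- The size of a list of arities. -/
abbrev sz : List ℕ+ → ℕ := tot (fun m : ℕ+ => (m : ℕ))

/-- An operation of arity `m` together with a list of arities of operations to be plugged into it,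
of total arity `k`. -/
structure Plug where
  m : ℕ+
  inp : List ℕ+
  k : ℕ+
  cnt_eq : cnt inp = m
  sz_eq : sz inp = k

variable (C : Type*) [Category* C] [MonoidalCategory C] [SymmetricCategory C]

/-- Unital `Σ`-operads `(P(l))_{l ≥ 1}` in a symmetric monoidal category. The structure morphism
`P(l) ⊗ P(m₁) ⊗ ⋯ ⊗ P(m_l) ⟶ P(n)`, for `n = m₁ + ⋯ + m_l`, is `comp [m₁, …, m_l] l n`. -/
structure Operad where
  obj : ℕ+ → C
  /-- the right action of the symmetric groups -/
  act : ∀ l : ℕ+, Equiv.Perm (Fin l) → (obj l ⟶ obj l)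
  act_one : ∀ l, act l 1 = 𝟙 (obj l)
  act_mul : ∀ (l : ℕ+) (σ τ : Equiv.Perm (Fin l)), act l (σ * τ) = act l σ ≫ act l τ
  unit : 𝟙_ C ⟶ obj 1
  comp : ∀ (ms : List ℕ+) (l n : ℕ+), cnt ms = l → sz ms = n → (obj l ⊗ tl obj ms ⟶ obj n)
  unit_comp : ∀ (n : ℕ+) (h : cnt [n] = (1 : ℕ+)) (h' : sz [n] = n),
    (λ_ (obj n)).inv ≫ (unit ⊗ₘ (ρ_ (obj n)).inv) ≫ comp [n] 1 n h h' = 𝟙 (obj n)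
  comp_unit : ∀ (l : ℕ+) (h : cnt (List.replicate (l : ℕ) (1 : ℕ+)) = l)
    (h' : sz (List.replicate (l : ℕ) (1 : ℕ+)) = l),
    (ρ_ (obj l)).inv ≫ obj l ◁ unitPow unit l ≫ comp (List.replicate (l : ℕ) 1) l l h h' =
      𝟙 (obj l)
  assoc : ∀ (B : List Plug) (l n N : ℕ+)
    (h₁ : cnt (B.map Plug.m) = l) (h₂ : sz (B.map Plug.m) = n)
    (h₃ : cnt (flat Plug.inp B) = n) (h₄ : sz (flat Plug.inp B) = N)
    (h₅ : cnt (B.map Plug.k) = l) (h₆ : sz (B.map Plug.k) = N),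
    (α_ _ _ _).inv ≫ comp (B.map Plug.m) l n h₁ h₂ ▷ tl obj (flat Plug.inp B) ≫
        comp (flat Plug.inp B) n N h₃ h₄ =
      obj l ◁ applyAll (fun b : Plug => comp b.inp b.m b.k b.cnt_eq b.sz_eq) B ≫
        comp (B.map Plug.k) l N h₅ h₆
  comp_act : ∀ (T : List (Σ m : ℕ+, Equiv.Perm (Fin m))) (l n : ℕ+)
    (h : cnt (T.map Sigma.fst) = l) (h' : sz (T.map Sigma.fst) = n),
    obj l ◁ actAll act T ≫ comp (T.map Sigma.fst) l n h h' =
      comp (T.map Sigma.fst) l n h h' ≫ act n (toPerm (sumPerm T) h' h')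
  act_comp : ∀ {ms ms' : List ℕ+} (w : Shuffle ms ms') (l n : ℕ+)
    (h : cnt ms = l) (h' : sz ms = n) (k : cnt ms' = l) (k' : sz ms' = n),
    act l (toPerm (blockEquiv (fun _ => 1) w) h k) ▷ tl obj ms ≫ comp ms l n h h' =
      obj l ◁ tlShuffle obj w ≫ comp ms' l n k k' ≫
        act n (toPerm (blockEquiv (fun m : ℕ+ => (m : ℕ)) w) h' k')

variable {C}

namespace Operad

/-- Morphisms of operads. -/
@[ext]
structure Hom (P Q : Operad C) where
  app : ∀ l, P.obj l ⟶ Q.obj l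
  act : ∀ l σ, P.act l σ ≫ app l = app l ≫ Q.act l σ
  unit : P.unit ≫ app 1 = Q.unit
  comp : ∀ ms l n h h', P.comp ms l n h h' ≫ app n =
    (app l ⊗ₘ tlMap app ms) ≫ Q.comp ms l n h h'

end Operad

end Operad

section TensorLemmas

variable {C : Type*} [Category* C] [MonoidalCategory C] {ι : Type*}

@[simp]
lemma tlMap_id (X : ι → C) (L : List ι) : tlMap (fun i => 𝟙 (X i)) L = 𝟙 (tl X L) := by
  induction L with
  | nil => rfl
  | cons i L ih => simp only [tlMap, ih, id_tensorHom_id]; rfl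

@[simp]
lemma tlMap_comp {X Y Z : ι → C} (f : ∀ i, X i ⟶ Y i) (g : ∀ i, Y i ⟶ Z i) (L : List ι) :
    tlMap f L ≫ tlMap g L = tlMap (fun i => f i ≫ g i) L := by
  induction L with
  | nil => exact Category.comp_id _
  | cons i L ih => exact (tensorHom_comp_tensorHom _ _ _ _).trans (by rw [ih]; rfl)

end TensorLemmas

section OperadCat

variable {C : Type*} [Category* C] [MonoidalCategory C] [SymmetricCategory C]

instance : Category (Operad C) where
  Hom := Operad.Hom
  id P := { app := fun l => 𝟙 _, act := by simp, unit := by simp, comp := by simp }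
  comp f g :=
    { app := fun l => f.app l ≫ g.app l
      act := fun l σ => by rw [← Category.assoc, f.act, Category.assoc, g.act, Category.assoc]
      unit := by rw [← Category.assoc, f.unit, g.unit]
      comp := fun ms l n h h' => by
        rw [← Category.assoc, f.comp, Category.assoc, g.comp, ← Category.assoc,
          tensorHom_comp_tensorHom, tlMap_comp] }
  id_comp f := by apply Operad.Hom.ext; funext l; simp
  comp_id f := by apply Operad.Hom.ext; funext l; simp
  assoc f g h := by apply Operad.Hom.ext; funext l; simp

@[ext]
lemma Operad.hom_ext {P Q : Operad C} {f g : P ⟶ Q} (h : ∀ l, f.app l = g.app l) : f = g :=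
  Operad.Hom.ext (funext h)

@[simp] lemma Operad.id_app (P : Operad C) (l : ℕ+) : Operad.Hom.app (𝟙 P) l = 𝟙 (P.obj l) := rfl
@[simp] lemma Operad.comp_app {P Q R : Operad C} (f : P ⟶ Q) (g : Q ⟶ R) (l : ℕ+) :
    (f ≫ g).app l = f.app l ≫ g.app l := rfl

end OperadCat


section Lax

open Functor.LaxMonoidal

variable {C : Type*} [Category* C] [MonoidalCategory C]
variable {A : Type*} [Category* A] [MonoidalCategory A] (F : A ⥤ C)

lemma lax_split_step [F.LaxMonoidal] {X T U V : A} {t u v : C} {k : t ⟶ F.obj T} {σ : T ⟶ U ⊗ V}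
    {s : t ⟶ u ⊗ v} {ku : u ⟶ F.obj U} {kv : v ⟶ F.obj V}
    (h : k ≫ F.map σ = s ≫ (ku ⊗ₘ kv) ≫ μ F U V) :
    (F.obj X ◁ k ≫ μ F X T) ≫ F.map (X ◁ σ ≫ (α_ X U V).inv) =
      (F.obj X ◁ s ≫ (α_ (F.obj X) u v).inv) ≫ ((F.obj X ◁ ku ≫ μ F X U) ⊗ₘ kv) ≫
        μ F (X ⊗ U) V := by
  rw [Functor.map_comp, Category.assoc, ← μ_natural_right_assoc, ← whiskerLeft_comp_assoc, h]
  simp only [whiskerLeft_comp, Category.assoc]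
  rw [Functor.LaxMonoidal.associativity_inv]
  simp [MonoidalCategory.tensorHom_def, ← whisker_exchange_assoc]

lemma lax_shuffle_step [BraidedCategory C] [BraidedCategory A] [F.LaxBraided] {X Y T : A} {t : C}
    (k : t ⟶ F.obj T) :
    (F.obj X ◁ (F.obj Y ◁ k ≫ μ F Y T) ≫ μ F X (Y ⊗ T)) ≫
        F.map ((α_ X Y T).inv ≫ (β_ X Y).hom ▷ T ≫ (α_ Y X T).hom) =
      ((α_ (F.obj X) (F.obj Y) t).inv ≫ (β_ (F.obj X) (F.obj Y)).hom ▷ t ≫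
        (α_ (F.obj Y) (F.obj X) t).hom) ≫
          (F.obj Y ◁ (F.obj X ◁ k ≫ μ F X T) ≫ μ F Y (X ⊗ T)) := by
  simp only [whiskerLeft_comp, Category.assoc, Functor.map_comp]
  rw [Functor.LaxMonoidal.associativity_inv_assoc, ← μ_natural_left_assoc,
    ← comp_whiskerRight_assoc, Functor.LaxBraided.braided, comp_whiskerRight_assoc,
    Functor.LaxMonoidal.associativity]
  rw [← associator_naturality_right_assoc, ← whisker_exchange_assoc,
    ← associator_inv_naturality_right_assoc]

lemma lax_apply_step [BraidedCategory C] [BraidedCategory A] [F.LaxBraided]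
    {Pb TP J R IR Xb Xo : A} {tp j r ir xo : C}
    {kp : tp ⟶ F.obj TP} {kj : j ⟶ F.obj J} {kr : r ⟶ F.obj R} {kir : ir ⟶ F.obj IR}
    {ko : xo ⟶ F.obj Xo} {s : ir ⟶ j ⊗ r} {σ : IR ⟶ J ⊗ R} {g : Pb ⊗ J ⟶ Xb}
    {aa : TP ⊗ R ⟶ Xo} {aa' : tp ⊗ r ⟶ xo}
    (h : kir ≫ F.map σ = s ≫ (kj ⊗ₘ kr) ≫ μ F J R)
    (h' : aa' ≫ ko = (kp ⊗ₘ kr) ≫ μ F TP R ≫ F.map aa) :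
    ((F.obj Pb ⊗ tp) ◁ s ≫ tensorμ (F.obj Pb) tp j r ≫
        ((F.obj Pb ◁ kj ≫ μ F Pb J ≫ F.map g) ⊗ₘ aa')) ≫ (F.obj Xb ◁ ko ≫ μ F Xb Xo) =
      ((F.obj Pb ◁ kp ≫ μ F Pb TP) ⊗ₘ kir) ≫ μ F (Pb ⊗ TP) IR ≫
        F.map ((Pb ⊗ TP) ◁ σ ≫ tensorμ Pb TP J R ≫ (g ⊗ₘ aa)) := by
  have e1 : ((F.obj Pb ◁ kp ≫ μ F Pb TP) ⊗ₘ kir) ≫ μ F (Pb ⊗ TP) IR ≫ F.map ((Pb ⊗ TP) ◁ σ) =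
      (F.obj Pb ⊗ tp) ◁ s ≫ ((F.obj Pb ◁ kp) ⊗ₘ (kj ⊗ₘ kr)) ≫
        (μ F Pb TP ⊗ₘ μ F J R) ≫ μ F (Pb ⊗ TP) (J ⊗ R) := by
    rw [← μ_natural_right, ← id_tensorHom (F.obj (Pb ⊗ TP)), tensorHom_comp_tensorHom_assoc, h,
      ← id_tensorHom (F.obj Pb ⊗ tp), tensorHom_comp_tensorHom_assoc,
      tensorHom_comp_tensorHom_assoc]
    simp
  have e2 : ((F.obj Pb ◁ kp) ⊗ₘ (kj ⊗ₘ kr)) ≫ tensorμ (F.obj Pb) (F.obj TP) (F.obj J) (F.obj R) =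
      tensorμ (F.obj Pb) tp j r ≫ ((F.obj Pb ◁ kj) ⊗ₘ (kp ⊗ₘ kr)) := by
    rw [← id_tensorHom, ← id_tensorHom, tensorμ_natural]
  rw [Functor.map_comp, Functor.map_comp, reassoc_of% e1,
    ← tensorμ_comp_μ_tensorHom_μ_comp_μ_assoc, reassoc_of% e2, ← μ_natural]
  simp only [Category.assoc]
  congr 2
  rw [← id_tensorHom (F.obj Xb), tensorHom_comp_tensorHom_assoc, h',
    tensorHom_comp_tensorHom_assoc, tensorHom_comp_tensorHom_assoc]
  simp

lemma lax_assoc_step [F.LaxMonoidal] {P T U N R : A} {t u : C} (k₁ : t ⟶ F.obj T)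
    (k₂ : u ⟶ F.obj U) (c : P ⊗ T ⟶ N) (c' : N ⊗ U ⟶ R) :
    (α_ (F.obj P) t u).inv ≫ (F.obj P ◁ k₁ ≫ μ F P T ≫ F.map c) ▷ u ≫
        F.obj N ◁ k₂ ≫ μ F N U ≫ F.map c' =
      F.obj P ◁ ((k₁ ⊗ₘ k₂) ≫ μ F T U) ≫ μ F P (T ⊗ U) ≫
        F.map ((α_ P T U).inv ≫ c ▷ U ≫ c') := by
  rw [F.map_comp, F.map_comp, whiskerLeft_comp_assoc,
    Functor.LaxMonoidal.associativity_inv_assoc, ← μ_natural_left_assoc,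
    ← whisker_exchange_assoc]
  simp [MonoidalCategory.tensorHom_def']

lemma lax_unit_step [F.LaxMonoidal] {P N R : A} (η : 𝟙_ A ⟶ P) (c : P ⊗ (N ⊗ 𝟙_ A) ⟶ R) :
    (λ_ (F.obj N)).inv ≫ ((ε F ≫ F.map η) ⊗ₘ (ρ_ (F.obj N)).inv) ≫
        F.obj P ◁ (F.obj N ◁ ε F ≫ μ F N (𝟙_ A)) ≫ μ F P (N ⊗ 𝟙_ A) ≫ F.map c =
      F.map ((λ_ N).inv ≫ (η ⊗ₘ (ρ_ N).inv) ≫ c) := by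
  rw [← id_tensorHom, tensorHom_comp_tensorHom_assoc, right_unitality_inv, Category.comp_id,
    F.map_comp, F.map_comp, ← left_unitality_inv_assoc, ← μ_natural_assoc,
    ← tensorHom_id, tensorHom_comp_tensorHom_assoc, Category.id_comp]

lemma lax_lam_step [F.LaxMonoidal] {X T T' W R : A} {x t u : C} {a : x ⟶ F.obj X}
    {b : t ⟶ F.obj T} {k : u ⟶ F.obj T'} {m : t ⟶ u} {c : T ⟶ T'} {p : X ⊗ T ⟶ W} {q : W ⟶ R}
    {r : X ⊗ T' ⟶ R} (h : m ≫ k = b ≫ F.map c) (e : p ≫ q = X ◁ c ≫ r) :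
    ((a ⊗ₘ b) ≫ μ F X T ≫ F.map p) ≫ F.map q =
      (a ⊗ₘ m) ≫ (F.obj X ◁ k ≫ μ F X T' ≫ F.map r) := by
  rw [Category.assoc, Category.assoc, ← F.map_comp, e, F.map_comp, ← μ_natural_right_assoc,
    ← id_tensorHom, ← id_tensorHom, tensorHom_comp_tensorHom_assoc,
    tensorHom_comp_tensorHom_assoc, h]

lemma lax_lam_step' [F.LaxMonoidal] {X T T' R : A} {x t u : C} {a : x ⟶ F.obj X}
    {b : t ⟶ F.obj T} {k : u ⟶ F.obj T'} {m : t ⟶ u} {c : T ⟶ T'} {p : X ⊗ T ⟶ R}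
    {q : R ⟶ X ⊗ T'} (h : m ≫ k = b ≫ F.map c) (e : p ≫ q = X ◁ c) :
    ((a ⊗ₘ b) ≫ μ F X T ≫ F.map p) ≫ F.map q = (a ⊗ₘ m) ≫ (F.obj X ◁ k ≫ μ F X T') := by
  rw [Category.assoc, Category.assoc, ← F.map_comp, e, ← μ_natural_right,
    ← id_tensorHom, ← id_tensorHom, tensorHom_comp_tensorHom_assoc,
    tensorHom_comp_tensorHom_assoc, h]

lemma lax_assoc_step' [F.LaxMonoidal] {P R T U N V : A} {t u v : C} {kt : t ⟶ F.obj T}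
    {ku : u ⟶ F.obj U} {kv : v ⟶ F.obj V} {aa : t ⊗ u ⟶ v} {b : T ⊗ U ⟶ V}
    {c : P ⊗ T ⟶ N} {c' : N ⊗ U ⟶ R} {d : P ⊗ V ⟶ R}
    (h : aa ≫ kv = (kt ⊗ₘ ku) ≫ μ F T U ≫ F.map b)
    (e : (α_ P T U).inv ≫ c ▷ U ≫ c' = P ◁ b ≫ d) :
    (α_ (F.obj P) t u).inv ≫ (F.obj P ◁ kt ≫ μ F P T ≫ F.map c) ▷ u ≫
        F.obj N ◁ ku ≫ μ F N U ≫ F.map c' =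
      F.obj P ◁ aa ≫ F.obj P ◁ kv ≫ μ F P V ≫ F.map d := by
  rw [lax_assoc_step, e, F.map_comp, ← μ_natural_right_assoc, ← whiskerLeft_comp_assoc,
    Category.assoc, ← h, whiskerLeft_comp_assoc]

lemma lax_equivariance_step [F.LaxMonoidal] {P T T' R : A} {t t' : C} {k : t ⟶ F.obj T}
    {k' : t' ⟶ F.obj T'} {s : t ⟶ t'} {σ : T ⟶ T'} {a : P ⟶ P} {c : P ⊗ T ⟶ R}
    {c' : P ⊗ T' ⟶ R} (h : k ≫ F.map σ = s ≫ k') (e : a ▷ T ≫ c = P ◁ σ ≫ c') :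
    F.map a ▷ t ≫ F.obj P ◁ k ≫ μ F P T ≫ F.map c =
      F.obj P ◁ s ≫ F.obj P ◁ k' ≫ μ F P T' ≫ F.map c' := by
  rw [← whisker_exchange_assoc, μ_natural_left_assoc, ← whiskerLeft_comp_assoc, ← h,
    whiskerLeft_comp_assoc, μ_natural_right_assoc, ← F.map_comp, ← F.map_comp, e]

lemma restrict_unit_step {X Y Z Z' R : C} (u : X ⟶ Y) (f : Y ⟶ Z) (r : Z' ⟶ R) {W : C}
    (a : Z ⊗ R ⟶ W) : (u ⊗ₘ r) ≫ f ▷ R ≫ a = ((u ≫ f) ⊗ₘ r) ≫ a := by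
  rw [← tensorHom_id, tensorHom_comp_tensorHom_assoc, Category.comp_id]

lemma restrict_assoc_step {P P' T T' U N N' V W : C} {p : P ⟶ P'} {t : T ⟶ T'} {n : N ⟶ N'}
    {c : P ⊗ T ⟶ N} {c' : P' ⊗ T' ⟶ N'} {b : T ⊗ U ⟶ V} {b' : T' ⊗ U ⟶ V}
    {a : N' ⊗ U ⟶ W} {d : P' ⊗ V ⟶ W}
    (hc : c ≫ n = (p ⊗ₘ t) ≫ c') (hb : (t ⊗ₘ 𝟙 U) ≫ b' = b ≫ 𝟙 V)
    (h : (α_ P' T' U).inv ≫ c' ▷ U ≫ a = P' ◁ b' ≫ d) :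
    (α_ P T U).inv ≫ c ▷ U ≫ n ▷ U ≫ a = P ◁ b ≫ p ▷ V ≫ d := by
  rw [Category.comp_id] at hb
  rw [← comp_whiskerRight_assoc, hc, comp_whiskerRight_assoc, ← hb, whiskerLeft_comp_assoc,
    whisker_exchange_assoc, ← h, tensorHom_id, ← tensorHom_id, ← associator_inv_naturality_assoc,
    MonoidalCategory.tensorHom_def', Category.assoc, tensorHom_id]

lemma lax_map_step [F.LaxMonoidal] {P P' T T' R R' : A} {t t' : C} {k : t ⟶ F.obj T}
    {k' : t' ⟶ F.obj T'} {s : t ⟶ t'} {σ : T ⟶ T'} {p : P ⟶ P'} {r : R ⟶ R'} {c : P ⊗ T ⟶ R}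
    {c' : P' ⊗ T' ⟶ R'} (h : s ≫ k' = k ≫ F.map σ) (e : c ≫ r = (p ⊗ₘ σ) ≫ c') :
    (F.obj P ◁ k ≫ μ F P T ≫ F.map c) ≫ F.map r =
      (F.map p ⊗ₘ s) ≫ (F.obj P' ◁ k' ≫ μ F P' T' ≫ F.map c') := by
  rw [← id_tensorHom (F.obj P'), tensorHom_comp_tensorHom_assoc, h, Category.comp_id,
    Category.assoc, Category.assoc, ← F.map_comp, e, F.map_comp, ← μ_natural_assoc,
    ← id_tensorHom (F.obj P), tensorHom_comp_tensorHom_assoc, Category.id_comp]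

lemma restrict_act_step {P Q T T' R R' : C} {p : P ⟶ Q} {q : Q ⟶ Q} {a : Q ⊗ T ⟶ R}
    {r : R ⟶ R'} {m : T ⟶ T'} {b : Q ⊗ T' ⟶ R'} (hq : q = 𝟙 Q)
    (h : a ≫ r = (q ⊗ₘ m) ≫ b) :
    (p ▷ T ≫ a) ≫ r = P ◁ m ≫ p ▷ T' ≫ b := by
  rw [Category.assoc, h, hq, id_tensorHom, whisker_exchange_assoc]

end Lax

section Transport

open Functor.LaxMonoidal

variable {C : Type*} [Category* C] [MonoidalCategory C] {ι : Type*}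
variable {I : Type*} [Category* I]

/-- The object-wise tensor product of diagrams over a list. -/
def tlF (X : ι → I ⥤ C) (L : List ι) : I ⥤ C where
  obj n := tl (fun i => (X i).obj n) L
  map f := tlMap (fun i => (X i).map f) L
  map_id n := by simp
  map_comp f g := by simp

variable (S : (I ⥤ C) ⥤ C)

/-- The iterated Künneth morphism of a lax monoidal functor. -/
def kun [S.LaxMonoidal] (X : ι → I ⥤ C) : ∀ L : List ι, tl (fun i => S.obj (X i)) L ⟶ S.obj (tlF X L)
  | [] => ε S
  | i :: L => S.obj (X i) ◁ kun X L ≫ μ S (X i) (tlF X L)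

lemma tlSplit_nat {X Y : ι → C} (f : ∀ i, X i ⟶ Y i) (L L' : List ι) :
    tlMap f (L ++ L') ≫ tlSplit Y L L' = tlSplit X L L' ≫ (tlMap f L ⊗ₘ tlMap f L') := by
  induction L with
  | nil => exact (leftUnitor_inv_naturality _).trans (by rw [← id_tensorHom]; rfl)
  | cons i L ih =>
    change (f i ⊗ₘ tlMap f (L ++ L')) ≫ Y i ◁ tlSplit Y L L' ≫ (α_ _ _ _).inv =
      (X i ◁ tlSplit X L L' ≫ (α_ _ _ _).inv) ≫ ((f i ⊗ₘ tlMap f L) ⊗ₘ tlMap f L')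
    rw [← id_tensorHom, tensorHom_comp_tensorHom_assoc, ih, Category.assoc,
      ← associator_inv_naturality, ← id_tensorHom, tensorHom_comp_tensorHom_assoc]
    simp


lemma tlShuffle_nat [BraidedCategory C] {X Y : ι → C} (f : ∀ i, X i ⟶ Y i) {L L' : List ι}
    (w : Shuffle L L') : tlMap f L ≫ tlShuffle Y w = tlShuffle X w ≫ tlMap f L' := by
  induction w with
  | nil => rfl
  | @cons i L L' w ih =>
    change (f i ⊗ₘ tlMap f L) ≫ Y i ◁ tlShuffle Y w = X i ◁ tlShuffle X w ≫ (f i ⊗ₘ tlMap f L')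
    rw [← id_tensorHom, ← id_tensorHom, tensorHom_comp_tensorHom, ih, tensorHom_comp_tensorHom]
    simp
  | swap i j L =>
    change (f i ⊗ₘ (f j ⊗ₘ tlMap f L)) ≫ (α_ _ _ _).inv ≫ (β_ _ _).hom ▷ _ ≫ (α_ _ _ _).hom =
      ((α_ _ _ _).inv ≫ (β_ _ _).hom ▷ _ ≫ (α_ _ _ _).hom) ≫ (f j ⊗ₘ (f i ⊗ₘ tlMap f L))
    rw [associator_inv_naturality_assoc, ← tensorHom_id, ← tensorHom_id,
      tensorHom_comp_tensorHom_assoc, BraidedCategory.braiding_naturality]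
    simp only [Category.assoc]
    rw [← associator_naturality, tensorHom_comp_tensorHom_assoc]
    simp
  | trans w w' ih ih' =>
    change tlMap f _ ≫ tlShuffle Y w ≫ tlShuffle Y w' =
      (tlShuffle X w ≫ tlShuffle X w') ≫ tlMap f _
    rw [← Category.assoc, ih, Category.assoc, ih', Category.assoc]

lemma applyAll_nat [BraidedCategory C] {κ β : Type*} {P P' : κ → C} {X X' : ι → C}
    {dom : β → κ} {inp : β → List ι} {out : β → ι}
    {g : ∀ b, P (dom b) ⊗ tl X (inp b) ⟶ X (out b)}
    {g' : ∀ b, P' (dom b) ⊗ tl X' (inp b) ⟶ X' (out b)}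
    (p : ∀ k, P k ⟶ P' k) (x : ∀ i, X i ⟶ X' i)
    (h : ∀ b, (p (dom b) ⊗ₘ tlMap x (inp b)) ≫ g' b = g b ≫ x (out b)) (B : List β) :
    (tlMap p (B.map dom) ⊗ₘ tlMap x (flat inp B)) ≫ applyAll g' B =
      applyAll g B ≫ tlMap x (B.map out) := by
  induction B with
  | nil =>
    change (𝟙 (𝟙_ C) ⊗ₘ 𝟙 (𝟙_ C)) ≫ (λ_ (𝟙_ C)).hom = (λ_ (𝟙_ C)).hom ≫ 𝟙 (𝟙_ C)
    simp
  | cons b B ih =>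
    change ((p (dom b) ⊗ₘ tlMap p (B.map dom)) ⊗ₘ tlMap x (inp b ++ flat inp B)) ≫
        _ ◁ tlSplit X' (inp b) (flat inp B) ≫ tensorμ _ _ _ _ ≫ (g' b ⊗ₘ applyAll g' B) =
      (_ ◁ tlSplit X (inp b) (flat inp B) ≫ tensorμ _ _ _ _ ≫ (g b ⊗ₘ applyAll g B)) ≫
        (x (out b) ⊗ₘ tlMap x (B.map out))
    have e : ((p (dom b) ⊗ₘ tlMap p (B.map dom)) ⊗ₘ (tlSplit X (inp b) (flat inp B) ≫
          (tlMap x (inp b) ⊗ₘ tlMap x (flat inp B)))) =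
        _ ◁ tlSplit X (inp b) (flat inp B) ≫ ((p (dom b) ⊗ₘ tlMap p (B.map dom)) ⊗ₘ
          (tlMap x (inp b) ⊗ₘ tlMap x (flat inp B))) := by
      rw [← id_tensorHom, tensorHom_comp_tensorHom, Category.id_comp]
    rw [← id_tensorHom (P' (dom b) ⊗ tl P' (B.map dom)), tensorHom_comp_tensorHom_assoc,
      tlSplit_nat, Category.comp_id, e,
      Category.assoc, Category.assoc, Category.assoc, tensorHom_comp_tensorHom, ← h, ← ih,
      ← tensorHom_comp_tensorHom, tensorμ_natural_assoc]

lemma unitPow_nat {X Y : ι → C} (f : ∀ i, X i ⟶ Y i) {i : ι} (η : 𝟙_ C ⟶ X i) (k : ℕ) :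
    unitPow η k ≫ tlMap f (List.replicate k i) = unitPow (X := Y) (η ≫ f i) k := by
  induction k with
  | zero => exact Category.comp_id _
  | succ k ih =>
    change ((λ_ (𝟙_ C)).inv ≫ (η ⊗ₘ unitPow η k)) ≫ (f i ⊗ₘ tlMap f (List.replicate k i)) =
      (λ_ (𝟙_ C)).inv ≫ ((η ≫ f i) ⊗ₘ unitPow (X := Y) (η ≫ f i) k)
    rw [Category.assoc, tensorHom_comp_tensorHom, ih]

lemma actAll_nat {G : ι → Type*} {X Y : ι → C} {ρ : ∀ i, G i → (X i ⟶ X i)}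
    {ρ' : ∀ i, G i → (Y i ⟶ Y i)} (f : ∀ i, X i ⟶ Y i)
    (h : ∀ i g, f i ≫ ρ' i g = ρ i g ≫ f i) (T : List (Σ i, G i)) :
    tlMap f (T.map Sigma.fst) ≫ actAll ρ' T = actAll ρ T ≫ tlMap f (T.map Sigma.fst) := by
  induction T with
  | nil => rfl
  | cons t T ih =>
    change (f t.1 ⊗ₘ tlMap f (T.map Sigma.fst)) ≫ (ρ' t.1 t.2 ⊗ₘ actAll ρ' T) =
      (ρ t.1 t.2 ⊗ₘ actAll ρ T) ≫ (f t.1 ⊗ₘ tlMap f (T.map Sigma.fst))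
    rw [tensorHom_comp_tensorHom, tensorHom_comp_tensorHom, ih, h]

/-- Tensor products over a list of morphisms of diagrams. -/
def tlMapF {X Y : ι → I ⥤ C} (f : ∀ i, X i ⟶ Y i) (L : List ι) : tlF X L ⟶ tlF Y L where
  app n := tlMap (fun i => (f i).app n) L
  naturality n n' g := by
    simp only [tlF, tlMap_comp, NatTrans.naturality]

lemma kun_nat [S.LaxMonoidal] {X Y : ι → I ⥤ C} (f : ∀ i, X i ⟶ Y i) (L : List ι) :
    tlMap (fun i => S.map (f i)) L ≫ kun S Y L = kun S X L ≫ S.map (tlMapF f L) := by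
  induction L with
  | nil =>
    change 𝟙 (𝟙_ C) ≫ ε S = ε S ≫ S.map (𝟙 (𝟙_ (I ⥤ C)))
    simp
  | cons i L ih =>
    change (S.map (f i) ⊗ₘ tlMap (fun i => S.map (f i)) L) ≫
        (S.obj (Y i) ◁ kun S Y L ≫ μ S (Y i) (tlF Y L)) =
      (S.obj (X i) ◁ kun S X L ≫ μ S (X i) (tlF X L)) ≫ S.map (f i ⊗ₘ tlMapF f L)
    rw [Category.assoc, ← μ_natural, ← id_tensorHom, ← id_tensorHom,
      tensorHom_comp_tensorHom_assoc, tensorHom_comp_tensorHom_assoc, ih]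
    simp

/-- The associativity isomorphism, for diagrams. -/
def tlSplitF (X : ι → I ⥤ C) (L L' : List ι) : tlF X (L ++ L') ⟶ tlF X L ⊗ tlF X L' where
  app n := tlSplit (fun i => (X i).obj n) L L'
  naturality _ _ _ := tlSplit_nat _ _ _

lemma kun_split [S.LaxMonoidal] (X : ι → I ⥤ C) (L L' : List ι) :
    kun S X (L ++ L') ≫ S.map (tlSplitF X L L') =
      tlSplit (fun i => S.obj (X i)) L L' ≫ (kun S X L ⊗ₘ kun S X L') ≫
        μ S (tlF X L) (tlF X L') := by
  induction L with
  | nil =>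
    change kun S X L' ≫ S.map (λ_ (tlF X L')).inv =
      (λ_ _).inv ≫ (ε S ⊗ₘ kun S X L') ≫ μ S (𝟙_ (I ⥤ C)) (tlF X L')
    rw [← left_unitality_inv, MonoidalCategory.tensorHom_def']
    simp
  | cons i L ih => exact lax_split_step S ih

/-- The permutation of the factors, for diagrams. -/
def tlShuffleF [BraidedCategory C] (X : ι → I ⥤ C) {L L' : List ι} (w : Shuffle L L') :
    tlF X L ⟶ tlF X L' where
  app n := tlShuffle (fun i => (X i).obj n) w
  naturality _ _ _ := tlShuffle_nat _ _

lemma kun_shuffle [BraidedCategory C] [S.LaxBraided] (X : ι → I ⥤ C) {L L' : List ι}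
    (w : Shuffle L L') :
    kun S X L ≫ S.map (tlShuffleF X w) = tlShuffle (fun i => S.obj (X i)) w ≫ kun S X L' := by
  induction w with
  | nil =>
    change ε S ≫ S.map (𝟙 (𝟙_ (I ⥤ C))) = 𝟙 (𝟙_ C) ≫ ε S
    simp
  | @cons i L L' w ih =>
    change (S.obj (X i) ◁ kun S X L ≫ μ S (X i) (tlF X L)) ≫ S.map (X i ◁ tlShuffleF X w) =
      S.obj (X i) ◁ tlShuffle _ w ≫ (S.obj (X i) ◁ kun S X L' ≫ μ S (X i) (tlF X L'))
    rw [Category.assoc, ← μ_natural_right, ← whiskerLeft_comp_assoc, ih]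
    simp
  | swap i j L => exact lax_shuffle_step S (kun S X L)
  | @trans L L' L'' w w' ih ih' =>
    change kun S X L ≫ S.map (tlShuffleF X w ≫ tlShuffleF X w') =
      (tlShuffle _ w ≫ tlShuffle _ w') ≫ kun S X L''
    rw [S.map_comp, ← Category.assoc, ih, Category.assoc, ih', Category.assoc]

/-- Simultaneous application of operations, for diagrams. -/
def applyAllF [BraidedCategory C] {κ β : Type*} {P : κ → I ⥤ C} {X : ι → I ⥤ C}
    {dom : β → κ} {inp : β → List ι} {out : β → ι}
    (g : ∀ b, P (dom b) ⊗ tlF X (inp b) ⟶ X (out b)) (B : List β) :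
    tlF P (B.map dom) ⊗ tlF X (flat inp B) ⟶ tlF X (B.map out) where
  app n := applyAll (P := fun k => (P k).obj n) (X := fun i => (X i).obj n)
    (fun b => (g b).app n) B
  naturality _ _ f := applyAll_nat _ _ (fun b => (g b).naturality f) B

lemma kun_applyAll [BraidedCategory C] [S.LaxBraided] {κ β : Type*} {P : κ → I ⥤ C}
    {X : ι → I ⥤ C} {dom : β → κ} {inp : β → List ι} {out : β → ι}
    (g : ∀ b, P (dom b) ⊗ tlF X (inp b) ⟶ X (out b)) (B : List β) :
    applyAll (P := fun k => S.obj (P k)) (X := fun i => S.obj (X i))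
        (fun b => S.obj (P (dom b)) ◁ kun S X (inp b) ≫ μ S _ _ ≫ S.map (g b)) B ≫
          kun S X (B.map out) =
      (kun S P (B.map dom) ⊗ₘ kun S X (flat inp B)) ≫ μ S _ _ ≫ S.map (applyAllF g B) := by
  induction B with
  | nil =>
    change (λ_ (𝟙_ C)).hom ≫ ε S = (ε S ⊗ₘ ε S) ≫ μ S (𝟙_ (I ⥤ C)) (𝟙_ (I ⥤ C)) ≫
      S.map (λ_ (𝟙_ (I ⥤ C))).hom
    rw [MonoidalCategory.tensorHom_def', Category.assoc, ← left_unitality, leftUnitor_naturality]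
  | cons b B ih => exact lax_apply_step S (kun_split S X (inp b) (flat inp B)) ih

/-- Tensor powers of a unit, for diagrams. -/
def unitPowF {X : ι → I ⥤ C} {i : ι} (η : 𝟙_ (I ⥤ C) ⟶ X i) (k : ℕ) :
    𝟙_ (I ⥤ C) ⟶ tlF X (List.replicate k i) where
  app n := unitPow (X := fun i => (X i).obj n) (η.app n) k
  naturality n n' f := by
    have h : 𝟙 (𝟙_ C) ≫ η.app n' = η.app n ≫ (X i).map f := η.naturality f
    refine Eq.trans ?_ (unitPow_nat (Y := fun i => (X i).obj n') (fun i => (X i).map f)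
      (η.app n) k).symm
    rw [← h, Category.id_comp]
    exact Category.id_comp _

lemma kun_unitPow [S.LaxMonoidal] {X : ι → I ⥤ C} {i : ι} (η : 𝟙_ (I ⥤ C) ⟶ X i) (k : ℕ) :
    unitPow (X := fun i => S.obj (X i)) (i := i) (ε S ≫ S.map η) k ≫ kun S X (List.replicate k i) =
      ε S ≫ S.map (unitPowF η k) := by
  induction k with
  | zero =>
    change 𝟙 (𝟙_ C) ≫ ε S = ε S ≫ S.map (𝟙 (𝟙_ (I ⥤ C)))
    simp
  | succ k ih =>
    change ((λ_ (𝟙_ C)).inv ≫ ((ε S ≫ S.map η) ⊗ₘ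
        unitPow (X := fun i => S.obj (X i)) (i := i) (ε S ≫ S.map η) k)) ≫
        (S.obj (X i) ◁ kun S X (List.replicate k i) ≫ μ S (X i) (tlF X (List.replicate k i))) =
      ε S ≫ S.map ((λ_ (𝟙_ (I ⥤ C))).inv ≫ (η ⊗ₘ unitPowF η k))
    rw [S.map_comp, ← left_unitality_inv_assoc, ← μ_natural, Category.assoc, ← id_tensorHom,
      tensorHom_comp_tensorHom_assoc, ih, Category.comp_id, ← tensorHom_comp_tensorHom_assoc,
      MonoidalCategory.tensorHom_def' (ε S) (ε S), Category.assoc,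
      ← leftUnitor_inv_naturality_assoc]

/-- Simultaneous action on the factors, for diagrams. -/
def actAllF {G : ι → Type*} {X : ι → I ⥤ C} (ρ : ∀ i, G i → (X i ⟶ X i)) (T : List (Σ i, G i)) :
    tlF X (T.map Sigma.fst) ⟶ tlF X (T.map Sigma.fst) where
  app n := actAll (X := fun i => (X i).obj n) (fun i g => (ρ i g).app n) T
  naturality _ _ f := actAll_nat _ (fun i g => (ρ i g).naturality f) T

lemma kun_actAll [S.LaxMonoidal] {G : ι → Type*} {X : ι → I ⥤ C} (ρ : ∀ i, G i → (X i ⟶ X i))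
    (T : List (Σ i, G i)) :
    actAll (X := fun i => S.obj (X i)) (fun i g => S.map (ρ i g)) T ≫
        kun S X (T.map Sigma.fst) =
      kun S X (T.map Sigma.fst) ≫ S.map (actAllF ρ T) := by
  induction T with
  | nil =>
    change 𝟙 (𝟙_ C) ≫ ε S = ε S ≫ S.map (𝟙 (𝟙_ (I ⥤ C)))
    simp
  | cons t T ih =>
    change (S.map (ρ t.1 t.2) ⊗ₘ actAll (fun i g => S.map (ρ i g)) T) ≫
        (S.obj (X t.1) ◁ kun S X (T.map Sigma.fst) ≫ μ S (X t.1) (tlF X (T.map Sigma.fst))) =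
      (S.obj (X t.1) ◁ kun S X (T.map Sigma.fst) ≫ μ S (X t.1) (tlF X (T.map Sigma.fst))) ≫
        S.map (ρ t.1 t.2 ⊗ₘ actAllF ρ T)
    rw [Category.assoc, ← μ_natural, ← id_tensorHom, tensorHom_comp_tensorHom_assoc,
      tensorHom_comp_tensorHom_assoc, ih]
    simp

/-- The comparison of a constant diagram of tensor products with a tensor product of constant
diagrams. -/
def constTl (X : ι → C) (L : List ι) :
    (Functor.const I).obj (tl X L) ⟶ tlF (fun i => (Functor.const I).obj (X i)) L where
  app _ := 𝟙 _
  naturality n n' f := by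
    change 𝟙 _ ≫ 𝟙 _ = 𝟙 _ ≫ tlMap (fun i => 𝟙 (X i)) L
    simp

end Transport

section OperadTransport

open Functor.LaxMonoidal

variable {C : Type*} [Category* C] [MonoidalCategory C] [SymmetricCategory C]
variable {I : Type*} [Category* I]

namespace Operad

/-- The functor `P ↦ P(l)`. -/
@[simps]
def ev (l : ℕ+) : Operad C ⥤ C where
  obj P := P.obj l
  map f := f.app l

section

variable (Q : I ⥤ Operad C)

/-- The diagram of objects of arity `l` of a diagram of operads. -/
abbrev comps (l : ℕ+) : I ⥤ C := Q ⋙ ev l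

/-- The structure morphisms of a diagram of operads. -/
def compF (ms : List ℕ+) (l n : ℕ+) (h : cnt ms = l) (h' : sz ms = n) :
    comps Q l ⊗ tlF (comps Q) ms ⟶ comps Q n where
  app i := (Q.obj i).comp ms l n h h'
  naturality _ _ f := ((Q.map f).comp ms l n h h').symm

/-- The unit of a diagram of operads. -/
def unitF : 𝟙_ (I ⥤ C) ⟶ comps Q 1 where
  app i := (Q.obj i).unit
  naturality _ _ f := (Category.id_comp _).trans (Q.map f).unit.symm

/-- The action of a permutation on a diagram of operads. -/
def actF (l : ℕ+) (σ : Equiv.Perm (Fin l)) : comps Q l ⟶ comps Q l where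
  app i := (Q.obj i).act l σ
  naturality _ _ f := ((Q.map f).act l σ).symm

variable (S : (I ⥤ C) ⥤ C) [S.LaxBraided]

/-- The operad `S(Q)`, defined arity-wise, for a diagram of operads `Q` and a lax symmetric
monoidal functor `S`. -/
def liftObj : Operad C where
  obj l := S.obj (comps Q l)
  act l σ := S.map (actF Q l σ)
  act_one l := by
    rw [← S.map_id]
    congr 1
    ext i
    exact (Q.obj i).act_one l
  act_mul l σ τ := by
    rw [← S.map_comp]
    congr 1
    ext i
    exact (Q.obj i).act_mul l σ τ
  unit := ε S ≫ S.map (unitF Q)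
  comp ms l n h h' := S.obj (comps Q l) ◁ kun S (comps Q) ms ≫ μ S _ _ ≫ S.map (compF Q ms l n h h')
  unit_comp n h h' := by
    refine (lax_unit_step S (unitF Q) (compF Q [n] 1 n h h')).trans ?_
    rw [← S.map_id]
    congr 1
    ext i
    exact (Q.obj i).unit_comp n h h'
  comp_unit l h h' := by
    rw [← whiskerLeft_comp_assoc, kun_unitPow, whiskerLeft_comp_assoc, μ_natural_right_assoc,
      right_unitality_inv_assoc, ← S.map_comp, ← S.map_comp, ← S.map_id]
    congr 1
    ext i
    exact (Q.obj i).comp_unit l h h'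
  assoc B l n N h₁ h₂ h₃ h₄ h₅ h₆ := by
    refine (lax_assoc_step S _ _ _ _).trans ?_
    have e : (α_ _ _ _).inv ≫ compF Q (B.map Plug.m) l n h₁ h₂ ▷ tlF (comps Q) (flat Plug.inp B) ≫
        compF Q (flat Plug.inp B) n N h₃ h₄ =
      comps Q l ◁ applyAllF (fun b : Plug => compF Q b.inp b.m b.k b.cnt_eq b.sz_eq) B ≫
        compF Q (B.map Plug.k) l N h₅ h₆ := by
      ext i
      exact (Q.obj i).assoc B l n N h₁ h₂ h₃ h₄ h₅ h₆
    rw [e, S.map_comp, ← μ_natural_right_assoc, ← whiskerLeft_comp_assoc, Category.assoc,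
      ← kun_applyAll, whiskerLeft_comp_assoc]
  comp_act T l n h h' := by
    rw [← whiskerLeft_comp_assoc, kun_actAll, whiskerLeft_comp_assoc, μ_natural_right_assoc,
      Category.assoc, Category.assoc, ← S.map_comp, ← S.map_comp]
    congr 3
    ext i
    exact (Q.obj i).comp_act T l n h h'
  act_comp {ms ms'} w l n h h' k k' := by
    rw [← whisker_exchange_assoc, μ_natural_left_assoc, Category.assoc, Category.assoc,
      ← whiskerLeft_comp_assoc, ← kun_shuffle, whiskerLeft_comp_assoc,
      μ_natural_right_assoc, ← S.map_comp, ← S.map_comp, ← S.map_comp]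
    congr 3
    ext i
    exact (Q.obj i).act_comp w l n h h' k k'

/-- The functor `Q ↦ S(Q)` on diagrams of operads. -/
def lift : (I ⥤ Operad C) ⥤ Operad C where
  obj Q := liftObj Q S
  map {Q R} f :=
    { app := fun l => S.map (Functor.whiskerRight f (ev l))
      act := fun l σ => by
        change S.map _ ≫ S.map _ = S.map _ ≫ S.map _
        rw [← S.map_comp, ← S.map_comp]
        congr 1
        ext i
        exact (f.app i).act l σ
      unit := by
        change (ε S ≫ S.map _) ≫ S.map _ = ε S ≫ S.map _
        rw [Category.assoc, ← S.map_comp]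
        congr 2
        ext i
        exact (f.app i).unit
      comp := fun ms l n h h' => by
        change (_ ◁ kun S (comps Q) ms ≫ μ S _ _ ≫ S.map (compF Q ms l n h h')) ≫ S.map _ =
          (S.map (Functor.whiskerRight f (ev l)) ⊗ₘ
            tlMap (fun l => S.map (Functor.whiskerRight f (ev l))) ms) ≫
              (_ ◁ kun S (comps R) ms ≫ μ S _ _ ≫ S.map (compF R ms l n h h'))
        rw [← id_tensorHom (S.obj (R ⋙ ev l)), tensorHom_comp_tensorHom_assoc, kun_nat,
          Category.comp_id, Category.assoc, Category.assoc, ← S.map_comp,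
          ← id_tensorHom (S.obj (comps Q l))]
        have e : compF Q ms l n h h' ≫ Functor.whiskerRight f (ev n) =
            (Functor.whiskerRight f (ev l) ⊗ₘ
              tlMapF (fun l => Functor.whiskerRight f (ev l)) ms) ≫ compF R ms l n h h' := by
          ext i
          exact (f.app i).comp ms l n h h'
        rw [e, S.map_comp, ← μ_natural_assoc, tensorHom_comp_tensorHom_assoc, Category.id_comp] }
  map_id Q := by
    ext l
    exact S.map_id _
  map_comp f g := by
    ext l
    exact S.map_comp (Functor.whiskerRight f (ev l)) (Functor.whiskerRight g (ev l))

end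

end Operad

/-- The constant diagram functor is monoidal. -/
instance constMonoidal : (Functor.const I : C ⥤ I ⥤ C).Monoidal :=
  Functor.CoreMonoidal.toMonoidal
    { εIso := Iso.refl _
      μIso := fun X Y => NatIso.ofComponents (fun _ => Iso.refl (X ⊗ Y))
      μIso_hom_natural_left := fun f X => by
        ext i
        exact (Category.comp_id _).trans (Category.id_comp _).symm
      μIso_hom_natural_right := fun X f => by
        ext i
        exact (Category.comp_id _).trans (Category.id_comp _).symm
      associativity := fun X Y Z => by
        ext i
        change 𝟙 _ ▷ Z ≫ 𝟙 _ ≫ (α_ X Y Z).hom = (α_ X Y Z).hom ≫ X ◁ 𝟙 _ ≫ 𝟙 _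
        simp
      left_unitality := fun X => by
        ext i
        change (λ_ X).hom = 𝟙 _ ▷ X ≫ 𝟙 _ ≫ (λ_ X).hom
        simp
      right_unitality := fun X => by
        ext i
        change (ρ_ X).hom = X ◁ 𝟙 _ ≫ 𝟙 _ ≫ (ρ_ X).hom
        simp }

section Lam

variable (S : (I ⥤ C) ⥤ C) [S.LaxBraided] (lam : 𝟭 C ⟶ Functor.const I ⋙ S)

lemma lam_unit [NatTrans.IsMonoidal lam] : lam.app (𝟙_ C) = ε S := by
  have h := NatTrans.IsMonoidal.unit (τ := lam)
  rw [Functor.LaxMonoidal.comp_ε] at h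
  change 𝟙 (𝟙_ C) ≫ lam.app (𝟙_ C) = ε S ≫ S.map (𝟙 (𝟙_ (I ⥤ C))) at h
  exact (Category.id_comp _).symm.trans (h.trans (by
    rw [S.map_id]; exact Category.comp_id _))

lemma lam_tensor [NatTrans.IsMonoidal lam] (X Y : C) :
    lam.app (X ⊗ Y) = (lam.app X ⊗ₘ lam.app Y) ≫
      μ S ((Functor.const I).obj X) ((Functor.const I).obj Y) ≫
        S.map (μ (Functor.const I) X Y) := by
  have h := NatTrans.IsMonoidal.tensor (τ := lam) X Y
  rw [Functor.LaxMonoidal.comp_μ] at h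
  exact (Category.id_comp _).symm.trans h

lemma lam_kun [NatTrans.IsMonoidal lam] {ι : Type*} (X : ι → C) (L : List ι) :
    tlMap (fun i => lam.app (X i)) L ≫ kun S (fun i => (Functor.const I).obj (X i)) L =
      lam.app (tl X L) ≫ S.map (constTl X L) := by
  induction L with
  | nil =>
    refine (Category.id_comp (ε S)).trans ?_
    have e : S.map (constTl (I := I) X []) = 𝟙 _ := S.map_id (𝟙_ (I ⥤ C))
    exact (lam_unit S lam).symm.trans ((Category.comp_id _).symm.trans (congrArg _ e.symm))
  | cons i L ih =>
    have e : μ (Functor.const I) (X i) (tl X L) ≫ constTl (I := I) X (i :: L) =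
        (Functor.const I).obj (X i) ◁ constTl X L := by
      ext n
      exact (Category.id_comp _).trans (whiskerLeft_id _ _).symm
    have e' := lam_tensor S lam (X i) (tl X L)
    exact ((lax_lam_step' S (a := lam.app (X i)) ih e).symm).trans
      (congrArg (· ≫ S.map (constTl (I := I) X (i :: L))) e'.symm)

/-- The morphism of operads `P ⟶ S(c P)`. -/
def Operad.liftLam [NatTrans.IsMonoidal lam] :
    𝟭 (Operad C) ⟶ Functor.const I ⋙ Operad.lift S where
  app P :=
    { app := fun l => lam.app (P.obj l)
      act := fun l σ => lam.naturality (P.act l σ)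
      unit := by
        refine (lam.naturality P.unit).trans ?_
        rw [lam_unit]
        rfl
      comp := fun ms l n h h' => by
        have e : μ (Functor.const I) _ _ ≫ (Functor.const I).map (P.comp ms l n h h') =
            (Functor.const I).obj (P.obj l) ◁ constTl P.obj ms ≫
              Operad.compF ((Functor.const I).obj P) ms l n h h' := by
          ext i
          change 𝟙 _ ≫ P.comp ms l n h h' = P.obj l ◁ 𝟙 _ ≫ P.comp ms l n h h'
          simp
        refine (lam.naturality (P.comp ms l n h h')).trans ?_
        rw [lam_tensor]
        exact lax_lam_step S (lam_kun S lam P.obj ms) e }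
  naturality P Q f := by
    ext l
    exact lam.naturality (f.app l)

end Lam

end OperadTransport

section Algebra

open Functor.LaxMonoidal

variable {C : Type*} [Category* C] [MonoidalCategory C] [SymmetricCategory C]

/-- An operation of arity `m` together with a list of `m` inputs. -/
structure Feed where
  m : ℕ+
  inp : List Unit
  cnt_eq : cnt inp = m

/-- Algebras over an operad `P`. Tensor powers of the underlying object are indexed by lists of
`()`: the structure morphism `P(l) ⊗ A ⊗ ⋯ ⊗ A ⟶ A` is `act l [(), …, ()]`. -/
structure AlgOver (P : Operad C) where
  carrier : C
  act : ∀ (l : ℕ+) (L : List Unit), cnt L = l →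
    (P.obj l ⊗ tl (fun _ : Unit => carrier) L ⟶ carrier)
  unit_act : ∀ h : cnt [()] = (1 : ℕ+),
    (λ_ carrier).inv ≫ (P.unit ⊗ₘ (ρ_ carrier).inv) ≫ act 1 [()] h = 𝟙 carrier
  assoc : ∀ (B : List Feed) (l n : ℕ+) (h₁ : cnt (B.map Feed.m) = l) (h₂ : sz (B.map Feed.m) = n)
    (h₃ : cnt (flat Feed.inp B) = n) (h₄ : cnt (B.map fun _ => ()) = l),
    (α_ _ _ _).inv ≫ P.comp (B.map Feed.m) l n h₁ h₂ ▷ tl (fun _ : Unit => carrier) (flat Feed.inp B) ≫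
        act n (flat Feed.inp B) h₃ =
      P.obj l ◁ applyAll (P := P.obj) (X := fun _ : Unit => carrier) (out := fun _ : Feed => ())
          (fun b : Feed => act b.m b.inp b.cnt_eq) B ≫
        act l (B.map fun _ => ()) h₄
  equivariance : ∀ {L L' : List Unit} (w : Shuffle L L') (l : ℕ+) (h : cnt L = l) (h' : cnt L' = l),
    P.act l (toPerm (blockEquiv (fun _ => 1) w) h h') ▷ tl (fun _ : Unit => carrier) L ≫ act l L h =
      P.obj l ◁ tlShuffle (fun _ : Unit => carrier) w ≫ act l L' h'

namespace AlgOver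

/-- Morphisms of algebras over an operad. -/
@[ext]
structure Hom {P : Operad C} (A B : AlgOver P) where
  map : A.carrier ⟶ B.carrier
  act : ∀ l L h, A.act l L h ≫ map = P.obj l ◁ tlMap (fun _ : Unit => map) L ≫ B.act l L h

instance (P : Operad C) : Category (AlgOver P) where
  Hom := Hom
  id A := { map := 𝟙 _, act := by simp }
  comp f g :=
    { map := f.map ≫ g.map
      act := fun l L h => by
        rw [← Category.assoc, f.act, Category.assoc, g.act, ← whiskerLeft_comp_assoc, tlMap_comp] }
  id_comp f := by apply Hom.ext; simp
  comp_id f := by apply Hom.ext; simp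
  assoc f g h := by apply Hom.ext; simp

@[ext]
lemma hom_ext {P : Operad C} {A B : AlgOver P} {f g : A ⟶ B} (h : f.map = g.map) : f = g :=
  Hom.ext h

/-- The reciprocal image of an algebra along a morphism of operads. -/
def restrict {P Q : Operad C} (f : P ⟶ Q) (B : AlgOver Q) : AlgOver P where
  carrier := B.carrier
  act l L h := f.app l ▷ tl (fun _ : Unit => B.carrier) L ≫ B.act l L h
  unit_act h := by
    refine Eq.trans (congrArg _ (restrict_unit_step _ _ _ _)) ?_
    rw [f.unit]
    exact B.unit_act h
  assoc Bs l n h₁ h₂ h₃ h₄ := by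
    have e := applyAll_nat (P := P.obj) (P' := Q.obj) (X := fun _ : Unit => B.carrier)
      (X' := fun _ : Unit => B.carrier) (out := fun _ : Feed => ())
      (g := fun b : Feed => f.app b.m ▷ tl (fun _ : Unit => B.carrier) b.inp ≫
        B.act b.m b.inp b.cnt_eq)
      (g' := fun b : Feed => B.act b.m b.inp b.cnt_eq) f.app (fun _ => 𝟙 _)
      (fun b => by simp) Bs
    rw [tlMap_id, tlMap_id] at e
    exact restrict_assoc_step (f.comp _ l n h₁ h₂) e (B.assoc Bs l n h₁ h₂ h₃ h₄)
  equivariance {L L'} w l h h' := by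
    rw [← comp_whiskerRight_assoc, f.act, comp_whiskerRight_assoc, B.equivariance w l h h',
      whisker_exchange_assoc]

end AlgOver

variable (C) in
/-- Pairs `(P, A)` of an operad `P` and a `P`-algebra `A`. -/
structure OperadAlg where
  opd : Operad C
  alg : AlgOver opd

namespace OperadAlg

/-- Morphisms `(P, A) ⟶ (Q, B)`: pairs of a morphism of operads `P ⟶ Q` and a morphism of
`P`-algebras from `A` to the reciprocal image of `B`. -/
structure Hom (X Y : OperadAlg C) where
  opd : X.opd ⟶ Y.opd
  alg : X.alg ⟶ AlgOver.restrict opd Y.alg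

/-- The morphism of underlying objects. -/
def Hom.map {X Y : OperadAlg C} (f : Hom X Y) : X.alg.carrier ⟶ Y.alg.carrier := f.alg.map

lemma Hom.ext {X Y : OperadAlg C} {f g : Hom X Y} (h : f.opd = g.opd) (h' : f.map = g.map) :
    f = g := by
  obtain ⟨a, b⟩ := f
  obtain ⟨a', b'⟩ := g
  obtain rfl : a = a' := h
  obtain rfl : b = b' := AlgOver.hom_ext h'
  rfl

lemma Hom.act {X Y : OperadAlg C} (f : Hom X Y) (l : ℕ+) (L : List Unit) (h : cnt L = l) :
    X.alg.act l L h ≫ f.map =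
      (f.opd.app l ⊗ₘ tlMap (fun _ : Unit => f.map) L) ≫ Y.alg.act l L h := by
  refine (f.alg.act l L h).trans ?_
  rw [MonoidalCategory.tensorHom_def', Category.assoc]
  rfl

/-- Constructor for morphisms. -/
def Hom.mk' {X Y : OperadAlg C} (opd : X.opd ⟶ Y.opd) (map : X.alg.carrier ⟶ Y.alg.carrier)
    (h : ∀ l L h, X.alg.act l L h ≫ map =
      (opd.app l ⊗ₘ tlMap (fun _ : Unit => map) L) ≫ Y.alg.act l L h) : Hom X Y where
  opd := opd
  alg :=
    { map := map
      act := fun l L k => by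
        refine (h l L k).trans ?_
        rw [MonoidalCategory.tensorHom_def', Category.assoc]
        rfl }

instance : Category (OperadAlg C) where
  Hom := Hom
  id X := Hom.mk' (𝟙 _) (𝟙 _) (by simp)
  comp f g := Hom.mk' (f.opd ≫ g.opd) (f.map ≫ g.map) (fun l L h => by
    rw [← Category.assoc, f.act, Category.assoc, g.act, tensorHom_comp_tensorHom_assoc,
      tlMap_comp]
    rfl)
  id_comp f := Hom.ext (Category.id_comp _) (Category.id_comp _)
  comp_id f := Hom.ext (Category.comp_id _) (Category.comp_id _)
  assoc f g h := Hom.ext (Category.assoc _ _ _) (Category.assoc _ _ _)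

@[ext]
lemma hom_ext {X Y : OperadAlg C} {f g : X ⟶ Y} (h : f.opd = g.opd) (h' : f.map = g.map) : f = g :=
  Hom.ext h h'

variable (C) in
/-- The functor `(P, A) ↦ P`. -/
@[simps]
def fst : OperadAlg C ⥤ Operad C where
  obj X := X.opd
  map f := f.opd

variable (C) in
/-- The functor `(P, A) ↦ A`, with values in the underlying category. -/
@[simps]
def snd : OperadAlg C ⥤ C where
  obj X := X.alg.carrier
  map f := f.map

end OperadAlg

variable {I : Type*} [Category* I]

namespace OperadAlg

section

variable (Q : I ⥤ OperadAlg C)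

/-- The structure morphisms of a diagram of operad algebras. -/
def actF (l : ℕ+) (L : List Unit) (h : cnt L = l) :
    Operad.comps (Q ⋙ fst C) l ⊗ tlF (fun _ : Unit => Q ⋙ snd C) L ⟶ Q ⋙ snd C where
  app i := (Q.obj i).alg.act l L h
  naturality _ _ f := ((Q.map f).act l L h).symm

variable (S : (I ⥤ C) ⥤ C) [S.LaxBraided]

/-- The operad algebra `S(Q)` for a diagram of operad algebras `Q` and a lax symmetric monoidal
functor `S`. -/
def liftObj : OperadAlg C where
  opd := Operad.liftObj (Q ⋙ fst C) S
  alg :=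
    { carrier := S.obj (Q ⋙ snd C)
      act := fun l L h => S.obj _ ◁ kun S (fun _ : Unit => Q ⋙ snd C) L ≫ μ S _ _ ≫
        S.map (actF Q l L h)
      unit_act := fun h => by
        refine (lax_unit_step S (Operad.unitF (Q ⋙ fst C)) (actF Q 1 [()] h)).trans ?_
        rw [← S.map_id]
        congr 1
        ext i
        exact (Q.obj i).alg.unit_act h
      assoc := fun B l n h₁ h₂ h₃ h₄ => by
        have e : (α_ _ _ _).inv ≫ Operad.compF (Q ⋙ fst C) (B.map Feed.m) l n h₁ h₂ ▷
              tlF (fun _ : Unit => Q ⋙ snd C) (flat Feed.inp B) ≫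
            actF Q n (flat Feed.inp B) h₃ =
          Operad.comps (Q ⋙ fst C) l ◁
            applyAllF (P := Operad.comps (Q ⋙ fst C)) (X := fun _ : Unit => Q ⋙ snd C)
              (out := fun _ : Feed => ()) (fun b : Feed => actF Q b.m b.inp b.cnt_eq) B ≫
            actF Q l (B.map fun _ => ()) h₄ := by
          ext i
          exact (Q.obj i).alg.assoc B l n h₁ h₂ h₃ h₄
        exact lax_assoc_step' S (kun_applyAll S (P := Operad.comps (Q ⋙ fst C))
          (X := fun _ : Unit => Q ⋙ snd C) (out := fun _ : Feed => ())
          (fun b : Feed => actF Q b.m b.inp b.cnt_eq) B) e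
      equivariance := fun {L L'} w l h h' => by
        refine lax_equivariance_step S (kun_shuffle S (fun _ : Unit => Q ⋙ snd C) w) ?_
        ext i
        exact (Q.obj i).alg.equivariance w l h h' }

/-- The functor `Q ↦ S(Q)` on diagrams of operad algebras. -/
def lift : (I ⥤ OperadAlg C) ⥤ OperadAlg C where
  obj Q := liftObj Q S
  map {Q R} f := Hom.mk' ((Operad.lift S).map (Functor.whiskerRight f (fst C)))
    (S.map (Functor.whiskerRight f (snd C))) (fun l L h => by
      have e : actF Q l L h ≫ Functor.whiskerRight f (snd C) =
          (Functor.whiskerRight (Functor.whiskerRight f (fst C)) (Operad.ev l) ⊗ₘ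
            tlMapF (fun _ : Unit => Functor.whiskerRight f (snd C)) L) ≫ actF R l L h := by
        ext i
        exact (f.app i).act l L h
      exact lax_map_step S (kun_nat S (fun _ : Unit => Functor.whiskerRight f (snd C)) L) e)
  map_id Q := Hom.ext ((Operad.lift S).map_id _) (S.map_id _)
  map_comp f g := Hom.ext ((Operad.lift S).map_comp (Functor.whiskerRight f (fst C))
    (Functor.whiskerRight g (fst C))) (S.map_comp (Functor.whiskerRight f (snd C))
    (Functor.whiskerRight g (snd C)))

/-- The morphism of operad algebras `(P, A) ⟶ S(c P, c A)`. -/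
def liftLam (lam : 𝟭 C ⟶ Functor.const I ⋙ S) [NatTrans.IsMonoidal lam] :
    𝟭 (OperadAlg C) ⟶ Functor.const I ⋙ lift S where
  app X := Hom.mk' ((Operad.liftLam S lam).app X.opd) (lam.app X.alg.carrier) (fun l L h => by
    have e : μ (Functor.const I) _ _ ≫ (Functor.const I).map (X.alg.act l L h) =
        (Functor.const I).obj (X.opd.obj l) ◁ constTl (fun _ : Unit => X.alg.carrier) L ≫
          actF ((Functor.const I).obj X) l L h := by
      ext i
      change 𝟙 _ ≫ X.alg.act l L h = X.opd.obj l ◁ 𝟙 _ ≫ X.alg.act l L h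
      simp
    refine (lam.naturality (X.alg.act l L h)).trans ?_
    rw [lam_tensor]
    exact lax_lam_step S (lam_kun S lam (fun _ : Unit => X.alg.carrier) L) e)
  naturality X Y f := Hom.ext ((Operad.liftLam S lam).naturality f.opd) (lam.naturality f.map)

end

end OperadAlg

namespace AlgOver

variable (P : Operad C)

/-- The underlying object of an algebra. -/
@[simps]
def forget : AlgOver P ⥤ C where
  obj A := A.carrier
  map f := f.map

/-- The inclusion `A ↦ (P, A)` of the category of `P`-algebras in the category of all operad
algebras. -/
def incl : AlgOver P ⥤ OperadAlg C where
  obj A := ⟨P, A⟩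
  map {A B} f := OperadAlg.Hom.mk' (𝟙 P) f.map (fun l L h => by
    refine (f.act l L h).trans ?_
    exact congrArg (· ≫ B.act l L h) (id_tensorHom _ _).symm)
  map_id A := OperadAlg.Hom.ext rfl rfl
  map_comp f g := OperadAlg.Hom.ext (Category.comp_id _).symm rfl

variable (S : (I ⥤ C) ⥤ C) [S.LaxBraided]
variable (lam : 𝟭 C ⟶ Functor.const I ⋙ S) [NatTrans.IsMonoidal lam]

/-- The functor `A ↦ λ_P^* S(A)` on diagrams of algebras over `P`: the algebra `S(A)` over
`S(c P)` is restricted along `λ_P : P ⟶ S(c P)`. -/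
def lift : (I ⥤ AlgOver P) ⥤ AlgOver P where
  obj A := restrict ((Operad.liftLam S lam).app P) (OperadAlg.liftObj (A ⋙ incl P) S).alg
  map {A B} f :=
    { map := S.map (Functor.whiskerRight f (forget P))
      act := fun l L h => by
        refine restrict_act_step (p := lam.app (P.obj l)) ?_
          (((OperadAlg.lift S).map (Functor.whiskerRight f (incl P))).act l L h)
        exact S.map_id _ }
  map_id A := hom_ext (S.map_id _)
  map_comp f g := hom_ext (S.map_comp (Functor.whiskerRight f (forget P))
    (Functor.whiskerRight g (forget P)))

/-- The morphism of `P`-algebras `A ⟶ λ_P^* S(c A)`. -/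
def liftLam : 𝟭 (AlgOver P) ⟶ Functor.const I ⋙ lift P S lam where
  app A :=
    { map := lam.app A.carrier
      act := fun l L h => ((OperadAlg.liftLam S lam).app ⟨P, A⟩).alg.act l L h }
  naturality _ _ f := hom_ext (lam.naturality f.map)

end AlgOver

end Algebra

section Descent

universe v u

variable (D : Type u) [Category.{v} D]

/-- The diagonal functor from bicosimplicial objects to cosimplicial objects. -/
@[simps]
def diagonal : (SimplexCategory ⥤ SimplexCategory ⥤ D) ⥤ (SimplexCategory ⥤ D) where
  obj Z :=
    { obj := fun n => (Z.obj n).obj n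
      map := fun {m n} f => (Z.map f).app m ≫ (Z.obj n).map f }
  map {Z Z'} f := { app := fun n => (f.app n).app n }

variable {D}

/-- The diagonal of a bicosimplicial object which is constant in the first direction. -/
def diagonalConst (X : SimplexCategory ⥤ D) :
    (diagonal D).obj ((Functor.const SimplexCategory).obj X) ≅ X :=
  NatIso.ofComponents (fun n => Iso.refl (X.obj n)) fun _ =>
    (Category.comp_id _).trans rfl

/-- The diagonal of a bicosimplicial object which is constant in the second direction. -/
def diagonalLevelwiseConst (X : SimplexCategory ⥤ D) :
    (diagonal D).obj (X ⋙ Functor.const SimplexCategory) ≅ X :=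
  NatIso.ofComponents (fun n => Iso.refl (X.obj n)) fun _ =>
    (Category.comp_id _).trans ((Category.comp_id _).trans (Category.id_comp _).symm)

/-- The cosimplicial object `A^{Δ[1]}`, given by `∏_{Δ[1]_n} A` in degree `n`. -/
noncomputable def pathObj [HasFiniteProducts D] (A : D) : SimplexCategory ⥤ D where
  obj n := ∏ᶜ fun _ : n ⟶ SimplexCategory.mk 1 => A
  map {m n} f := Pi.lift fun g : n ⟶ SimplexCategory.mk 1 => Pi.π (fun _ => A) (f ≫ g)
  map_id n := Limits.Pi.hom_ext _ _ fun g => by simp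
  map_comp f g := Limits.Pi.hom_ext _ _ fun h => by simp

/-- The evaluation `A^{Δ[1]} ⟶ A^{Δ[0]} = A` at a vertex of `Δ[1]`. -/
noncomputable def pathEval [HasFiniteProducts D] (A : D) (i : Fin 2) :
    pathObj A ⟶ (Functor.const SimplexCategory).obj A where
  app n := Pi.π (fun _ : n ⟶ SimplexCategory.mk 1 => A)
    (SimplexCategory.const n (SimplexCategory.mk 1) i)
  naturality m n f := by
    change Pi.lift _ ≫ Pi.π (fun _ => A) _ = Pi.π (fun _ => A) _ ≫ 𝟙 A
    rw [Pi.lift_π, Category.comp_id]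
    rfl

variable (D) in
/-- (Cosimplicial) descent structures on a category `D` with finite products: a saturated class of
equivalences and a simple functor from cosimplicial objects to objects. -/
structure DescentStructure [HasFiniteProducts D] where
  /-- the equivalences -/
  eqv : MorphismProperty D
  saturated : ∀ ⦃X Y : D⦄ (f : X ⟶ Y), eqv f ↔ IsIso (eqv.Q.map f)
  eqv_prod : ∀ ⦃X Y X' Y' : D⦄ (f : X ⟶ Y) (f' : X' ⟶ Y'), eqv f → eqv f' → eqv (prod.map f f')
  simple : (SimplexCategory ⥤ D) ⥤ D
  additivity : ∀ X Y : SimplexCategory ⥤ D, eqv (prodComparison simple X Y)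
  mu : (Functor.whiskeringRight SimplexCategory (SimplexCategory ⥤ D) D).obj simple ⋙ simple ⟶
    diagonal D ⋙ simple
  factorization : ∀ Z, eqv (mu.app Z)
  lam : 𝟭 D ⟶ Functor.const SimplexCategory ⋙ simple
  normalization : ∀ A, eqv (lam.app A)
  lam_mu : ∀ X : SimplexCategory ⥤ D,
    eqv.Q.map ((lam.app (simple.obj X) : _ ⟶ simple.obj _) ≫
      simple.map (Functor.constComp SimplexCategory X simple).inv ≫
        (mu.app ((Functor.const SimplexCategory).obj X) : _ ⟶ simple.obj _) ≫
          simple.map (diagonalConst X).hom) = 𝟙 (eqv.Q.obj (simple.obj X))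
  map_lam_mu : ∀ X : SimplexCategory ⥤ D,
    eqv.Q.map (simple.map (Functor.whiskerLeft X lam) ≫
      (mu.app (X ⋙ Functor.const SimplexCategory) : _ ⟶ simple.obj _) ≫
        simple.map (diagonalLevelwiseConst X).hom) = 𝟙 (eqv.Q.obj (simple.obj X))
  exactness : ∀ ⦃X Y : SimplexCategory ⥤ D⦄ (f : X ⟶ Y), (∀ n, eqv (f.app n)) → eqv (simple.map f)
  homotopy : ∀ A : D, eqv (simple.map (pathEval A 0))

/-- The diagonal functor is monoidal. -/
instance diagonalMonoidal [MonoidalCategory D] : (diagonal D).Monoidal :=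
  Functor.CoreMonoidal.toMonoidal
    { εIso := NatIso.ofComponents (fun _ => Iso.refl (𝟙_ D))
      μIso := fun X Y => NatIso.ofComponents (fun n => Iso.refl ((X.obj n).obj n ⊗ (Y.obj n).obj n))
        (fun {m n} f => by
          change (((X.map f).app m ≫ (X.obj n).map f) ⊗ₘ ((Y.map f).app m ≫ (Y.obj n).map f)) ≫ 𝟙 _ =
            𝟙 _ ≫ (((X.map f).app m ⊗ₘ (Y.map f).app m) ≫ ((X.obj n).map f ⊗ₘ (Y.obj n).map f))
          rw [tensorHom_comp_tensorHom, Category.id_comp, Category.comp_id])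
      μIso_hom_natural_left := fun f X => by
        ext i
        exact (Category.comp_id _).trans (Category.id_comp _).symm
      μIso_hom_natural_right := fun X f => by
        ext i
        exact (Category.comp_id _).trans (Category.id_comp _).symm
      associativity := fun X Y Z => by
        ext i
        change 𝟙 _ ▷ _ ≫ 𝟙 _ ≫ (α_ _ _ _).hom = (α_ _ _ _).hom ≫ _ ◁ 𝟙 _ ≫ 𝟙 _
        simp
      left_unitality := fun X => by
        ext i
        change (λ_ _).hom = 𝟙 _ ▷ _ ≫ 𝟙 _ ≫ (λ_ _).hom
        simp
      right_unitality := fun X => by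
        ext i
        change (ρ_ _).hom = _ ◁ 𝟙 _ ≫ 𝟙 _ ≫ (ρ_ _).hom
        simp }

variable (D) in
/-- Monoidal descent structures on a symmetric monoidal category. -/
structure MonoidalDescentStructure [HasFiniteProducts D] [MonoidalCategory D] [SymmetricCategory D]
    extends DescentStructure D where
  /-- the simple functor is lax symmetric monoidal -/
  lax : simple.LaxBraided
  mu_monoidal : NatTrans.IsMonoidal mu
  lam_monoidal : NatTrans.IsMonoidal lam

attribute [instance] MonoidalDescentStructure.lax MonoidalDescentStructure.lam_monoidal

end Descent

section Godement

section Powers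

universe v u

variable {A : Type u} [Category.{v} A] (T : Monad A)

/-- The iterates of a monad. -/
def pow : ℕ → A → A
  | 0, X => X
  | n + 1, X => T.obj (pow n X)

/-- Functoriality of the iterates of a monad. -/
def powMap {X Y : A} (f : X ⟶ Y) : ∀ n : ℕ, pow T n X ⟶ pow T n Y
  | 0 => f
  | n + 1 => T.map (powMap f n)

/-- The composition of a morphism with the unit of a monad. -/
def addUnit {Y Z : A} (g : Y ⟶ Z) : Y ⟶ T.obj Z := g ≫ T.η.app Z

/-- The extension `T Y ⟶ T Z` of a morphism `Y ⟶ T Z`. -/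
def extend {Y Z : A} (g : Y ⟶ T.obj Z) : T.obj Y ⟶ T.obj Z := T.map g ≫ T.μ.app Z

/-- The morphism `T^m X ⟶ T^n X` associated to a nondecreasing map `φ : Fin m → Fin n`: the
factors indexed by `φ⁻¹(j)` are multiplied. -/
def act (X : A) : ∀ n m : ℕ, (Fin m → Fin n) → (pow T m X ⟶ pow T n X)
  | 0, 0, _ => 𝟙 X
  | 0, _ + 1, φ => (φ 0).elim0
  | n + 1, 0, _ => addUnit T (act X n 0 Fin.elim0)
  | n + 1, m + 1, φ =>
      if h : ∀ i, φ i ≠ 0 then addUnit T (act X n (m + 1) (fun i => (φ i).pred (h i)))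
      else extend T (act X (n + 1) m (fun i => φ i.succ))
  termination_by n m => (n, m)

variable {T}

lemma comp_addUnit {X Y Z : A} (f : X ⟶ Y) (g : Y ⟶ Z) :
    f ≫ addUnit T g = addUnit T (f ≫ g) := (Category.assoc _ _ _).symm

lemma addUnit_map {X Y Z : A} (f : X ⟶ Y) (g : Y ⟶ Z) :
    addUnit T f ≫ T.map g = addUnit T (f ≫ g) := by
  have := T.η.naturality g
  dsimp at this
  simp [addUnit, ← this]

lemma extend_map {X Y Z : A} (f : X ⟶ T.obj Y) (g : Y ⟶ Z) :
    extend T f ≫ T.map g = extend T (f ≫ T.map g) := by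
  have := T.μ.naturality g
  dsimp at this
  simp [extend, ← this]

lemma map_extend {X Y Z : A} (f : X ⟶ Y) (g : Y ⟶ T.obj Z) :
    T.map f ≫ extend T g = extend T (f ≫ g) := by
  simp [extend]

lemma addUnit_extend {X Y Z : A} (f : X ⟶ Y) (g : Y ⟶ T.obj Z) :
    addUnit T f ≫ extend T g = f ≫ g := by
  have := T.η.naturality_assoc g (T.μ.app Z)
  dsimp at this
  simp [addUnit, extend, ← this]

lemma extend_extend {X Y Z : A} (f : X ⟶ T.obj Y) (g : Y ⟶ T.obj Z) :
    extend T f ≫ extend T g = extend T (f ≫ extend T g) := by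
  have := T.μ.naturality_assoc g (T.μ.app Z)
  dsimp at this
  simp [extend, ← this, T.assoc]

lemma extend_addUnit_id (X : A) : extend T (addUnit T (𝟙 X)) = 𝟙 (T.obj X) := by
  simp [extend, addUnit]

lemma act_of_ne (X : A) {n m : ℕ} (φ : Fin m → Fin (n + 1)) (h : ∀ i, φ i ≠ 0) :
    act T X (n + 1) m φ = addUnit T (act T X n m (fun i => (φ i).pred (h i))) := by
  cases m with
  | zero =>
    rw [act]
    exact congrArg (fun φ => addUnit T (act T X n 0 φ)) (funext fun i => i.elim0)
  | succ m =>
    rw [act]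
    exact dif_pos h

lemma act_of_not (X : A) {n m : ℕ} (φ : Fin (m + 1) → Fin (n + 1)) (h : ¬ ∀ i, φ i ≠ 0) :
    act T X (n + 1) (m + 1) φ = extend T (act T X (n + 1) m (fun i => φ i.succ)) := by
  rw [act]
  exact dif_neg h

lemma act_id (X : A) (n : ℕ) : act T X n n id = 𝟙 (pow T n X) := by
  induction n with
  | zero => rw [act]; rfl
  | succ n ih =>
    rw [act_of_not X id (fun k => k 0 rfl),
      act_of_ne X (fun i : Fin n => id i.succ) (fun i => Fin.succ_ne_zero i)]
    have e : (fun i : Fin n => (id i.succ).pred (Fin.succ_ne_zero i)) = id :=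
      funext fun i => Fin.pred_succ i
    rw [e, ih]
    exact extend_addUnit_id _

lemma act_nat {X Y : A} (f : X ⟶ Y) : ∀ (n m : ℕ) (φ : Fin m → Fin n),
    act T X n m φ ≫ powMap T f n = powMap T f m ≫ act T Y n m φ := by
  intro n
  induction n with
  | zero =>
    intro m φ
    cases m with
    | zero => rw [act, act]; exact (Category.id_comp f).trans (Category.comp_id f).symm
    | succ m => exact (φ 0).elim0
  | succ n ihn =>
    have key : ∀ m (φ : Fin m → Fin (n + 1)), (∀ i, φ i ≠ 0) →
        act T X (n + 1) m φ ≫ powMap T f (n + 1) = powMap T f m ≫ act T Y (n + 1) m φ := by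
      intro m φ h
      rw [act_of_ne X φ h, act_of_ne Y φ h]
      exact (addUnit_map _ _).trans ((congrArg (addUnit T) (ihn m _)).trans (comp_addUnit _ _).symm)
    intro m
    induction m with
    | zero => exact fun φ => key 0 φ (fun i => i.elim0)
    | succ m ihm =>
      intro φ
      by_cases h : ∀ i, φ i ≠ 0
      · exact key _ φ h
      · rw [act_of_not X φ h, act_of_not Y φ h]
        exact (extend_map _ _).trans ((congrArg (extend T) (ihm _)).trans (map_extend _ _).symm)

lemma act_comp (X : A) : ∀ (k n m : ℕ) (φ : Fin m → Fin n) (ψ : Fin n → Fin k),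
    Monotone φ → Monotone ψ → act T X k m (ψ ∘ φ) = act T X n m φ ≫ act T X k n ψ := by
  intro k
  induction k with
  | zero =>
    intro n m φ ψ _ _
    cases n with
    | succ n => exact (ψ 0).elim0
    | zero =>
      cases m with
      | succ m => exact (φ 0).elim0
      | zero => rw [act, act, act]; exact (Category.comp_id _).symm
  | succ k ihk =>
    have key : ∀ n m (φ : Fin m → Fin n) (ψ : Fin n → Fin (k + 1)), Monotone φ → Monotone ψ →
        (∀ i, ψ i ≠ 0) →
        act T X (k + 1) m (ψ ∘ φ) = act T X n m φ ≫ act T X (k + 1) n ψ := by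
      intro n m φ ψ hφ hψ h
      rw [act_of_ne X ψ h, act_of_ne X (ψ ∘ φ) (fun i => h (φ i))]
      exact (congrArg (addUnit T) (ihk _ _ φ (fun i => (ψ i).pred (h i)) hφ
        (fun i j hij => Fin.pred_le_pred_iff.2 (hψ hij)))).trans (comp_addUnit _ _).symm
    intro n
    induction n with
    | zero => exact fun m φ ψ hφ hψ => key 0 m φ ψ hφ hψ (fun i => i.elim0)
    | succ n ihn =>
      have key' : ∀ m (φ : Fin m → Fin (n + 1)) (ψ : Fin (n + 1) → Fin (k + 1)),
          Monotone φ → Monotone ψ → (∀ i, φ i ≠ 0) → ¬ (∀ i, ψ i ≠ 0) →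
          act T X (k + 1) m (ψ ∘ φ) = act T X (n + 1) m φ ≫ act T X (k + 1) (n + 1) ψ := by
        intro m φ ψ hφ hψ h h'
        rw [act_of_ne X φ h, act_of_not X ψ h']
        refine Eq.trans ?_ (addUnit_extend _ _).symm
        refine Eq.trans ?_ (ihn m (fun i => (φ i).pred (h i)) (fun i => ψ i.succ)
          (fun i j hij => Fin.pred_le_pred_iff.2 (hφ hij))
          (fun i j hij => hψ (Fin.succ_le_succ_iff.2 hij)))
        exact congrArg (act T X (k + 1) m) (funext fun i => by simp)
      intro m
      induction m with
      | zero =>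
        intro φ ψ hφ hψ
        by_cases h : ∀ i, ψ i ≠ 0
        · exact key _ _ φ ψ hφ hψ h
        · exact key' _ φ ψ hφ hψ (fun i => i.elim0) h
      | succ m ihm =>
        intro φ ψ hφ hψ
        by_cases h : ∀ i, ψ i ≠ 0
        · exact key _ _ φ ψ hφ hψ h
        · by_cases h' : ∀ i, φ i ≠ 0
          · exact key' _ φ ψ hφ hψ h' h
          · have vanish : ∀ {a b : ℕ} (θ : Fin (a + 1) → Fin (b + 1)), Monotone θ →
                ¬ (∀ i, θ i ≠ 0) → θ 0 = 0 := fun θ hθ hn => by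
              push Not at hn
              obtain ⟨i, hi⟩ := hn
              exact le_antisymm (hi ▸ hθ (Fin.zero_le i)) (Fin.zero_le _)
            have h0 : ¬ ∀ i, (ψ ∘ φ) i ≠ 0 := fun hn => hn 0 (by
              rw [Function.comp_apply, vanish φ hφ h', vanish ψ hψ h])
            have e := ihm (fun i => φ i.succ) ψ (fun i j hij => hφ (Fin.succ_le_succ_iff.2 hij)) hψ
            rw [act_of_not X ψ h] at e
            rw [act_of_not X _ h0, act_of_not X φ h', act_of_not X ψ h]
            exact (congrArg (extend T) e).trans (extend_extend _ _).symm

lemma powMap_id (X : A) (n : ℕ) : powMap T (𝟙 X) n = 𝟙 (pow T n X) := by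
  induction n with
  | zero => rfl
  | succ n ih => exact (congrArg T.map ih).trans (T.map_id _)

lemma powMap_comp {X Y Z : A} (f : X ⟶ Y) (g : Y ⟶ Z) (n : ℕ) :
    powMap T (f ≫ g) n = powMap T f n ≫ powMap T g n := by
  induction n with
  | zero => rfl
  | succ n ih => exact (congrArg T.map ih).trans (T.map_comp _ _)

variable (T)

/-- The cosimplicial resolution `[p] ↦ T^{p+1} X` associated to a monad `T`. -/
def cosimplicial : A ⥤ (SimplexCategory ⥤ A) where
  obj X :=
    { obj := fun p => pow T (p.len + 1) X
      map := fun {p q} θ => act T X (q.len + 1) (p.len + 1) θ.toOrderHom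
      map_id := fun p => act_id X (p.len + 1)
      map_comp := fun θ θ' => act_comp X _ _ _ _ _ θ.toOrderHom.monotone θ'.toOrderHom.monotone }
  map f :=
    { app := fun p => powMap T f (p.len + 1)
      naturality := fun p q θ => act_nat f _ _ _ }
  map_id X := by
    ext p
    exact powMap_id X _
  map_comp f g := by
    ext p
    exact powMap_comp f g _

/-- The coaugmentation `X ⟶ T^{p+1} X`. -/
def coaug : Functor.const SimplexCategory ⟶ cosimplicial T where
  app X :=
    { app := fun p => act T X (p.len + 1) 0 Fin.elim0
      naturality := fun p q θ => by
        refine (Category.id_comp _).trans (Eq.trans ?_ (act_comp X _ _ 0 Fin.elim0 _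
          (fun i => i.elim0) θ.toOrderHom.monotone))
        congr 1
        exact funext fun i => i.elim0 }
  naturality X Y f := by
    ext p
    exact (act_nat f _ 0 Fin.elim0).symm

end Powers
lemma rho_step {A B : Type*} [Category* A] [Category* B] {s : B ⥤ A} {X Y : A} {W Z X' Y' : B}
    {f : X ⟶ Y} {l : X ⟶ s.obj W} {l' : Y ⟶ s.obj Z} {h : W ⟶ Z} {c : W ⟶ X'} {c' : Z ⟶ Y'}
    {g : X' ⟶ Y'} (e : f ≫ l' = l ≫ s.map h) (e' : h ≫ c' = c ≫ g) :
    f ≫ l' ≫ s.map c' = (l ≫ s.map c) ≫ s.map g := by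
  rw [← Category.assoc, e, Category.assoc, ← s.map_comp, e', s.map_comp, Category.assoc]

section Stalks

universe v u w

variable {C : Type w} [SmallCategory C] {J : GrothendieckTopology C}
variable {A : Type u} [Category.{v} A] [HasFilteredColimitsOfSize.{w, w} A]

instance (x : GrothendieckTopology.Point.{w} J) : HasColimitsOfShape x.fiber.Elementsᵒᵖ A :=
  HasFilteredColimitsOfSize.HasColimitsOfShape _

/-- The stalk `F_x` of a presheaf `F` at a point `x`: the filtered colimit of the `F(U)` over the
neighborhoods `(U, u)` of `x`. -/
noncomputable def stalk (x : GrothendieckTopology.Point.{w} J) : (Cᵒᵖ ⥤ A) ⥤ A :=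
  (Functor.whiskeringLeft _ _ _).obj (CategoryOfElements.π x.fiber).op ⋙ colim

/-- The canonical morphism `F(U) ⟶ F_x` for a neighborhood `(U, t)` of `x`. -/
noncomputable def germ (x : GrothendieckTopology.Point.{w} J) (F : Cᵒᵖ ⥤ A) (U : C)
    (t : x.fiber.obj U) : F.obj (op U) ⟶ (stalk x).obj F :=
  colimit.ι ((CategoryOfElements.π x.fiber).op ⋙ F) (op ⟨U, t⟩)

@[ext]
lemma stalk_hom_ext {x : GrothendieckTopology.Point.{w} J} {F : Cᵒᵖ ⥤ A} {Z : A}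
    {f g : (stalk x).obj F ⟶ Z} (h : ∀ U t, germ x F U t ≫ f = germ x F U t ≫ g) : f = g :=
  colimit.hom_ext (by rintro ⟨⟨U, t⟩⟩; exact h U t)

lemma germ_res (x : GrothendieckTopology.Point.{w} J) (F : Cᵒᵖ ⥤ A) {U V : C} (f : U ⟶ V)
    (t : x.fiber.obj U) : F.map f.op ≫ germ x F U t = germ x F V (x.fiber.map f t) :=
  colimit.w ((CategoryOfElements.π x.fiber).op ⋙ F)
    (CategoryOfElements.homMk ⟨U, t⟩ ⟨V, x.fiber.map f t⟩ f rfl).op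

lemma germ_map (x : GrothendieckTopology.Point.{w} J) {F G : Cᵒᵖ ⥤ A} (f : F ⟶ G) (U : C)
    (t : x.fiber.obj U) :
    germ x F U t ≫ (stalk x).map f = f.app (op U) ≫ germ x G U t :=
  colimit.ι_map (Functor.whiskerLeft (CategoryOfElements.π x.fiber).op f) (op ⟨U, t⟩)

/-- The morphism `F_x ⟶ Z` induced by compatible morphisms `F(U) ⟶ Z`. -/
noncomputable def stalkDesc (x : GrothendieckTopology.Point.{w} J) (F : Cᵒᵖ ⥤ A) {Z : A}
    (k : ∀ U, x.fiber.obj U → (F.obj (op U) ⟶ Z))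
    (h : ∀ {U V : C} (f : U ⟶ V) (t : x.fiber.obj U),
      F.map f.op ≫ k U t = k V (x.fiber.map f t)) : (stalk x).obj F ⟶ Z :=
  colimit.desc ((CategoryOfElements.π x.fiber).op ⋙ F)
    { pt := Z
      ι :=
        { app := fun e => k e.unop.1 e.unop.2
          naturality := fun e e' f => by
            have := h f.unop.1 e'.unop.2
            rw [show x.fiber.map f.unop.1 e'.unop.2 = e.unop.2 from f.unop.2] at this
            exact this.trans (Category.comp_id _).symm } }

lemma germ_stalkDesc (x : GrothendieckTopology.Point.{w} J) (F : Cᵒᵖ ⥤ A) {Z : A}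
    (k : ∀ U, x.fiber.obj U → (F.obj (op U) ⟶ Z))
    (h : ∀ {U V : C} (f : U ⟶ V) (t : x.fiber.obj U),
      F.map f.op ≫ k U t = k V (x.fiber.map f t)) (U : C) (t : x.fiber.obj U) :
    germ x F U t ≫ stalkDesc x F k h = k U t :=
  colimit.ι_desc _ _

variable [HasProducts.{w} A] {P : Type w} (pt : P → GrothendieckTopology.Point.{w} J)

/-- The functor `p^*` sending a presheaf to the family of its stalks. -/
noncomputable def stalks : (Cᵒᵖ ⥤ A) ⥤ (P → A) :=
  Functor.pi' fun x => stalk (pt x)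

/-- The set of all pairs consisting of a point `x` and an element of the fiber of `U` at `x`. -/
abbrev Germs (U : C) : Type w := Σ x : P, (pt x).fiber.obj U

/-- The functor `p_*` sending a family of objects `D_x` to the product of skyscraper sheaves
`U ↦ ∏_x ∏_{t ∈ x^* U} D_x`. -/
noncomputable def skyscrapers : (P → A) ⥤ (Cᵒᵖ ⥤ A) where
  obj E :=
    { obj := fun U => ∏ᶜ fun t : Germs pt U.unop => E t.1
      map := fun {U V} f => Pi.lift fun t : Germs pt V.unop =>
        Pi.π (fun t : Germs pt U.unop => E t.1) ⟨t.1, (pt t.1).fiber.map f.unop t.2⟩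
      map_id := fun U => Limits.Pi.hom_ext _ _ fun t => by
        obtain ⟨x, t⟩ := t
        rw [Pi.lift_π, Category.id_comp]
        congr 2
        exact ConcreteCategory.congr_hom ((pt x).fiber.map_id U.unop) t
      map_comp := fun {U V W} f g => Limits.Pi.hom_ext _ _ fun t => by
        obtain ⟨x, t⟩ := t
        rw [Category.assoc, Pi.lift_π, Pi.lift_π, Pi.lift_π]
        congr 2
        exact ConcreteCategory.congr_hom ((pt x).fiber.map_comp g.unop f.unop) t }
  map {E E'} f :=
    { app := fun U => Limits.Pi.map fun t : Germs pt U.unop => f t.1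
      naturality := fun U V g => Limits.Pi.hom_ext _ _ fun t => by simp }
  map_id E := by
    ext U : 2
    exact Limits.Pi.hom_ext _ _ fun t => by simp
  map_comp f g := by
    ext U : 2
    exact Limits.Pi.hom_ext _ _ fun t => by simp

/-- The projection of `∏_x ∏_{t ∈ x^* U} D_x` to the factor of index `(x, t)`. -/
noncomputable def skyProj (E : P → A) (U : C) (x : P) (t : (pt x).fiber.obj U) :
    ((skyscrapers pt).obj E).obj (op U) ⟶ E x :=
  Pi.π (fun t : Germs pt U => E t.1) ⟨x, t⟩

/-- The morphism to `∏_x ∏_{t ∈ x^* U} D_x` with given components. -/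
noncomputable def skyLift (E : P → A) (U : C) {Z : A}
    (k : ∀ (x : P) (_ : (pt x).fiber.obj U), Z ⟶ E x) :
    Z ⟶ ((skyscrapers pt).obj E).obj (op U) :=
  Pi.lift fun t : Germs pt U => k t.1 t.2

variable {pt}

lemma skyLift_skyProj (E : P → A) (U : C) {Z : A}
    (k : ∀ (x : P) (_ : (pt x).fiber.obj U), Z ⟶ E x) (x : P) (t : (pt x).fiber.obj U) :
    skyLift pt E U k ≫ skyProj pt E U x t = k x t :=
  Pi.lift_π _ _

lemma sky_hom_ext {E : P → A} {U : C} {Z : A} {f g : Z ⟶ ((skyscrapers pt).obj E).obj (op U)}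
    (h : ∀ x t, f ≫ skyProj pt E U x t = g ≫ skyProj pt E U x t) : f = g :=
  Limits.Pi.hom_ext _ _ fun t => h t.1 t.2

lemma sky_res (E : P → A) {U V : C} (f : U ⟶ V) (x : P) (t : (pt x).fiber.obj U) :
    ((skyscrapers pt).obj E).map f.op ≫ skyProj pt E U x t =
      skyProj pt E V x ((pt x).fiber.map f t) :=
  Pi.lift_π _ _

lemma sky_map {E E' : P → A} (f : E ⟶ E') (U : C) (x : P) (t : (pt x).fiber.obj U) :
    ((skyscrapers pt).map f).app (op U) ≫ skyProj pt E' U x t = skyProj pt E U x t ≫ f x :=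
  Limits.Pi.map_π (fun t : Germs pt U => f t.1) ⟨x, t⟩

variable (pt)

/-- The unit `F ⟶ p_* p^* F`. -/
noncomputable def stalksUnit : 𝟭 (Cᵒᵖ ⥤ A) ⟶ stalks pt ⋙ skyscrapers pt where
  app F :=
    { app := fun U => skyLift pt _ U.unop fun x t => germ (pt x) F U.unop t
      naturality := fun U V f => sky_hom_ext (pt := pt) fun x t => by
        refine (Category.assoc _ _ _).trans (Eq.trans ?_ (Category.assoc _ _ _).symm)
        refine (congrArg _ (skyLift_skyProj _ _ _ _ _)).trans ?_
        exact (germ_res (pt x) F f.unop t).trans ((skyLift_skyProj (pt := pt)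
          ((stalks pt).obj F) U.unop (fun x t => germ (pt x) F U.unop t) x
            ((pt x).fiber.map f.unop t)).symm.trans
          (congrArg _ (sky_res ((stalks pt).obj F) f.unop x t).symm)) }
  naturality F G f := by
    ext U
    refine sky_hom_ext (pt := pt) fun x t => ?_
    refine (Category.assoc _ _ _).trans (Eq.trans ?_ (Category.assoc _ _ _).symm)
    refine (congrArg (f.app U ≫ ·) (skyLift_skyProj (pt := pt) ((stalks pt).obj G) U.unop
      (fun x t => germ (pt x) G U.unop t) x t)).trans ?_
    refine (germ_map (pt x) f U.unop t).symm.trans (Eq.trans ?_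
      (congrArg (skyLift pt ((stalks pt).obj F) U.unop (fun x t => germ (pt x) F U.unop t) ≫ ·)
        (sky_map ((stalks pt).map f) U.unop x t).symm))
    refine Eq.trans ?_ (Category.assoc _ _ _)
    exact congrArg (· ≫ (stalks pt).map f x) (skyLift_skyProj (pt := pt) ((stalks pt).obj F)
      U.unop (fun x t => germ (pt x) F U.unop t) x t).symm

/-- The counit `p^* p_* D ⟶ D`. -/
noncomputable def stalksCounit : skyscrapers pt ⋙ stalks pt ⟶ 𝟭 (P → A) where
  app E x := stalkDesc (pt x) ((skyscrapers pt).obj E) (fun U t => skyProj pt E U x t)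
    (fun f t => sky_res E f x t)
  naturality E E' f := by
    funext x
    refine stalk_hom_ext fun U t => ?_
    refine (Category.assoc _ _ _).symm.trans (Eq.trans ?_ (Category.assoc _ _ _))
    refine (congrArg (· ≫ _) (germ_map _ _ _ _)).trans (Eq.trans ?_
      (congrArg (· ≫ f x) (germ_stalkDesc _ _ _ _ U t).symm))
    refine (Category.assoc _ _ _).trans ?_
    refine (congrArg _ (germ_stalkDesc _ _ _ _ U t)).trans ?_
    exact sky_map f U x t

lemma stalksUnit_skyProj (F : Cᵒᵖ ⥤ A) (U : C) (x : P) (t : (pt x).fiber.obj U) :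
    ((stalksUnit pt).app F).app (op U) ≫ skyProj pt ((stalks pt).obj F) U x t =
      germ (pt x) F U t :=
  skyLift_skyProj (pt := pt) ((stalks pt).obj F) U (fun x t => germ (pt x) F U t) x t

lemma germ_stalksCounit (E : P → A) (U : C) (x : P) (t : (pt x).fiber.obj U) :
    germ (pt x) ((skyscrapers pt).obj E) U t ≫ (stalksCounit pt).app E x = skyProj pt E U x t :=
  germ_stalkDesc (pt x) ((skyscrapers pt).obj E) (fun U t => skyProj pt E U x t)
    (fun f t => sky_res E f x t) U t

/-- The adjunction between `p^*` and `p_*`. -/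
noncomputable def stalksAdj : stalks (A := A) pt ⊣ skyscrapers pt where
  unit := stalksUnit pt
  counit := stalksCounit pt
  left_triangle_components F := by
    funext x
    refine stalk_hom_ext (x := pt x) (F := F) fun U t => ?_
    refine (Category.assoc _ _ _).symm.trans (Eq.trans ?_ (Category.comp_id _).symm)
    refine (congrArg (· ≫ (stalksCounit pt).app ((stalks pt).obj F) x)
      (germ_map (pt x) ((stalksUnit pt).app F) U t)).trans ?_
    refine (Category.assoc _ _ _).trans ?_
    refine (congrArg _ (germ_stalksCounit pt ((stalks pt).obj F) U x t)).trans ?_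
    exact stalksUnit_skyProj pt F U x t
  right_triangle_components E := by
    ext U
    refine sky_hom_ext (pt := pt) fun x t => ?_
    refine (Category.assoc _ _ _).trans (Eq.trans ?_ (Category.id_comp _).symm)
    refine (congrArg _ (sky_map ((stalksCounit pt).app E) U.unop x t)).trans ?_
    refine (Category.assoc _ _ _).symm.trans ?_
    refine (congrArg (· ≫ (stalksCounit pt).app E x)
      (stalksUnit_skyProj pt ((skyscrapers pt).obj E) U.unop x t)).trans ?_
    exact germ_stalksCounit pt E U.unop x t

/-- The triple `T = p_* p^*`. -/
noncomputable def triple : Monad (Cᵒᵖ ⥤ A) := (stalksAdj pt).toMonad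

/-- The cosimplicial Godement resolution `G^p F = T^{p+1} F`. -/
noncomputable def godement : (Cᵒᵖ ⥤ A) ⥤ (SimplexCategory ⥤ Cᵒᵖ ⥤ A) := cosimplicial (triple pt)

variable (s : (SimplexCategory ⥤ A) ⥤ A)

/-- The functor `F ↦ ℍ(F) = s(G^• F)`, defined object-wise. -/
noncomputable def hyper : (Cᵒᵖ ⥤ A) ⥤ (Cᵒᵖ ⥤ A) :=
  godement pt ⋙ flipFunctor _ _ _ ⋙ (Functor.whiskeringRight Cᵒᵖ (SimplexCategory ⥤ A) A).obj s

variable {s}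

/-- The coaugmentation `F ⟶ G^• F`, evaluated at an object. -/
noncomputable def coaugAt (F : Cᵒᵖ ⥤ A) (U : Cᵒᵖ) :
    (Functor.const SimplexCategory).obj (F.obj U) ⟶ ((godement pt).obj F).flip.obj U where
  app p := (((coaug (triple pt)).app F).app p).app U
  naturality _ _ θ := NatTrans.congr_app (((coaug (triple pt)).app F).naturality θ) U

/-- The natural transformation `ρ_F : F ⟶ ℍ(F)`: the composition of `λ : F ⟶ s(F)` with the image by
`s` of the coaugmentation `F ⟶ G^• F`. -/
noncomputable def rho (lam : 𝟭 A ⟶ Functor.const SimplexCategory ⋙ s) : 𝟭 (Cᵒᵖ ⥤ A) ⟶ hyper pt s where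
  app F :=
    { app := fun U => lam.app (F.obj U) ≫ s.map (coaugAt pt F U)
      naturality := fun U V f => by
        have e : F.map f ≫ lam.app (F.obj V) =
          lam.app (F.obj U) ≫ s.map ((Functor.const SimplexCategory).map (F.map f)) :=
            lam.naturality (F.map f)
        refine rho_step (s := s) e ?_
        ext p
        exact (((coaug (triple pt)).app F).app p).naturality f }
  naturality F G f := by
    ext U
    have e : f.app U ≫ lam.app (G.obj U) =
      lam.app (F.obj U) ≫ s.map ((Functor.const SimplexCategory).map (f.app U)) :=
        lam.naturality (f.app U)
    refine rho_step (s := s) e ?_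
    ext p
    exact NatTrans.congr_app (NatTrans.congr_app ((coaug (triple pt)).naturality f) p) U

end Stalks
end Godement

section CartanEilenberg

variable {A : Type*} [Category* A] (S W : MorphismProperty A)

/-- An object `M` is Cartan-Eilenberg fibrant with respect to strong equivalences `S` and weak
equivalences `W` if every weak equivalence `X ⟶ Y` induces a bijection
`Hom_{A[S⁻¹]}(Y, M) ⟶ Hom_{A[S⁻¹]}(X, M)`. -/
def IsFibrant (M : A) : Prop :=
  ∀ ⦃X Y : A⦄ (w : X ⟶ Y), W w →
    Function.Bijective fun g : S.Q.obj Y ⟶ S.Q.obj M => S.Q.map w ≫ g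

/-- Right Cartan-Eilenberg categories: every object `X` has a fibrant model, that is, a fibrant
object `M` with a morphism `X ⟶ M` of `A[S⁻¹]` which becomes an isomorphism in `A[W⁻¹]`. -/
def IsRightCartanEilenberg : Prop :=
  ∃ h : S ≤ W, ∀ X : A, ∃ (M : A) (φ : S.Q.obj X ⟶ S.Q.obj M), IsFibrant S W M ∧
    IsIso ((Localization.Construction.lift W.Q
      (fun _ _ f hf => W.Q_inverts f (h f hf) : S.IsInvertedBy W.Q)).map φ)

/-- The functor `F : A ⥤ B` has a right derived functor `RF : A[W⁻¹] ⥤ B[W'⁻¹]` (a left Kan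
extension along the localization functor) which is given by `RF X = F (H X)`, its universal
morphism `F X ⟶ RF X` being `F (ρ_X)`. -/
def IsDerivedBy {B : Type*} [Category* B] (W' : MorphismProperty B) (F : A ⥤ B) {H : A ⥤ A}
    (ρ : 𝟭 A ⟶ H) : Prop :=
  ∃ (RF : W.Localization ⥤ W'.Localization) (e : H ⋙ F ⋙ W'.Q ≅ W.Q ⋙ RF),
    RF.IsRightDerivedFunctor
      ((F ⋙ W'.Q).leftUnitor.inv ≫ Functor.whiskerRight ρ (F ⋙ W'.Q) ≫ e.hom) W

end CartanEilenberg

/-- A category of coefficients `E` over a category `D` with a class of equivalences: a family of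
forgetful functors `E ⥤ D`, a simple functor `s` on `E` and a natural transformation
`λ : id ⟶ s c`, where `c` is the constant cosimplicial object functor. -/
structure Coefficients (D E : Type*) [Category* D] [Category* E] where
  weq : MorphismProperty D
  Idx : Type
  forget : Idx → (E ⥤ D)
  simple : (SimplexCategory ⥤ E) ⥤ E
  lam : 𝟭 E ⟶ Functor.const SimplexCategory ⋙ simple

namespace Coefficients

universe w v u v' u'

variable {D : Type u} [Category.{v} D] {E : Type u'} [Category.{v'} E] (K : Coefficients D E)

/-- The equivalences of `E`: the morphisms all of whose components are equivalences. -/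
def equiv : MorphismProperty E := fun _ _ f => ∀ i, K.weq ((K.forget i).map f)

variable {C : Type w} [SmallCategory C] (J : GrothendieckTopology C)

/-- A presheaf with values in `E` is a sheaf if all its components are sheaves. -/
def IsSheaf : ObjectProperty (Cᵒᵖ ⥤ E) := fun F => ∀ i, Presheaf.IsSheaf J (F ⋙ K.forget i)

/-- The category of sheaves with values in `E`. -/
abbrev Sh := (K.IsSheaf J).FullSubcategory

/-- The strong (global) equivalences: the object-wise equivalences. -/
def strong : MorphismProperty (K.Sh J) := fun _ _ f => ∀ U, K.equiv (f.hom.app U)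

/-- The sections functor `Γ(U, -)`. -/
def sections (U : C) : K.Sh J ⥤ E := (K.IsSheaf J).ι ⋙ (evaluation Cᵒᵖ E).obj (op U)

/-- The direct image functor associated to a morphism of sites, given by a continuous functor
`f` between the underlying categories: `(f_* F)(V) = F(f V)`. -/
def directImage {C' : Type w} [SmallCategory C'] {J' : GrothendieckTopology C'} (f : C' ⥤ C)
    [f.IsContinuous J' J] : K.Sh J ⥤ K.Sh J' :=
  (K.IsSheaf J').lift ((K.IsSheaf J).ι ⋙ (Functor.whiskeringLeft _ _ _).obj f.op)
    fun F i => f.op_comp_isSheaf_of_isSheaf J' J (F.obj ⋙ K.forget i) (F.property i)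

variable {J}

section

variable [HasFilteredColimitsOfSize.{w, w} D] {P : Type w}
  (pt : P → GrothendieckTopology.Point.{w} J)

/-- The weak (local) equivalences: the morphisms all of whose components induce equivalences on
the stalks at the given points. -/
def weak : MorphismProperty (K.Sh J) := fun _ _ f =>
  ∀ i x, K.weq ((stalk (pt x)).map (Functor.whiskerRight f.hom (K.forget i)))

end

variable [HasFilteredColimitsOfSize.{w, w} E] [HasProducts.{w} E] {P : Type w}
  (pt : P → GrothendieckTopology.Point.{w} J)

/-- The presheaves `ℍ(F)` are sheaves if `F` is a sheaf. -/
def HyperSheaves : Prop :=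
  ∀ F : Cᵒᵖ ⥤ E, K.IsSheaf J F → K.IsSheaf J ((hyper pt K.simple).obj F)

variable {K} {pt}

/-- The hypercohomology sheaf functor `F ↦ ℍ(F)`. -/
noncomputable def resolution (h : K.HyperSheaves pt) : K.Sh J ⥤ K.Sh J :=
  (K.IsSheaf J).lift ((K.IsSheaf J).ι ⋙ hyper pt K.simple) fun F => h F.obj F.property

/-- The natural transformation `ρ_F : F ⟶ ℍ(F)` for sheaves. -/
noncomputable def resolutionMap (h : K.HyperSheaves pt) : 𝟭 (K.Sh J) ⟶ resolution h where
  app F := ObjectProperty.homMk ((rho pt K.lam).app F.obj)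
  naturality _ _ f := ObjectProperty.hom_ext _ ((rho pt K.lam).naturality f.hom)

variable (K) (pt)

variable [HasFilteredColimitsOfSize.{w, w} D]

/-- Compatibility of a site, with a set of points, and a category of coefficients: sheaves form a
right Cartan-Eilenberg category with respect to strong and weak equivalences, and for every sheaf
`F` the morphism `ρ_F : F ⟶ ℍ(F)` is a fibrant model of `F`. -/
def Compatible : Prop :=
  ∃ h : K.HyperSheaves pt, IsRightCartanEilenberg (K.strong J) (K.weak pt) ∧
    ∀ F : K.Sh J, IsFibrant (K.strong J) (K.weak pt) ((resolution h).obj F) ∧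
      IsIso ((K.weak pt).Q.map ((resolutionMap h).app F))

/-- Direct images, sections and cohomology of sheaves with values in `E` have right derived
functors, and these are computed by `ℍ`. -/
def DerivedFunctors : Prop :=
  ∃ h : K.HyperSheaves pt,
    (∀ {C' : Type w} [SmallCategory C'] (J' : GrothendieckTopology C') {P' : Type w}
      (pt' : P' → GrothendieckTopology.Point.{w} J') (f : C' ⥤ C) [f.IsContinuous J' J],
      IsDerivedBy (K.weak pt) (K.weak pt') (K.directImage J f) (resolutionMap h)) ∧
    (∀ U : C, IsDerivedBy (K.weak pt) K.equiv (K.sections J U) (resolutionMap h)) ∧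
    ∀ (X : C) (_ : IsTerminal X) (RΓ : (K.weak pt).Localization ⥤ K.equiv.Localization)
      (α : K.sections J X ⋙ K.equiv.Q ⟶ (K.weak pt).Q ⋙ RΓ)
      [RΓ.IsRightDerivedFunctor α (K.weak pt)],
      ∃ e : resolution h ⋙ K.sections J X ⋙ K.equiv.Q ≅ (K.weak pt).Q ⋙ RΓ,
        (K.sections J X ⋙ K.equiv.Q).leftUnitor.inv ≫
          Functor.whiskerRight (resolutionMap h) (K.sections J X ⋙ K.equiv.Q) ≫ e.hom = α

end Coefficients

namespace DescentStructure

universe w v u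

variable {D : Type u} [Category.{v} D] [HasFiniteProducts D]

/-- The coefficients given by a descent category. -/
def coefficients (M : DescentStructure D) : Coefficients D D where
  weq := M.eqv
  Idx := Unit
  forget _ := 𝟭 D
  simple := M.simple
  lam := M.lam

/-- Filtered colimits preserve equivalences. -/
def FilteredColimitsExact (M : DescentStructure D) [HasFilteredColimitsOfSize.{w, w} D] : Prop :=
  ∀ (I : Type w) [SmallCategory I] [IsFiltered I] (F G : I ⥤ D) (f : F ⟶ G),
    (∀ i, M.eqv (f.app i)) → M.eqv (colimMap f)

/-- Products preserve equivalences. -/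
def ProductsExact (M : DescentStructure D) [HasProducts.{w} D] : Prop :=
  ∀ (I : Type w) (X Y : I → D) (f : ∀ i, X i ⟶ Y i), (∀ i, M.eqv (f i)) →
    M.eqv (Limits.Pi.map f)

end DescentStructure

namespace MonoidalDescentStructure

universe v u

variable {D : Type u} [Category.{v} D] [HasFiniteProducts D] [MonoidalCategory D]
  [SymmetricCategory D] (M : MonoidalDescentStructure D)

/-- Operads in a monoidal descent category, with the arity-wise structure. -/
def operads : Coefficients D (Operad D) where
  weq := M.eqv
  Idx := ℕ+
  forget := Operad.ev
  simple := Operad.lift M.simple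
  lam := Operad.liftLam M.simple M.lam

/-- Algebras over all operads in a monoidal descent category, with the component-wise structure. -/
def operadAlgebras : Coefficients D (OperadAlg D) where
  weq := M.eqv
  Idx := Option ℕ+
  forget i := i.elim (OperadAlg.snd D) (fun l => OperadAlg.fst D ⋙ Operad.ev l)
  simple := OperadAlg.lift M.simple
  lam := OperadAlg.liftLam M.simple M.lam

/-- Algebras over a fixed operad in a monoidal descent category. -/
def algebrasOver (P : Operad D) : Coefficients D (AlgOver P) where
  weq := M.eqv
  Idx := Unit
  forget _ := AlgOver.forget P
  simple := AlgOver.lift P M.simple M.lam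
  lam := AlgOver.liftLam P M.simple M.lam

end MonoidalDescentStructure

end OperadSheaf

universe w v u

namespace OperadSheaf

section Derived

variable {A : Type*} [Category* A]

/-- A functor with a resolution `ρ : id ⟶ H` by weak equivalences has a right derived functor given
by `H`, provided that it sends `H` of weak equivalences and the morphisms `ρ_{H X}` to
equivalences. -/
theorem isDerivedBy_of_resolution (W : MorphismProperty A) {B : Type*} [Category* B]
    (W' : MorphismProperty B) (F : A ⥤ B) {H : A ⥤ A} (ρ : 𝟭 A ⟶ H)
    (weak : ∀ X, W (ρ.app X)) (inverts : W.IsInvertedBy (H ⋙ F ⋙ W'.Q))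
    (idem : ∀ X, IsIso (W'.Q.map (F.map (ρ.app (H.obj X))))) :
    IsDerivedBy W W' F ρ := by
  refine ⟨Localization.lift _ inverts W.Q, (Localization.fac _ inverts W.Q).symm, ?_⟩
  set RF := Localization.lift (H ⋙ F ⋙ W'.Q) inverts W.Q
  set e : H ⋙ F ⋙ W'.Q ≅ W.Q ⋙ RF := (Localization.fac _ inverts W.Q).symm
  set α := (F ⋙ W'.Q).leftUnitor.inv ≫ Functor.whiskerRight ρ (F ⋙ W'.Q) ≫ e.hom with hα
  have app_α (X : A) : α.app X = W'.Q.map (F.map (ρ.app X)) ≫ e.hom.app X := by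
    simp [hα]
  have iso_Q (X : A) : IsIso (W.Q.map (ρ.app X)) := W.Q_inverts _ (weak X)
  have iso_α (X : A) : IsIso (α.app (H.obj X)) := by
    have := idem X
    rw [app_α]
    infer_instance
  constructor
  refine ⟨⟨IsInitial.ofUniqueHom (fun Y => ?_) ?_⟩⟩
  · let τ : H ⋙ F ⋙ W'.Q ⟶ W.Q ⋙ Y.right :=
      { app := fun X => Y.hom.app (H.obj X) ≫ inv (Y.right.map (W.Q.map (ρ.app X)))
        naturality := fun X X' f => by
          have h₁ := Y.hom.naturality (H.map f)
          have h₂ : Y.right.map (W.Q.map (ρ.app X)) ≫ Y.right.map (W.Q.map (H.map f)) =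
              Y.right.map (W.Q.map f) ≫ Y.right.map (W.Q.map (ρ.app X')) := by
            rw [← Functor.map_comp, ← Functor.map_comp, ← Functor.map_comp, ← Functor.map_comp]
            exact congrArg (fun g => Y.right.map (W.Q.map g)) (ρ.naturality f).symm
          dsimp at h₁ ⊢
          rw [reassoc_of% h₁, Category.assoc]
          congr 1
          rw [IsIso.comp_inv_eq, Category.assoc, IsIso.eq_inv_comp, h₂] }
    let γ : RF ⟶ Y.right :=
      (Localization.fullyFaithfulWhiskeringLeft W.Q W _).preimage (e.inv ≫ τ)
    have hγ : Functor.whiskerLeft W.Q γ = e.inv ≫ τ :=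
      (Localization.fullyFaithfulWhiskeringLeft W.Q W _).map_preimage (e.inv ≫ τ)
    refine StructuredArrow.homMk γ ?_
    ext X
    change α.app X ≫ (Functor.whiskerLeft W.Q γ).app X = Y.hom.app X
    have h := Y.hom.naturality (ρ.app X)
    dsimp at h
    rw [hγ, app_α, NatTrans.comp_app, Category.assoc, Iso.hom_inv_id_app_assoc]
    change _ ≫ Y.hom.app (H.obj X) ≫ inv (Y.right.map (W.Q.map (ρ.app X))) = _
    rw [← Category.assoc, IsIso.comp_inv_eq]
    exact h
  · intro Y m
    have key (γ γ' : RF ⟶ Y.right)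
        (h : ∀ X, α.app X ≫ γ.app (W.Q.obj X) = α.app X ≫ γ'.app (W.Q.obj X)) : γ = γ' := by
      refine Localization.natTrans_ext W.Q W fun X => ?_
      have h' := h (H.obj X)
      rw [cancel_epi] at h'
      rw [← cancel_mono (Y.right.map (W.Q.map (ρ.app X))), ← NatTrans.naturality,
        ← NatTrans.naturality]
      exact congrArg (_ ≫ ·) h'
    have w (m : Functor.LeftExtension.mk RF α ⟶ Y) (X : A) :
        α.app X ≫ m.right.app (W.Q.obj X) = Y.hom.app X :=
      NatTrans.congr_app (StructuredArrow.w m) X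
    exact StructuredArrow.ext _ _ (key _ _ fun X => (w _ X).trans (w _ X).symm)

/-- A weak equivalence between fibrant objects is invertible up to strong equivalences. -/
lemma isIso_of_isFibrant (S W : MorphismProperty A) {M N : A} (hM : IsFibrant S W M)
    (hN : IsFibrant S W N) (f : M ⟶ N) (hf : W f) : IsIso (S.Q.map f) := by
  obtain ⟨g, hg⟩ := (hM f hf).2 (𝟙 _)
  refine ⟨g, hg, (hN f hf).1 ?_⟩
  dsimp at hg ⊢
  rw [reassoc_of% hg, Category.comp_id]

end Derived

namespace Coefficients

universe v' u'

section Saturation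

variable {D : Type u} [Category.{v} D] {E : Type u'} [Category.{v'} E] (K : Coefficients D E)

/-- The class of equivalences is saturated. -/
def IsSaturated : Prop := ∀ ⦃X Y : D⦄ (f : X ⟶ Y), K.weq f ↔ IsIso (K.weq.Q.map f)

variable {K} in
lemma IsSaturated.of_comp {B : Type*} [Category* B] (hK : K.IsSaturated) (S : MorphismProperty B)
    (Φ : B ⥤ D) (hΦ : ∀ ⦃X Y : B⦄ (f : X ⟶ Y), S f → K.weq (Φ.map f)) {X Y : B} (f : X ⟶ Y)
    [IsIso (S.Q.map f)] : K.weq (Φ.map f) := by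
  have hS : S.IsInvertedBy (Φ ⋙ K.weq.Q) := fun _ _ g hg => (hK _).1 (hΦ g hg)
  rw [hK]
  have := (NatIso.isIso_map_iff (Localization.fac _ hS S.Q) f).1
    (inferInstanceAs (IsIso ((Localization.lift _ hS S.Q).map (S.Q.map f))))
  exact this

variable {K} in
lemma IsSaturated.respectsIso (hK : K.IsSaturated) : K.weq.RespectsIso :=
  MorphismProperty.RespectsIso.of_respects_arrow_iso _ fun f g e hf => by
    have := (hK _).1 hf
    have h : g.hom = inv e.hom.left ≫ f.hom ≫ e.hom.right := by
      rw [← Arrow.w e.hom, IsIso.inv_hom_id_assoc]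
    rw [hK, h, Functor.map_comp, Functor.map_comp]
    infer_instance

variable {C : Type w} [SmallCategory C] {J : GrothendieckTopology C}

lemma strong_of_isIso (hK : K.IsSaturated) {F G : K.Sh J} (f : F ⟶ G)
    [IsIso ((K.strong J).Q.map f)] : K.strong J f := fun U i =>
  hK.of_comp (K.strong J) ((K.IsSheaf J).ι ⋙ (evaluation Cᵒᵖ E).obj U ⋙ K.forget i)
    (fun _ _ _ hg => hg U i) f

variable [HasFilteredColimitsOfSize.{w, w} D] {P : Type w}
  (pt : P → GrothendieckTopology.Point.{w} J)

lemma weak_of_isIso (hK : K.IsSaturated) {F G : K.Sh J} (f : F ⟶ G)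
    [IsIso ((K.weak pt).Q.map f)] : K.weak pt f := fun i x =>
  hK.of_comp (K.weak pt) ((K.IsSheaf J).ι ⋙ (Functor.whiskeringRight _ _ _).obj (K.forget i) ⋙
    stalk (pt x)) (fun _ _ _ hg => hg i x) f

variable [HasFilteredColimitsOfSize.{w, w} E] [HasProducts.{w} E]
variable {pt} {K}

lemma weak_resolutionMap (hK : K.IsSaturated) (hc : K.Compatible pt) (h : K.HyperSheaves pt)
    (F : K.Sh J) : K.weak pt ((resolutionMap h).app F) := by
  obtain ⟨_, _, h'⟩ := hc
  have := (h' F).2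
  exact K.weak_of_isIso pt hK _

lemma strong_resolution_map (hK : K.IsSaturated) (hc : K.Compatible pt) (h : K.HyperSheaves pt)
    {F G : K.Sh J} (f : F ⟶ G) (hf : K.weak pt f) : K.strong J ((resolution h).map f) := by
  have hQ : IsIso ((K.weak pt).Q.map ((resolution h).map f)) := by
    have h₁ : IsIso ((K.weak pt).Q.map f) := (K.weak pt).Q_inverts _ hf
    have h₂ (F : K.Sh J) : IsIso ((K.weak pt).Q.map ((resolutionMap h).app F)) :=
      (K.weak pt).Q_inverts _ (weak_resolutionMap hK hc h F)
    have h₃ := congrArg (K.weak pt).Q.map ((resolutionMap h).naturality f)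
    rw [Functor.map_comp, Functor.map_comp] at h₃
    have h₄ : IsIso ((K.weak pt).Q.map ((resolutionMap h).app F) ≫
        (K.weak pt).Q.map ((resolution h).map f)) := by
      rw [← h₃]
      exact @IsIso.comp_isIso _ _ _ _ _ _ _ h₁ (h₂ G)
    exact @IsIso.of_isIso_comp_left _ _ _ _ _ _ _ (h₂ F) h₄
  obtain ⟨_, _, h'⟩ := hc
  have := isIso_of_isFibrant _ _ (h' F).1 (h' G).1 _ (K.weak_of_isIso pt hK ((resolution h).map f))
  exact K.strong_of_isIso hK _

lemma strong_resolutionMap_resolution (hK : K.IsSaturated) (hc : K.Compatible pt)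
    (h : K.HyperSheaves pt) (F : K.Sh J) :
    K.strong J ((resolutionMap h).app ((resolution h).obj F)) := by
  have hw := weak_resolutionMap hK hc h ((resolution h).obj F)
  obtain ⟨_, _, h'⟩ := hc
  have := isIso_of_isFibrant _ _ (h' F).1 (h' ((resolution h).obj F)).1 _ hw
  exact K.strong_of_isIso hK _

variable (K) in
/-- Filtered colimits over the neighborhoods of a point preserve equivalences. -/
def StalksExact : Prop :=
  ∀ {C : Type w} [SmallCategory C] {J : GrothendieckTopology C}
    (x : GrothendieckTopology.Point.{w} J) {F G : Cᵒᵖ ⥤ D} (f : F ⟶ G),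
    (∀ U, K.weq (f.app U)) → K.weq ((stalk x).map f)

lemma derivedFunctors_of_resolution (stalks_exact : K.StalksExact) (h : K.HyperSheaves pt)
    (h₁ : ∀ F, K.weak pt ((resolutionMap h).app F))
    (h₂ : ∀ {F G : K.Sh J} (f : F ⟶ G), K.weak pt f → K.strong J ((resolution h).map f))
    (h₃ : ∀ F, K.strong J ((resolutionMap h).app ((resolution h).obj F))) :
    K.DerivedFunctors pt := by
  have sec (U : C) : IsDerivedBy (K.weak pt) K.equiv (K.sections J U) (resolutionMap h) :=
    isDerivedBy_of_resolution _ _ _ _ h₁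
      (fun F G f hf => K.equiv.Q_inverts _ (h₂ f hf (op U)))
      (fun F => K.equiv.Q_inverts _ (h₃ F (op U)))
  refine ⟨h, ?_, sec, ?_⟩
  · intro C' _ J' P' pt' f _
    have hS {F G : K.Sh J} (g : F ⟶ G) (hg : K.strong J g) :
        K.weak pt' ((K.directImage J f).map g) :=
      fun i x => stalks_exact _ _ fun V => hg _ i
    exact isDerivedBy_of_resolution _ _ _ _ h₁
      (fun F G g hg => (K.weak pt').Q_inverts _ (hS _ (h₂ g hg)))
      (fun F => (K.weak pt').Q_inverts _ (hS _ (h₃ F)))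
  · intro X _ RΓ α _
    obtain ⟨RF, e, hRF⟩ := sec X
    refine ⟨e ≪≫ Functor.isoWhiskerLeft _
      (@Functor.rightDerivedUnique _ _ _ _ _ _ RF RΓ _ _ _ α (K.weak pt) _ hRF _), ?_⟩
    have := @Functor.rightDerivedNatTrans_fac _ _ _ _ _ _ RF RΓ _ _ _ _ α (K.weak pt) _ hRF (𝟙 _)
    rw [Category.id_comp] at this
    refine Eq.trans ?_ this
    simp

end Saturation

end Coefficients

end OperadSheaf

namespace OperadSheaf

section MonadComparison

variable {A B : Type*} [Category* A] [Category* B] {T : Monad A} {T' : Monad B} {V : A ⥤ B}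
  (θ : T.toFunctor ⋙ V ⟶ V ⋙ T'.toFunctor)

/-- Compatibility of a natural transformation `V T ⟶ T' V` with the structures of monads. -/
structure IsMonadComparison : Prop where
  unit : ∀ X, V.map (T.η.app X) ≫ θ.app X = T'.η.app (V.obj X)
  mul : ∀ X, V.map (T.μ.app X) ≫ θ.app X =
    θ.app (T.obj X) ≫ T'.map (θ.app X) ≫ T'.μ.app (V.obj X)

/-- The comparison `V T^n ⟶ T'^n V` of iterates of monads. -/
def powComparison (X : A) : ∀ n : ℕ, V.obj (pow T n X) ⟶ pow T' n (V.obj X)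
  | 0 => 𝟙 _
  | n + 1 => θ.app (pow T n X) ≫ T'.map (powComparison X n)

instance isIso_powComparison [IsIso θ] (X : A) (n : ℕ) : IsIso (powComparison θ X n) := by
  induction n with
  | zero => exact inferInstanceAs (IsIso (𝟙 _))
  | succ n ih => exact inferInstanceAs (IsIso (θ.app (pow T n X) ≫ T'.map (powComparison θ X n)))

lemma powComparison_naturality {X Y : A} (f : X ⟶ Y) (n : ℕ) :
    V.map (powMap T f n) ≫ powComparison θ Y n =
      powComparison θ X n ≫ powMap T' (V.map f) n := by
  induction n with
  | zero => exact (Category.comp_id _).trans (Category.id_comp _).symm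
  | succ n ih =>
    have h := θ.naturality (powMap T f n)
    dsimp at h
    change V.map (T.map (powMap T f n)) ≫ θ.app _ ≫ T'.map (powComparison θ Y n) =
      (θ.app _ ≫ T'.map (powComparison θ X n)) ≫ T'.map (powMap T' (V.map f) n)
    rw [reassoc_of% h, ← T'.map_comp, ih, T'.map_comp, Category.assoc]

variable {θ}

lemma IsMonadComparison.map_addUnit (h : IsMonadComparison θ) {Y Z : A} {W : B} (g : Y ⟶ Z)
    (k : V.obj Z ⟶ W) :
    V.map (addUnit T g) ≫ θ.app Z ≫ T'.map k = addUnit T' (V.map g ≫ k) := by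
  have := T'.η.naturality k
  dsimp at this
  rw [addUnit, addUnit, V.map_comp, Category.assoc, reassoc_of% (h.unit Z), ← this, Category.assoc]

lemma IsMonadComparison.map_extend (h : IsMonadComparison θ) {Y Z : A} {Y' Z' : B}
    (g : Y ⟶ T.obj Z) (k : V.obj Z ⟶ Z') (j : V.obj Y ⟶ Y') (g' : Y' ⟶ T'.obj Z')
    (e : V.map g ≫ θ.app Z ≫ T'.map k = j ≫ g') :
    V.map (extend T g) ≫ θ.app Z ≫ T'.map k = (θ.app Y ≫ T'.map j) ≫ extend T' g' := by
  have h₁ := T'.μ.naturality k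
  have h₂ := θ.naturality g
  dsimp at h₁ h₂
  rw [extend, extend, V.map_comp, Category.assoc, reassoc_of% (h.mul Z), reassoc_of% h₂, ← h₁,
    Category.assoc, ← T'.map_comp_assoc, ← T'.map_comp_assoc, ← T'.map_comp_assoc,
    Category.assoc, e]

lemma IsMonadComparison.map_act (h : IsMonadComparison θ) (X : A) :
    ∀ (n m : ℕ) (φ : Fin m → Fin n), V.map (act T X n m φ) ≫ powComparison θ X n =
      powComparison θ X m ≫ act T' (V.obj X) n m φ := by
  intro n
  induction n with
  | zero =>
    intro m φ
    cases m with
    | zero =>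
      rw [act, act]
      exact congrArg (· ≫ 𝟙 _) (V.map_id X)
    | succ m => exact (φ 0).elim0
  | succ n ihn =>
    have key : ∀ m (φ : Fin m → Fin (n + 1)), (∀ i, φ i ≠ 0) →
        V.map (act T X (n + 1) m φ) ≫ powComparison θ X (n + 1) =
          powComparison θ X m ≫ act T' (V.obj X) (n + 1) m φ := by
      intro m φ hφ
      rw [act_of_ne X φ hφ, act_of_ne (V.obj X) φ hφ]
      exact (h.map_addUnit _ _).trans
        ((congrArg (addUnit T') (ihn m _)).trans (comp_addUnit _ _).symm)
    intro m
    induction m with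
    | zero => exact fun φ => key 0 φ (fun i => i.elim0)
    | succ m ihm =>
      intro φ
      by_cases hφ : ∀ i, φ i ≠ 0
      · exact key _ φ hφ
      · rw [act_of_not X φ hφ, act_of_not (V.obj X) φ hφ]
        exact h.map_extend _ _ _ _ (ihm _)

end MonadComparison

section GodementComparison

universe v' u'

variable {C : Type w} [SmallCategory C] {J : GrothendieckTopology C}
variable {A : Type u} [Category.{v} A] [HasFilteredColimitsOfSize.{w, w} A] [HasProducts.{w} A]
variable {B : Type u'} [Category.{v'} B] [HasFilteredColimitsOfSize.{w, w} B] [HasProducts.{w} B]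
variable (U : A ⥤ B) [PreservesFilteredColimitsOfSize.{w, w} U]
  [∀ I : Type w, PreservesLimitsOfShape (Discrete I) U]

section

variable (x : GrothendieckTopology.Point.{w} J)

/-- The comparison `U(F_x) ≅ (U F)_x` of stalks. -/
noncomputable def stalkComparison (F : Cᵒᵖ ⥤ A) :
    U.obj ((stalk x).obj F) ≅ (stalk x).obj (F ⋙ U) :=
  preservesColimitIso U ((CategoryOfElements.π x.fiber).op ⋙ F)

variable {U x} in
lemma map_stalk_hom_ext {F : Cᵒᵖ ⥤ A} {Z : B} {f g : U.obj ((stalk x).obj F) ⟶ Z}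
    (h : ∀ V t, U.map (germ x F V t) ≫ f = U.map (germ x F V t) ≫ g) : f = g :=
  (isColimitOfPreserves U (colimit.isColimit ((CategoryOfElements.π x.fiber).op ⋙ F))).hom_ext
    (by rintro ⟨⟨V, t⟩⟩; exact h V t)

lemma germ_stalkComparison (F : Cᵒᵖ ⥤ A) (V : C) (t : x.fiber.obj V) :
    U.map (germ x F V t) ≫ (stalkComparison U x F).hom = germ x (F ⋙ U) V t :=
  ι_preservesColimitIso_hom U ((CategoryOfElements.π x.fiber).op ⋙ F) (op ⟨V, t⟩)

lemma germ_stalkComparison_assoc (F : Cᵒᵖ ⥤ A) (V : C) (t : x.fiber.obj V) {Z : B}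
    (g : (stalk x).obj (F ⋙ U) ⟶ Z) :
    U.map (germ x F V t) ≫ (stalkComparison U x F).hom ≫ g = germ x (F ⋙ U) V t ≫ g :=
  (Category.assoc _ _ _).symm.trans (congrArg (· ≫ g) (germ_stalkComparison U x F V t))

lemma stalkComparison_naturality {F G : Cᵒᵖ ⥤ A} (f : F ⟶ G) :
    U.map ((stalk x).map f) ≫ (stalkComparison U x G).hom =
      (stalkComparison U x F).hom ≫ (stalk x).map (Functor.whiskerRight f U) := by
  refine map_stalk_hom_ext fun V t => ?_
  rw [germ_stalkComparison_assoc, germ_map, ← U.map_comp_assoc, germ_map, U.map_comp_assoc,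
    germ_stalkComparison]
  rfl

end

variable {P : Type w} (pt : P → GrothendieckTopology.Point.{w} J)

/-- The comparison of the values of `U(p_* p^* F)` and `p_* p^* (U F)`. -/
noncomputable def tripleComparisonApp (F : Cᵒᵖ ⥤ A) (V : C) :
    U.obj (((triple pt).obj F).obj (op V)) ⟶ ((triple pt).obj (F ⋙ U)).obj (op V) :=
  skyLift pt ((stalks pt).obj (F ⋙ U)) V fun x t =>
    U.map (skyProj pt ((stalks pt).obj F) V x t) ≫ (stalkComparison U (pt x) F).hom

lemma tripleComparisonApp_proj (F : Cᵒᵖ ⥤ A) (V : C) (x : P) (t : (pt x).fiber.obj V) :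
    tripleComparisonApp U pt F V ≫ skyProj pt ((stalks pt).obj (F ⋙ U)) V x t =
      U.map (skyProj pt ((stalks pt).obj F) V x t) ≫ (stalkComparison U (pt x) F).hom :=
  skyLift_skyProj (pt := pt) _ _ _ _ _

lemma tripleComparisonApp_proj_assoc (F : Cᵒᵖ ⥤ A) (V : C) (x : P) (t : (pt x).fiber.obj V) {Z : B}
    (g : (stalk (pt x)).obj (F ⋙ U) ⟶ Z) :
    tripleComparisonApp U pt F V ≫ skyProj pt ((stalks pt).obj (F ⋙ U)) V x t ≫ g =
      U.map (skyProj pt ((stalks pt).obj F) V x t) ≫ (stalkComparison U (pt x) F).hom ≫ g :=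
  (Category.assoc _ _ _).symm.trans
    ((congrArg (· ≫ g) (tripleComparisonApp_proj U pt F V x t)).trans (Category.assoc _ _ _))

instance (F : Cᵒᵖ ⥤ A) (V : C) : IsIso (tripleComparisonApp U pt F V) := by
  let k (t : Germs pt V) : U.obj ((stalk (pt t.1)).obj F) ⟶ (stalk (pt t.1)).obj (F ⋙ U) :=
    (stalkComparison U (pt t.1) F).hom
  have e : tripleComparisonApp U pt F V =
      piComparison U (fun t : Germs pt V => (stalk (pt t.1)).obj F) ≫ Limits.Pi.map k := by
    refine sky_hom_ext (pt := pt) fun x t => ?_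
    refine (tripleComparisonApp_proj U pt F V x t).trans (Eq.trans ?_ (Category.assoc _ _ _).symm)
    refine Eq.trans ?_ (congrArg _ (Limits.Pi.map_π k ⟨x, t⟩).symm)
    exact (piComparison_comp_π_assoc U (fun t : Germs pt V => (stalk (pt t.1)).obj F) ⟨x, t⟩
      (k ⟨x, t⟩)).symm
  rw [e]
  have h₁ : IsIso (Limits.Pi.map k) := by
    have (t : Germs pt V) : IsIso (k t) := inferInstanceAs (IsIso (stalkComparison U (pt t.1) F).hom)
    infer_instance
  exact @IsIso.comp_isIso _ _ _ _ _ _ _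
    (PreservesProduct.iso U fun t : Germs pt V => (stalk (pt t.1)).obj F).isIso_hom h₁

/-- The comparison of `U(p_* p^* F)` and `p_* p^* (U F)`. -/
noncomputable def tripleComparison :
    (triple pt).toFunctor ⋙ (Functor.whiskeringRight Cᵒᵖ A B).obj U ⟶
      (Functor.whiskeringRight Cᵒᵖ A B).obj U ⋙ (triple pt).toFunctor where
  app F :=
    { app := fun V => tripleComparisonApp U pt F V.unop
      naturality := fun V V' f => by
        refine sky_hom_ext (pt := pt) fun x t => ?_
        refine (Category.assoc _ _ _).trans (Eq.trans ?_ (Category.assoc _ _ _).symm)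
        refine (congrArg _ (tripleComparisonApp_proj U pt F V'.unop x t)).trans ?_
        refine Eq.trans ?_ (congrArg _ (sky_res ((stalks pt).obj (F ⋙ U)) f.unop x t).symm)
        refine Eq.trans ?_ (tripleComparisonApp_proj U pt F V.unop x _).symm
        refine (U.map_comp_assoc _ _ _).symm.trans ?_
        exact congrArg (fun g => U.map g ≫ (stalkComparison U (pt x) F).hom)
          (sky_res ((stalks pt).obj F) f.unop x t) }
  naturality F G f := by
    ext V
    refine sky_hom_ext (pt := pt) fun x t => ?_
    refine (Category.assoc _ _ _).trans (Eq.trans ?_ (Category.assoc _ _ _).symm)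
    refine (congrArg _ (tripleComparisonApp_proj U pt G V.unop x t)).trans ?_
    refine Eq.trans ?_ (congrArg _
      (sky_map ((stalks pt).map (Functor.whiskerRight f U)) V.unop x t).symm)
    refine Eq.trans ?_ (tripleComparisonApp_proj_assoc U pt F V.unop x t _).symm
    refine (U.map_comp_assoc _ _ _).symm.trans ?_
    refine (congrArg (fun g => U.map g ≫ (stalkComparison U (pt x) G).hom)
      (sky_map ((stalks pt).map f) V.unop x t)).trans ?_
    refine (U.map_comp_assoc _ _ _).trans ?_
    exact congrArg _ (stalkComparison_naturality U (pt x) f)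

instance : IsIso (tripleComparison U pt) := by
  have (F : Cᵒᵖ ⥤ A) : IsIso ((tripleComparison U pt).app F) := by
    have (V : Cᵒᵖ) : IsIso (((tripleComparison U pt).app F).app V) :=
      inferInstanceAs (IsIso (tripleComparisonApp U pt F V.unop))
    exact NatIso.isIso_of_isIso_app _
  exact NatIso.isIso_of_isIso_app _

lemma stalksCounit_stalkComparison (F : Cᵒᵖ ⥤ A) (x : P) :
    U.map ((stalksCounit pt).app ((stalks pt).obj F) x) ≫ (stalkComparison U (pt x) F).hom =
      (stalkComparison U (pt x) ((triple pt).obj F)).hom ≫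
        (stalk (pt x)).map ((tripleComparison U pt).app F) ≫
          (stalksCounit pt).app ((stalks pt).obj (F ⋙ U)) x := by
  refine map_stalk_hom_ext (x := pt x) fun V t => ?_
  refine (U.map_comp_assoc _ _ _).symm.trans ?_
  refine (congrArg (fun g => U.map g ≫ (stalkComparison U (pt x) F).hom)
    (germ_stalksCounit pt ((stalks pt).obj F) V x t)).trans ?_
  refine Eq.trans ?_ (germ_stalkComparison_assoc U (pt x) ((triple pt).obj F) V t _).symm
  refine Eq.trans ?_ (Category.assoc _ _ _)
  refine Eq.trans ?_ (congrArg (· ≫ (stalksCounit pt).app ((stalks pt).obj (F ⋙ U)) x)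
    (germ_map (pt x) ((tripleComparison U pt).app F) V t).symm)
  refine Eq.trans ?_ (Category.assoc _ _ _).symm
  refine Eq.trans ?_ (congrArg (tripleComparisonApp U pt F V ≫ ·)
    (germ_stalksCounit pt ((stalks pt).obj (F ⋙ U)) V x t).symm)
  exact (tripleComparisonApp_proj U pt F V x t).symm

lemma isMonadComparison_triple : IsMonadComparison (tripleComparison U pt) where
  unit F := by
    ext V
    refine sky_hom_ext (pt := pt) fun x t => ?_
    refine (Category.assoc _ _ _).trans ?_
    refine (congrArg _ (tripleComparisonApp_proj U pt F V.unop x t)).trans ?_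
    refine (U.map_comp_assoc _ _ _).symm.trans ?_
    refine (congrArg (fun g => U.map g ≫ (stalkComparison U (pt x) F).hom)
      (stalksUnit_skyProj pt F V.unop x t)).trans ?_
    exact (germ_stalkComparison U (pt x) F V.unop t).trans
      (stalksUnit_skyProj pt (F ⋙ U) V.unop x t).symm
  mul F := by
    ext V
    refine sky_hom_ext (pt := pt) fun x t => ?_
    refine (Category.assoc _ _ _).trans ?_
    refine (congrArg _ (tripleComparisonApp_proj U pt F V.unop x t)).trans ?_
    refine (U.map_comp_assoc _ _ _).symm.trans ?_
    refine (congrArg (fun g => U.map g ≫ (stalkComparison U (pt x) F).hom)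
      (sky_map ((stalksCounit pt).app ((stalks pt).obj F)) V.unop x t)).trans ?_
    refine (U.map_comp_assoc _ _ _).trans ?_
    refine (congrArg _ (stalksCounit_stalkComparison U pt F x)).trans ?_
    refine Eq.trans ?_ (Category.assoc _ _ _).symm
    refine Eq.trans ?_ (congrArg (tripleComparisonApp U pt ((triple pt).obj F) V.unop ≫ ·)
      ((Category.assoc _ _ _).trans (congrArg _
        (sky_map ((stalksCounit pt).app ((stalks pt).obj (F ⋙ U))) V.unop x t))).symm)
    refine Eq.trans ?_ (congrArg (tripleComparisonApp U pt ((triple pt).obj F) V.unop ≫ ·)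
      ((Category.assoc _ _ _).symm.trans (congrArg
        (· ≫ (stalksCounit pt).app ((stalks pt).obj (F ⋙ U)) x)
        (sky_map ((stalks pt).map ((tripleComparison U pt).app F)) V.unop x t))).symm)
    refine Eq.trans ?_ (congrArg (tripleComparisonApp U pt ((triple pt).obj F) V.unop ≫ ·)
      (Category.assoc _ _ _).symm)
    exact (tripleComparisonApp_proj_assoc U pt ((triple pt).obj F) V.unop x t _).symm

/-- The comparison of `U(G^• F)` and `G^•(U F)`, evaluated at an object. -/
noncomputable def godementComparison (F : Cᵒᵖ ⥤ A) (V : Cᵒᵖ) :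
    ((godement pt).obj F).flip.obj V ⋙ U ⟶ ((godement pt).obj (F ⋙ U)).flip.obj V where
  app p := (powComparison (tripleComparison U pt) F (p.len + 1)).app V
  naturality _ _ φ := NatTrans.congr_app
    ((isMonadComparison_triple U pt).map_act F _ _ φ.toOrderHom) V

instance (F : Cᵒᵖ ⥤ A) (V : Cᵒᵖ) : IsIso (godementComparison U pt F V) := by
  have (p : SimplexCategory) : IsIso ((godementComparison U pt F V).app p) :=
    inferInstanceAs (IsIso ((powComparison (tripleComparison U pt) F (p.len + 1)).app V))
  exact NatIso.isIso_of_isIso_app _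

variable {U} {s : (SimplexCategory ⥤ A) ⥤ A} {s' : (SimplexCategory ⥤ B) ⥤ B}
  (c : s ⋙ U ≅ (Functor.whiskeringRight _ _ _).obj U ⋙ s')

/-- The comparison of `U(ℍ(F))` and `ℍ(U F)`. -/
noncomputable def hyperComparison (F : Cᵒᵖ ⥤ A) :
    (hyper pt s).obj F ⋙ U ≅ (hyper pt s').obj (F ⋙ U) :=
  NatIso.ofComponents (fun V => c.app (((godement pt).obj F).flip.obj V) ≪≫
    s'.mapIso (asIso (godementComparison U pt F V))) fun {V V'} f => by
      have h₁ := c.hom.naturality (((godement pt).obj F).flip.map f)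
      have h₂ : Functor.whiskerRight (((godement pt).obj F).flip.map f) U ≫
          godementComparison U pt F V' = godementComparison U pt F V ≫
            ((godement pt).obj (F ⋙ U)).flip.map f := by
        ext p
        exact (powComparison (tripleComparison U pt) F (p.len + 1)).naturality f
      have h₃ := congrArg s'.map h₂
      rw [s'.map_comp, s'.map_comp] at h₃
      change U.map (s.map (((godement pt).obj F).flip.map f)) ≫ c.hom.app _ ≫ s'.map _ =
        (c.hom.app _ ≫ s'.map _) ≫ s'.map (((godement pt).obj (F ⋙ U)).flip.map f)
      dsimp at h₁
      rw [reassoc_of% h₁, Category.assoc]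
      exact congrArg _ h₃

lemma hyperComparison_naturality {F G : Cᵒᵖ ⥤ A} (f : F ⟶ G) :
    Functor.whiskerRight ((hyper pt s).map f) U ≫ (hyperComparison pt c G).hom =
      (hyperComparison pt c F).hom ≫ (hyper pt s').map (Functor.whiskerRight f U) := by
  ext V
  have h₁ := c.hom.naturality (((flipFunctor _ _ _).map ((godement pt).map f)).app V)
  have h₂ : Functor.whiskerRight (((flipFunctor _ _ _).map ((godement pt).map f)).app V) U ≫
      godementComparison U pt G V = godementComparison U pt F V ≫
        ((flipFunctor _ _ _).map ((godement pt).map (Functor.whiskerRight f U))).app V := by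
    ext p
    exact NatTrans.congr_app
      (powComparison_naturality (tripleComparison U pt) f (p.len + 1)) V
  have h₃ := congrArg s'.map h₂
  rw [s'.map_comp, s'.map_comp] at h₃
  change U.map (s.map (((flipFunctor _ _ _).map ((godement pt).map f)).app V)) ≫
    c.hom.app _ ≫ s'.map _ = (c.hom.app _ ≫ s'.map _) ≫
      s'.map (((flipFunctor _ _ _).map ((godement pt).map (Functor.whiskerRight f U))).app V)
  dsimp only [Functor.comp_map] at h₁
  rw [reassoc_of% h₁, Category.assoc]
  exact congrArg _ h₃

lemma rho_hyperComparison (lam : 𝟭 A ⟶ Functor.const SimplexCategory ⋙ s)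
    (lam' : 𝟭 B ⟶ Functor.const SimplexCategory ⋙ s')
    (hlam : ∀ X, U.map (lam.app X) ≫ c.hom.app ((Functor.const SimplexCategory).obj X) =
      lam'.app (U.obj X) ≫ s'.map (Functor.constComp SimplexCategory X U).inv)
    (F : Cᵒᵖ ⥤ A) :
    Functor.whiskerRight ((rho pt lam).app F) U ≫ (hyperComparison pt c F).hom =
      (rho pt lam').app (F ⋙ U) := by
  ext V
  have h₁ := c.hom.naturality (coaugAt pt F V)
  have h₂ : (Functor.constComp SimplexCategory (F.obj V) U).inv ≫
      Functor.whiskerRight (coaugAt pt F V) U ≫ godementComparison U pt F V =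
        coaugAt pt (F ⋙ U) V := by
    ext p
    refine (Category.id_comp _).trans ?_
    refine (NatTrans.congr_app
      ((isMonadComparison_triple U pt).map_act F (p.len + 1) 0 Fin.elim0) V).trans ?_
    exact Category.id_comp _
  have h₃ := congrArg s'.map h₂
  rw [s'.map_comp, s'.map_comp] at h₃
  change U.map (lam.app (F.obj V) ≫ s.map (coaugAt pt F V)) ≫ c.hom.app _ ≫ s'.map _ =
    lam'.app (U.obj (F.obj V)) ≫ s'.map (coaugAt pt (F ⋙ U) V)
  dsimp only [Functor.comp_map] at h₁
  rw [← h₃, U.map_comp, Category.assoc, reassoc_of% h₁, reassoc_of% (hlam (F.obj V))]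
  rfl

end GodementComparison

namespace Coefficients

universe v' u'

variable {D : Type u} [Category.{v} D] [HasFiniteProducts D] [HasFilteredColimitsOfSize.{w, w} D]
  [HasProducts.{w} D]

lemma stalksExact_of_filteredColimitsExact {M : DescentStructure D} {E : Type u'} [Category.{v'} E]
    (K : Coefficients D E) (hK : K.weq = M.eqv) (h : M.FilteredColimitsExact) :
    StalksExact.{w} K := by
  intro C _ J x F G f hf
  rw [hK] at hf ⊢
  exact h _ _ _ (Functor.whiskerLeft (CategoryOfElements.π x.fiber).op f) fun e => hf _

variable {E : Type u'} [Category.{v'} E] [HasFilteredColimitsOfSize.{w, w} E] [HasProducts.{w} E]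

/-- If the components of a category of coefficients over a descent category preserve filtered
colimits, products, the simple functor and `λ`, and if the descent category is compatible with a
site, then direct images and sections of sheaves have right derived functors given by `ℍ`. -/
theorem derivedFunctors_of_components (M : DescentStructure D) (K : Coefficients D E)
    (hK : K.weq = M.eqv) [∀ i, PreservesFilteredColimitsOfSize.{w, w} (K.forget i)]
    [∀ i, ∀ I : Type w, PreservesLimitsOfShape (Discrete I) (K.forget i)]
    (c : ∀ i, K.simple ⋙ K.forget i ≅
      (Functor.whiskeringRight _ _ _).obj (K.forget i) ⋙ M.simple)
    (hc : ∀ i X, (K.forget i).map (K.lam.app X) ≫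
        (c i).hom.app ((Functor.const SimplexCategory).obj X) =
      M.lam.app ((K.forget i).obj X) ≫
        M.simple.map (Functor.constComp SimplexCategory X (K.forget i)).inv)
    (exact_colimits : M.FilteredColimitsExact)
    {C : Type w} [SmallCategory C] {J : GrothendieckTopology C} {P : Type w}
    (pt : P → GrothendieckTopology.Point.{w} J) (compatible : M.coefficients.Compatible pt) :
    K.DerivedFunctors pt := by
  have sat : M.coefficients.IsSaturated := M.saturated
  have h' : M.coefficients.HyperSheaves pt := compatible.1
  have resp : K.weq.RespectsIso := hK ▸ sat.respectsIso
  have weq_iff {X Y : D} (f : X ⟶ Y) : K.weq f ↔ M.eqv f := by rw [hK]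
  have weq_congr {X Y : D} {f g : X ⟶ Y} (h : f = g) (hf : K.weq f) : K.weq g := h ▸ hf
  let comp (i : K.Idx) : K.Sh J ⥤ M.coefficients.Sh J :=
    (M.coefficients.IsSheaf J).lift
      ((K.IsSheaf J).ι ⋙ (Functor.whiskeringRight _ _ _).obj (K.forget i))
      fun F _ => F.property i
  let e (i : K.Idx) (F : Cᵒᵖ ⥤ E) : (hyper pt K.simple).obj F ⋙ K.forget i ≅
      (hyper pt M.simple).obj (F ⋙ K.forget i) := hyperComparison pt (c i) F
  have e_rho (i : K.Idx) (F : Cᵒᵖ ⥤ E) :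
      Functor.whiskerRight ((rho pt K.lam).app F) (K.forget i) ≫ (e i F).hom =
        (rho pt M.lam).app (F ⋙ K.forget i) :=
    rho_hyperComparison pt (c i) K.lam M.lam (hc i) F
  have h : K.HyperSheaves pt := fun F hF i =>
    (Presheaf.isSheaf_of_iso_iff (e i F)).2 (h' (F ⋙ K.forget i) (fun _ => hF i) ())
  refine derivedFunctors_of_resolution (K.stalksExact_of_filteredColimitsExact hK exact_colimits) h
    ?_ ?_ ?_
  · intro F i x
    have hw : K.weq ((stalk (pt x)).map ((rho pt M.lam).app (F.obj ⋙ K.forget i))) :=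
      (weq_iff _).2 <| weak_resolutionMap sat compatible h' ((comp i).obj F) () x
    rw [← e_rho, Functor.map_comp] at hw
    exact (K.weq.cancel_right_of_respectsIso _ ((stalk (pt x)).map (e i F.obj).hom)).1 hw
  · intro F G f hf V i
    have hw : M.coefficients.weak pt ((comp i).map f) := fun _ x => (weq_iff _).1 (hf i x)
    have hs : K.weq (((hyper pt M.simple).map (Functor.whiskerRight f.hom (K.forget i))).app V) :=
      (weq_iff _).2 <| strong_resolution_map sat compatible h' ((comp i).map f) hw V ()
    have hn := NatTrans.congr_app (hyperComparison_naturality pt (c i) f.hom) V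
    rw [← K.weq.cancel_left_of_respectsIso ((e i F.obj).hom.app V)] at hs
    exact (K.weq.cancel_right_of_respectsIso _ ((e i G.obj).hom.app V)).1
      (weq_congr hn.symm hs)
  · intro F V i
    have hs : K.weq (((rho pt M.lam).app
        ((hyper pt M.simple).obj (F.obj ⋙ K.forget i))).app V) :=
      (weq_iff _).2 <| strong_resolutionMap_resolution sat compatible h' ((comp i).obj F) V ()
    have hn := (rho pt M.lam).naturality (e i F.obj).hom
    have hr := e_rho i ((hyper pt K.simple).obj F.obj)
    dsimp only [Functor.id_map] at hn
    rw [← hr] at hn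
    rw [← K.weq.cancel_left_of_respectsIso ((e i F.obj).hom.app V)] at hs
    have hn' := NatTrans.congr_app hn V
    have hs' := weq_congr hn' hs
    refine (K.weq.cancel_right_of_respectsIso _
      (((e i ((hyper pt K.simple).obj F.obj)).hom.app V) ≫
        ((hyper pt M.simple).map (e i F.obj).hom).app V)).1 ?_
    exact weq_congr (Category.assoc _ _ _) hs'

end Coefficients

end OperadSheaf

namespace OperadSheaf

open Functor.LaxMonoidal

section Whisker

variable {C : Type*} [Category* C] [MonoidalCategory C]

lemma whiskerLeft_comp_tensorHom_eq {P P' t T T' : C} {p : P ⟶ P'} {k : t ⟶ T} {q : T ⟶ T'}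
    {m : t ⟶ T'} (h : k ≫ q = m) : P ◁ k ≫ (p ⊗ₘ q) = p ⊗ₘ m := by
  rw [← id_tensorHom, tensorHom_comp_tensorHom, h, Category.id_comp]

lemma tensorHom_comp_whiskerLeft_eq {P P' t T T' : C} {p : P ⟶ P'} {k : t ⟶ T} {q : T ⟶ T'}
    {m : t ⟶ T'} (h : k ≫ q = m) : (p ⊗ₘ k) ≫ P' ◁ q = p ⊗ₘ m := by
  rw [← id_tensorHom, tensorHom_comp_tensorHom, h, Category.comp_id]

end Whisker

section LimitFunctor

variable {C : Type*} [Category* C] [MonoidalCategory C] {I : Type*} [Category* I]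

/-- A lax monoidal functor computing limits of diagrams, such that the projections are monoidal. -/
structure LimitFunctor (S : (I ⥤ C) ⥤ C) [S.LaxMonoidal] where
  /-- the projections -/
  proj : S ⋙ Functor.const I ⟶ 𝟭 (I ⥤ C)
  /-- the universal property -/
  isLimit : ∀ X : I ⥤ C, IsLimit (Cone.mk (S.obj X) (proj.app X))
  unit : ∀ i, ε S ≫ (proj.app (𝟙_ (I ⥤ C))).app i = 𝟙 (𝟙_ C)
  tensor : ∀ X Y i, μ S X Y ≫ (proj.app (X ⊗ Y)).app i =
    ((proj.app X).app i ⊗ₘ (proj.app Y).app i : S.obj X ⊗ S.obj Y ⟶ X.obj i ⊗ Y.obj i)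

namespace LimitFunctor

variable {S : (I ⥤ C) ⥤ C} [S.LaxMonoidal] (L : LimitFunctor S)

/-- The projections of a limit functor. -/
def π (X : I ⥤ C) (i : I) : S.obj X ⟶ X.obj i := (L.proj.app X).app i

lemma hom_ext {X : I ⥤ C} {Z : C} {f g : Z ⟶ S.obj X} (h : ∀ i, f ≫ L.π X i = g ≫ L.π X i) :
    f = g := (L.isLimit X).hom_ext h

lemma π_map (X : I ⥤ C) {i j : I} (f : i ⟶ j) : L.π X i ≫ X.map f = L.π X j :=
  ((L.proj.app X).naturality f).symm.trans (Category.id_comp _)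

lemma map_π {X Y : I ⥤ C} (f : X ⟶ Y) (i : I) : S.map f ≫ L.π Y i = L.π X i ≫ f.app i :=
  NatTrans.congr_app (L.proj.naturality f) i

lemma ε_π (i : I) : ε S ≫ L.π (𝟙_ (I ⥤ C)) i = 𝟙 (𝟙_ C) := L.unit i

lemma μ_π (X Y : I ⥤ C) (i : I) :
    μ S X Y ≫ L.π (X ⊗ Y) i = (L.π X i ⊗ₘ L.π Y i : S.obj X ⊗ S.obj Y ⟶ X.obj i ⊗ Y.obj i) :=
  L.tensor X Y i

lemma kun_π {ι : Type*} (X : ι → I ⥤ C) (l : List ι) (i : I) :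
    kun S X l ≫ L.π (tlF X l) i = tlMap (fun k => L.π (X k) i) l := by
  induction l with
  | nil => exact L.ε_π i
  | cons k l ih =>
    refine (Category.assoc _ _ _).trans ((congrArg _ (L.μ_π (X k) (tlF X l) i)).trans ?_)
    exact whiskerLeft_comp_tensorHom_eq ih

/-- Projections are compatible with structure morphisms. -/
lemma structure_π {P T R : I ⥤ C} {t : C} (k : t ⟶ S.obj T) (c : P ⊗ T ⟶ R) (i : I) {m : t ⟶ T.obj i}
    (h : k ≫ L.π T i = m) :
    (S.obj P ◁ k ≫ μ S P T ≫ S.map c) ≫ L.π R i =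
      (L.π P i ⊗ₘ m : S.obj P ⊗ t ⟶ P.obj i ⊗ T.obj i) ≫ c.app i := by
  rw [Category.assoc, Category.assoc, L.map_π, ← Category.assoc (μ S P T), ← Category.assoc]
  exact congrArg (· ≫ c.app i) ((congrArg _ (L.μ_π P T i)).trans (whiskerLeft_comp_tensorHom_eq h))

/-- The morphism to a limit with given components. -/
def lift (X : I ⥤ C) {Z : C} (f : (Functor.const I).obj Z ⟶ X) : Z ⟶ S.obj X :=
  (L.isLimit X).lift (Cone.mk Z f)

lemma lift_π (X : I ⥤ C) {Z : C} (f : (Functor.const I).obj Z ⟶ X) (i : I) :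
    L.lift X f ≫ L.π X i = f.app i :=
  (L.isLimit X).fac _ _

/-- The diagonal morphisms `X ⟶ S(c X)`. -/
def diag : 𝟭 C ⟶ Functor.const I ⋙ S where
  app X := L.lift ((Functor.const I).obj X) (𝟙 _)
  naturality X Y f := L.hom_ext fun i => by
    refine (Category.assoc _ _ _).trans (Eq.trans ?_ (Category.assoc _ _ _).symm)
    refine (congrArg _ (L.lift_π _ _ i)).trans ?_
    refine Eq.trans ?_ (congrArg _ (L.map_π _ i).symm)
    refine Eq.trans ?_ ((Category.assoc _ _ _).symm.trans (congrArg (· ≫ _) (L.lift_π _ _ i))).symm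
    exact (Category.comp_id _).trans (Category.id_comp _).symm

lemma diag_π (X : C) (i : I) : L.diag.app X ≫ L.π ((Functor.const I).obj X) i = 𝟙 X :=
  L.lift_π _ _ i

end LimitFunctor

end LimitFunctor

section ColimitFunctor

variable {C : Type*} [Category* C] [MonoidalCategory C] {I : Type*} [Category* I]

/-- A lax monoidal functor computing colimits of diagrams, such that the inclusions are monoidal. -/
structure ColimitFunctor (S : (I ⥤ C) ⥤ C) [S.LaxMonoidal] where
  /-- the inclusions -/
  incl : 𝟭 (I ⥤ C) ⟶ S ⋙ Functor.const I
  /-- the universal property -/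
  isColimit : ∀ X : I ⥤ C, IsColimit (Cocone.mk (S.obj X) (incl.app X))
  unit : ∀ i, (incl.app (𝟙_ (I ⥤ C))).app i = ε S
  tensor : ∀ X Y i, ((incl.app X).app i ⊗ₘ (incl.app Y).app i :
    X.obj i ⊗ Y.obj i ⟶ S.obj X ⊗ S.obj Y) ≫ μ S X Y = (incl.app (X ⊗ Y)).app i
  isIso_μ : ∀ X Y, IsIso (μ S X Y)

namespace ColimitFunctor

variable {S : (I ⥤ C) ⥤ C} [S.LaxMonoidal] (L : ColimitFunctor S)

/-- The inclusions of a colimit functor. -/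
def ι (X : I ⥤ C) (i : I) : X.obj i ⟶ S.obj X := (L.incl.app X).app i

lemma hom_ext {X : I ⥤ C} {Z : C} {f g : S.obj X ⟶ Z} (h : ∀ i, L.ι X i ≫ f = L.ι X i ≫ g) :
    f = g := (L.isColimit X).hom_ext h

lemma map_ι (X : I ⥤ C) {i j : I} (f : i ⟶ j) : X.map f ≫ L.ι X j = L.ι X i :=
  ((L.incl.app X).naturality f).trans (Category.comp_id _)

lemma ι_map {X Y : I ⥤ C} (f : X ⟶ Y) (i : I) : L.ι X i ≫ S.map f = f.app i ≫ L.ι Y i :=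
  (NatTrans.congr_app (L.incl.naturality f) i).symm

lemma ι_unit (i : I) : L.ι (𝟙_ (I ⥤ C)) i = ε S := L.unit i

lemma ι_μ (X Y : I ⥤ C) (i : I) :
    (L.ι X i ⊗ₘ L.ι Y i : X.obj i ⊗ Y.obj i ⟶ S.obj X ⊗ S.obj Y) ≫ μ S X Y = L.ι (X ⊗ Y) i :=
  L.tensor X Y i

lemma ι_kun {κ : Type*} (X : κ → I ⥤ C) (l : List κ) (i : I) :
    tlMap (fun k => L.ι (X k) i) l ≫ kun S X l = L.ι (tlF X l) i := by
  induction l with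
  | nil => exact (Category.id_comp _).trans (L.ι_unit i).symm
  | cons k l ih =>
    refine (Category.assoc _ _ _).symm.trans (Eq.trans ?_ (L.ι_μ (X k) (tlF X l) i))
    exact congrArg (· ≫ μ S (X k) (tlF X l)) (tensorHom_comp_whiskerLeft_eq ih)

/-- Inclusions are compatible with structure morphisms. -/
lemma ι_structure {P T R : I ⥤ C} {t : C} (k : t ⟶ S.obj T) (c : P ⊗ T ⟶ R) (i : I)
    {m : T.obj i ⟶ t} (h : m ≫ k = L.ι T i) :
    (L.ι P i ⊗ₘ m : P.obj i ⊗ T.obj i ⟶ S.obj P ⊗ t) ≫ (S.obj P ◁ k ≫ μ S P T ≫ S.map c) =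
      c.app i ≫ L.ι R i := by
  refine Eq.trans ?_ (L.ι_map c i)
  refine Eq.trans ?_ (congrArg (· ≫ S.map c) (L.ι_μ P T i))
  refine (Category.assoc _ _ _).symm.trans ((congrArg (· ≫ μ S P T ≫ S.map c)
    (tensorHom_comp_whiskerLeft_eq h)).trans (Category.assoc _ _ _).symm)

/-- The morphism from a colimit with given components. -/
def desc (X : I ⥤ C) {Z : C} (f : X ⟶ (Functor.const I).obj Z) : S.obj X ⟶ Z :=
  (L.isColimit X).desc (Cocone.mk Z f)

lemma ι_desc (X : I ⥤ C) {Z : C} (f : X ⟶ (Functor.const I).obj Z) (i : I) :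
    L.ι X i ≫ L.desc X f = f.app i :=
  (L.isColimit X).fac _ _

variable [IsFiltered I]

lemma ι_const (X : C) (i j : I) :
    L.ι ((Functor.const I).obj X) i = L.ι ((Functor.const I).obj X) j := by
  rw [← L.map_ι _ (IsFiltered.leftToMax i j), ← L.map_ι _ (IsFiltered.rightToMax i j)]
  rfl

lemma isIso_ι_const (X : C) (i : I) : IsIso (L.ι ((Functor.const I).obj X) i) := by
  refine ⟨L.desc _ (𝟙 _), L.ι_desc _ _ i, L.hom_ext fun j => ?_⟩
  rw [reassoc_of% (L.ι_desc ((Functor.const I).obj X) (𝟙 _) j), L.ι_const X i j]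
  exact (Category.id_comp _).trans (Category.comp_id _).symm

lemma isIso_kun (L : ColimitFunctor S) {κ : Type*} (X : κ → I ⥤ C) (l : List κ) : IsIso (kun S X l) := by
  induction l with
  | nil =>
    obtain ⟨i⟩ := IsFiltered.nonempty (C := I)
    have := L.isIso_ι_const (𝟙_ C) i
    exact (congrArg (fun f : 𝟙_ C ⟶ S.obj (𝟙_ (I ⥤ C)) => IsIso f) (L.ι_unit i)).mp this
  | cons k l ih =>
    have := L.isIso_μ (X k) (tlF X l)
    exact inferInstanceAs (IsIso (S.obj (X k) ◁ kun S X l ≫ μ S (X k) (tlF X l)))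

lemma tensor_hom_ext {κ : Type*} (Y : I ⥤ C) (X : κ → I ⥤ C) (l : List κ) {Z : C}
    {f g : S.obj Y ⊗ tl (fun k => S.obj (X k)) l ⟶ Z}
    (h : ∀ i, (L.ι Y i ⊗ₘ tlMap (fun k => L.ι (X k) i) l) ≫ f =
      (L.ι Y i ⊗ₘ tlMap (fun k => L.ι (X k) i) l) ≫ g) : f = g := by
  have h₁ := L.isIso_kun X l
  have h₂ := L.isIso_μ Y (tlF X l)
  let e : S.obj Y ⊗ tl (fun k => S.obj (X k)) l ⟶ S.obj (Y ⊗ tlF X l) :=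
    S.obj Y ◁ kun S X l ≫ μ S Y (tlF X l)
  have he (i : I) : L.ι (Y ⊗ tlF X l) i ≫ inv e =
      (L.ι Y i ⊗ₘ tlMap (fun k => L.ι (X k) i) l) := by
    refine (IsIso.comp_inv_eq e).2 ?_
    refine (L.ι_μ Y (tlF X l) i).symm.trans (Eq.trans ?_ (Category.assoc _ _ _))
    exact congrArg (· ≫ μ S Y (tlF X l)) (tensorHom_comp_whiskerLeft_eq (L.ι_kun X l i)).symm
  rw [← cancel_epi (inv e)]
  refine L.hom_ext fun i => ?_
  rw [reassoc_of% (he i), reassoc_of% (he i)]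
  exact h i

/-- The morphisms `X ⟶ S(c X)`. -/
noncomputable def diag : 𝟭 C ⟶ Functor.const I ⋙ S where
  app X := L.ι ((Functor.const I).obj X) (Classical.choice IsFiltered.nonempty)
  naturality _ _ f := (L.ι_map ((Functor.const I).map f) _).symm

lemma diag_eq (X : C) (i : I) : L.diag.app X = L.ι ((Functor.const I).obj X) i :=
  L.ι_const X _ i

lemma isIso_diag (X : C) : IsIso (L.diag.app X) := L.isIso_ι_const X _

lemma tensor_hom_ext' {κ : Type*} (Y : C) (X : κ → I ⥤ C) (l : List κ) {Z : C}
    {f g : Y ⊗ tl (fun k => S.obj (X k)) l ⟶ Z}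
    (h : ∀ i, Y ◁ tlMap (fun k => L.ι (X k) i) l ≫ f =
      Y ◁ tlMap (fun k => L.ι (X k) i) l ≫ g) : f = g := by
  have := L.isIso_diag Y
  let e : Y ⟶ S.obj ((Functor.const I).obj Y) := L.diag.app Y
  have he : IsIso e := this
  rw [← cancel_epi (inv e ▷ _)]
  refine L.tensor_hom_ext _ _ _ fun i => ?_
  have hi : L.ι ((Functor.const I).obj Y) i ≫ inv e = 𝟙 Y := by
    rw [IsIso.comp_inv_eq]
    exact (L.diag_eq Y i).symm.trans (Category.id_comp e).symm
  have hw : (L.ι ((Functor.const I).obj Y) i ⊗ₘ tlMap (fun k => L.ι (X k) i) l) ≫ inv e ▷ _ =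
      Y ◁ tlMap (fun k => L.ι (X k) i) l := by
    rw [← tensorHom_id, tensorHom_comp_tensorHom, Category.comp_id]
    exact (congrArg (· ⊗ₘ tlMap (fun k => L.ι (X k) i) l) hi).trans (id_tensorHom _ _)
  refine (Category.assoc _ _ _).symm.trans (Eq.trans ?_ (Category.assoc _ _ _))
  exact (congrArg (· ≫ f) hw).trans ((h i).trans (congrArg (· ≫ g) hw).symm)

end ColimitFunctor

end ColimitFunctor

end OperadSheaf

namespace OperadSheaf

open Functor.LaxMonoidal

variable {C : Type*} [Category* C] [MonoidalCategory C] [SymmetricCategory C]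
variable {I : Type*} [Category* I] {S : (I ⥤ C) ⥤ C} [S.LaxBraided]

namespace LimitFunctor

variable (L : LimitFunctor S)

instance isMonoidal_diag : NatTrans.IsMonoidal L.diag where
  unit := by
    refine L.hom_ext fun i => ?_
    refine (congrArg (· ≫ L.π ((Functor.const I).obj (𝟙_ C)) i) (Category.id_comp _)).trans ?_
    refine (L.diag_π _ i).trans (Eq.trans ?_ (Category.assoc _ _ _).symm)
    refine Eq.trans ?_ (congrArg _ (L.map_π (ε (Functor.const I)) i).symm)
    exact ((congrArg _ (Category.comp_id _)).trans (L.ε_π i)).symm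
  tensor X Y := by
    refine L.hom_ext fun i => ?_
    refine (congrArg (· ≫ L.π ((Functor.const I).obj (X ⊗ Y)) i) (Category.id_comp _)).trans ?_
    refine (L.diag_π _ i).trans (Eq.trans ?_ (Category.assoc _ _ _).symm)
    refine Eq.trans ?_ (congrArg _ (Category.assoc _ _ _).symm)
    refine Eq.trans ?_ (congrArg _ (congrArg _ (L.map_π (μ (Functor.const I) X Y) i).symm))
    refine Eq.trans ?_ (congrArg _ (congrArg _ (Category.comp_id _).symm))
    refine Eq.trans ?_ (congrArg _ (L.μ_π _ _ i).symm)
    refine Eq.trans ?_ (tensorHom_comp_tensorHom _ _ _ _).symm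
    refine Eq.trans ?_ (congrArg₂ (· ⊗ₘ ·) (L.diag_π X i) (L.diag_π Y i)).symm
    exact (id_tensorHom_id X Y).symm

/-- The projections of a limit of operads. -/
def operadπ (Q : I ⥤ Operad C) (i : I) : (Operad.lift S).obj Q ⟶ Q.obj i where
  app l := L.π (Operad.comps Q l) i
  act l σ := L.map_π (Operad.actF Q l σ) i
  unit := by
    refine (Category.assoc _ _ _).trans ((congrArg _ (L.map_π (Operad.unitF Q) i)).trans ?_)
    refine (Category.assoc _ _ _).symm.trans ((congrArg (· ≫ (Q.obj i).unit) (L.ε_π i)).trans ?_)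
    exact Category.id_comp _
  comp ms l n h h' := L.structure_π _ _ i (L.kun_π (Operad.comps Q) ms i)

/-- The cone over a diagram of operads. -/
def operadCone (Q : I ⥤ Operad C) : Cone Q where
  pt := (Operad.lift S).obj Q
  π :=
    { app := L.operadπ Q
      naturality := fun i j f => by
        ext l
        exact (Category.id_comp _).trans (L.π_map (Operad.comps Q l) f).symm }

lemma operad_lift_π (Q : I ⥤ Operad C) (s : Cone Q) (l : ℕ+) (i : I) :
    L.lift (Operad.comps Q l) (((Operad.ev l).mapCone s).π) ≫ L.π (Operad.comps Q l) i =
      (s.π.app i).app l :=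
  L.lift_π _ _ i

/-- The morphism to a limit of operads. -/
def operadLift (Q : I ⥤ Operad C) (s : Cone Q) : s.pt ⟶ (Operad.lift S).obj Q where
  app l := L.lift (Operad.comps Q l) (((Operad.ev l).mapCone s).π)
  act l σ := L.hom_ext fun i => by
    refine (Category.assoc _ _ _).trans (Eq.trans ?_ (Category.assoc _ _ _).symm)
    refine (congrArg _ (L.operad_lift_π Q s l i)).trans ?_
    refine Eq.trans ?_ (congrArg _ (L.map_π (Operad.actF Q l σ) i).symm)
    refine Eq.trans ?_ (Category.assoc _ _ _)
    refine Eq.trans ?_ (congrArg (· ≫ (Q.obj i).act l σ) (L.operad_lift_π Q s l i).symm)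
    exact (s.π.app i).act l σ
  unit := L.hom_ext fun i => by
    refine (Category.assoc _ _ _).trans ((congrArg _ (L.operad_lift_π Q s 1 i)).trans ?_)
    exact (s.π.app i).unit.trans (L.operadπ Q i).unit.symm
  comp ms l n h h' := L.hom_ext fun i => by
    refine (Category.assoc _ _ _).trans ((congrArg _ (L.operad_lift_π Q s n i)).trans ?_)
    refine ((s.π.app i).comp ms l n h h').trans (Eq.trans ?_ (Category.assoc _ _ _).symm)
    refine Eq.trans ?_ (congrArg _ ((L.operadπ Q i).comp ms l n h h').symm)
    refine Eq.trans ?_ (Category.assoc _ _ _)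
    refine congrArg (· ≫ (Q.obj i).comp ms l n h h') (Eq.symm ?_)
    refine (tensorHom_comp_tensorHom _ _ _ _).trans ?_
    refine congrArg₂ (· ⊗ₘ ·) (L.operad_lift_π Q s l i) ((tlMap_comp _ _ ms).trans ?_)
    exact congrArg (fun f => tlMap f ms) (funext fun k => L.operad_lift_π Q s k i)

/-- The universal property of limits of operads. -/
def operadIsLimit (Q : I ⥤ Operad C) : IsLimit (L.operadCone Q) where
  lift s := L.operadLift Q s
  fac s i := Operad.hom_ext fun l => L.operad_lift_π Q s l i
  uniq s _ hm := Operad.hom_ext fun l => L.hom_ext fun i =>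
    (congrArg (fun f => Operad.Hom.app f l) (hm i)).trans (L.operad_lift_π Q s l i).symm

lemma preservesLimit_ev (L : LimitFunctor S) (Q : I ⥤ Operad C) (l : ℕ+) : PreservesLimit Q (Operad.ev l) :=
  preservesLimit_of_preserves_limit_cone (L.operadIsLimit Q) (L.isLimit (Q ⋙ Operad.ev l))

/-- The projections of a limit of operad algebras. -/
def operadAlgπ (Q : I ⥤ OperadAlg C) (i : I) : (OperadAlg.lift S).obj Q ⟶ Q.obj i :=
  OperadAlg.Hom.mk' (L.operadπ (Q ⋙ OperadAlg.fst C) i) (L.π (Q ⋙ OperadAlg.snd C) i)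
    fun l T h => L.structure_π _ (OperadAlg.actF Q l T h) i
      (L.kun_π (fun _ : Unit => Q ⋙ OperadAlg.snd C) T i)

/-- The cone over a diagram of operad algebras. -/
def operadAlgCone (Q : I ⥤ OperadAlg C) : Cone Q where
  pt := (OperadAlg.lift S).obj Q
  π :=
    { app := L.operadAlgπ Q
      naturality := fun _ _ f => OperadAlg.Hom.ext
        ((L.operadCone (Q ⋙ OperadAlg.fst C)).π.naturality f)
        ((Category.id_comp _).trans (L.π_map (Q ⋙ OperadAlg.snd C) f).symm) }

lemma operadAlg_lift_π (Q : I ⥤ OperadAlg C) (s : Cone Q) (i : I) :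
    L.lift (Q ⋙ OperadAlg.snd C) (((OperadAlg.snd C).mapCone s).π) ≫
      L.π (Q ⋙ OperadAlg.snd C) i = (s.π.app i).map :=
  L.lift_π _ _ i

/-- The morphism to a limit of operad algebras. -/
def operadAlgLift (Q : I ⥤ OperadAlg C) (s : Cone Q) : s.pt ⟶ (OperadAlg.lift S).obj Q :=
  OperadAlg.Hom.mk' (L.operadLift (Q ⋙ OperadAlg.fst C) ((OperadAlg.fst C).mapCone s))
    (L.lift (Q ⋙ OperadAlg.snd C) (((OperadAlg.snd C).mapCone s).π)) fun l T h =>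
      L.hom_ext fun i => by
        refine (Category.assoc _ _ _).trans ((congrArg _ (L.operadAlg_lift_π Q s i)).trans ?_)
        refine (OperadAlg.Hom.act (s.π.app i) l T h).trans
          (Eq.trans ?_ (Category.assoc _ _ _).symm)
        refine Eq.trans ?_ (congrArg _ (OperadAlg.Hom.act (L.operadAlgπ Q i) l T h).symm)
        refine Eq.trans ?_ (Category.assoc _ _ _)
        refine congrArg (· ≫ (Q.obj i).alg.act l T h) (Eq.symm ?_)
        refine (tensorHom_comp_tensorHom _ _ _ _).trans ?_
        refine congrArg₂ (· ⊗ₘ ·)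
          (L.operad_lift_π (Q ⋙ OperadAlg.fst C) ((OperadAlg.fst C).mapCone s) l i)
          ((tlMap_comp _ _ T).trans ?_)
        exact congrArg (fun f => tlMap f T) (funext fun _ => L.operadAlg_lift_π Q s i)

/-- The universal property of limits of operad algebras. -/
def operadAlgIsLimit (Q : I ⥤ OperadAlg C) : IsLimit (L.operadAlgCone Q) where
  lift s := L.operadAlgLift Q s
  fac s i := OperadAlg.Hom.ext
    ((L.operadIsLimit (Q ⋙ OperadAlg.fst C)).fac ((OperadAlg.fst C).mapCone s) i)
    (L.operadAlg_lift_π Q s i)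
  uniq s m hm := OperadAlg.Hom.ext
    ((L.operadIsLimit (Q ⋙ OperadAlg.fst C)).uniq ((OperadAlg.fst C).mapCone s)
      ((OperadAlg.fst C).map m) fun i => congrArg (OperadAlg.fst C).map (hm i))
    (L.hom_ext fun i => (congrArg (OperadAlg.snd C).map (hm i)).trans
      (L.operadAlg_lift_π Q s i).symm)

lemma preservesLimit_snd (L : LimitFunctor S) (Q : I ⥤ OperadAlg C) : PreservesLimit Q (OperadAlg.snd C) :=
  preservesLimit_of_preserves_limit_cone (L.operadAlgIsLimit Q)
    (L.isLimit (Q ⋙ OperadAlg.snd C))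

lemma preservesLimit_fst_ev (L : LimitFunctor S) (Q : I ⥤ OperadAlg C) (l : ℕ+) :
    PreservesLimit Q (OperadAlg.fst C ⋙ Operad.ev l) :=
  preservesLimit_of_preserves_limit_cone (L.operadAlgIsLimit Q)
    (L.isLimit (Q ⋙ OperadAlg.fst C ⋙ Operad.ev l))

variable {P : Operad C}

/-- The projections of a limit of algebras. -/
def algπ (A : I ⥤ AlgOver P) (i : I) : (AlgOver.lift P S L.diag).obj A ⟶ A.obj i where
  map := L.π (A ⋙ AlgOver.forget P) i
  act l T h := by
    refine (Category.assoc _ _ _).trans ((congrArg _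
      (OperadAlg.Hom.act (L.operadAlgπ (A ⋙ AlgOver.incl P) i) l T h)).trans ?_)
    refine (Category.assoc _ _ _).symm.trans (congrArg (· ≫ (A.obj i).act l T h) ?_)
    refine (congrArg (· ≫ _) (tensorHom_id _ _).symm).trans
      ((tensorHom_comp_tensorHom _ _ _ _).trans ?_)
    refine (congrArg₂ (· ⊗ₘ ·) (L.diag_π (P.obj l) i) (Category.id_comp _)).trans ?_
    exact id_tensorHom _ _

/-- The cone over a diagram of algebras. -/
def algCone (A : I ⥤ AlgOver P) : Cone A where
  pt := (AlgOver.lift P S L.diag).obj A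
  π :=
    { app := L.algπ A
      naturality := fun _ _ f => AlgOver.hom_ext
        ((Category.id_comp _).trans (L.π_map (A ⋙ AlgOver.forget P) f).symm) }

lemma alg_lift_π (A : I ⥤ AlgOver P) (s : Cone A) (i : I) :
    L.lift (A ⋙ AlgOver.forget P) (((AlgOver.forget P).mapCone s).π) ≫
      L.π (A ⋙ AlgOver.forget P) i = (s.π.app i).map :=
  L.lift_π _ _ i

/-- The morphism to a limit of algebras. -/
def algLift (A : I ⥤ AlgOver P) (s : Cone A) : s.pt ⟶ (AlgOver.lift P S L.diag).obj A where
  map := L.lift (A ⋙ AlgOver.forget P) (((AlgOver.forget P).mapCone s).π)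
  act l T h := L.hom_ext fun i => by
    refine (Category.assoc _ _ _).trans ((congrArg _ (L.alg_lift_π A s i)).trans ?_)
    refine ((s.π.app i).act l T h).trans (Eq.trans ?_ (Category.assoc _ _ _).symm)
    refine Eq.trans ?_ (congrArg _ ((L.algπ A i).act l T h).symm)
    refine Eq.trans ?_ (Category.assoc _ _ _)
    refine congrArg (· ≫ (A.obj i).act l T h) (Eq.symm ?_)
    refine (whiskerLeft_comp _ _ _).symm.trans (congrArg _ ((tlMap_comp _ _ T).trans ?_))
    exact congrArg (fun f => tlMap f T) (funext fun _ => L.alg_lift_π A s i)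

/-- The universal property of limits of algebras. -/
def algIsLimit (A : I ⥤ AlgOver P) : IsLimit (L.algCone A) where
  lift s := L.algLift A s
  fac s i := AlgOver.hom_ext (L.alg_lift_π A s i)
  uniq s _ hm := AlgOver.hom_ext (L.hom_ext fun i =>
    (congrArg AlgOver.Hom.map (hm i)).trans (L.alg_lift_π A s i).symm)

lemma preservesLimit_forget (L : LimitFunctor S) (A : I ⥤ AlgOver P) : PreservesLimit A (AlgOver.forget P) :=
  preservesLimit_of_preserves_limit_cone (L.algIsLimit A) (L.isLimit (A ⋙ AlgOver.forget P))

end LimitFunctor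

end OperadSheaf

namespace OperadSheaf

open Functor.LaxMonoidal

variable {C : Type*} [Category* C] [MonoidalCategory C] [SymmetricCategory C]
variable {I : Type*} [Category* I] {S : (I ⥤ C) ⥤ C} [S.LaxBraided]

namespace ColimitFunctor

variable [IsFiltered I] (L : ColimitFunctor S)

instance isMonoidal_diag : NatTrans.IsMonoidal L.diag where
  unit := by
    refine (Category.id_comp _).trans ?_
    refine (L.ι_unit _).trans (Eq.trans ?_ (congrArg _ (S.map_id _)).symm)
    exact (Category.comp_id _).symm
  tensor X Y := by
    refine (Category.id_comp _).trans (Eq.trans ?_ (Category.assoc _ _ _))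
    refine Eq.trans ?_ (congrArg (· ≫ S.map (μ (Functor.const I) X Y))
      (L.ι_μ ((Functor.const I).obj X) ((Functor.const I).obj Y) _).symm)
    exact ((L.ι_map (μ (Functor.const I) X Y) _).trans (Category.id_comp _)).symm

/-- The inclusions in a colimit of operads. -/
def operadι (Q : I ⥤ Operad C) (i : I) : Q.obj i ⟶ (Operad.lift S).obj Q where
  app l := L.ι (Operad.comps Q l) i
  act l σ := (L.ι_map (Operad.actF Q l σ) i).symm
  unit := (L.ι_map (Operad.unitF Q) i).symm.trans (congrArg (· ≫ _) (L.ι_unit i))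
  comp ms l n h h' := (L.ι_structure _ (Operad.compF Q ms l n h h') i
    (L.ι_kun (Operad.comps Q) ms i)).symm

/-- The cocone under a diagram of operads. -/
def operadCocone (Q : I ⥤ Operad C) : Cocone Q where
  pt := (Operad.lift S).obj Q
  ι :=
    { app := L.operadι Q
      naturality := fun i j f => by
        ext l
        exact (L.map_ι (Operad.comps Q l) f).trans (Category.comp_id _).symm }

lemma operad_ι_desc (Q : I ⥤ Operad C) (s : Cocone Q) (l : ℕ+) (i : I) :
    L.ι (Operad.comps Q l) i ≫ L.desc (Operad.comps Q l) (((Operad.ev l).mapCocone s).ι) =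
      (s.ι.app i).app l :=
  L.ι_desc _ _ i

/-- The morphism from a colimit of operads. -/
def operadDesc (Q : I ⥤ Operad C) (s : Cocone Q) : (Operad.lift S).obj Q ⟶ s.pt where
  app l := L.desc (Operad.comps Q l) (((Operad.ev l).mapCocone s).ι)
  act l σ := L.hom_ext fun i => by
    refine (Category.assoc _ _ _).symm.trans (Eq.trans ?_ (Category.assoc _ _ _))
    refine Eq.trans ?_ (congrArg (· ≫ s.pt.act l σ) (L.operad_ι_desc Q s l i).symm)
    refine (congrArg (· ≫ _) (L.ι_map (Operad.actF Q l σ) i)).trans ?_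
    refine (Category.assoc _ _ _).trans ((congrArg _ (L.operad_ι_desc Q s l i)).trans ?_)
    exact (s.ι.app i).act l σ
  unit := by
    obtain ⟨i⟩ := IsFiltered.nonempty (C := I)
    refine (congrArg (· ≫ _) (L.operadι Q i).unit.symm).trans ((Category.assoc _ _ _).trans ?_)
    exact (congrArg _ (L.operad_ι_desc Q s 1 i)).trans (s.ι.app i).unit
  comp ms l n h h' := L.tensor_hom_ext _ _ _ fun i => by
    refine (Category.assoc _ _ _).symm.trans ?_
    refine (congrArg (· ≫ _) ((L.operadι Q i).comp ms l n h h').symm).trans ?_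
    refine (Category.assoc _ _ _).trans ((congrArg _ (L.operad_ι_desc Q s n i)).trans ?_)
    refine ((s.ι.app i).comp ms l n h h').trans (Eq.trans ?_ (Category.assoc _ _ _))
    refine congrArg (· ≫ s.pt.comp ms l n h h') (Eq.symm ?_)
    refine (tensorHom_comp_tensorHom _ _ _ _).trans ?_
    refine congrArg₂ (· ⊗ₘ ·) (L.operad_ι_desc Q s l i) ((tlMap_comp _ _ ms).trans ?_)
    exact congrArg (fun f => tlMap f ms) (funext fun k => L.operad_ι_desc Q s k i)

/-- The universal property of filtered colimits of operads. -/
def operadIsColimit (Q : I ⥤ Operad C) : IsColimit (L.operadCocone Q) where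
  desc s := L.operadDesc Q s
  fac s i := Operad.hom_ext fun l => L.operad_ι_desc Q s l i
  uniq s _ hm := Operad.hom_ext fun l => L.hom_ext fun i =>
    (congrArg (fun f => Operad.Hom.app f l) (hm i)).trans (L.operad_ι_desc Q s l i).symm

lemma preservesColimit_ev (L : ColimitFunctor S) (Q : I ⥤ Operad C) (l : ℕ+) :
    PreservesColimit Q (Operad.ev l) :=
  preservesColimit_of_preserves_colimit_cocone (L.operadIsColimit Q) (L.isColimit (Q ⋙ Operad.ev l))

/-- The inclusions in a colimit of operad algebras. -/
def operadAlgι (Q : I ⥤ OperadAlg C) (i : I) : Q.obj i ⟶ (OperadAlg.lift S).obj Q :=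
  OperadAlg.Hom.mk' (L.operadι (Q ⋙ OperadAlg.fst C) i) (L.ι (Q ⋙ OperadAlg.snd C) i)
    fun l T h => (L.ι_structure _ (OperadAlg.actF Q l T h) i
      (L.ι_kun (fun _ : Unit => Q ⋙ OperadAlg.snd C) T i)).symm

/-- The cocone under a diagram of operad algebras. -/
def operadAlgCocone (Q : I ⥤ OperadAlg C) : Cocone Q where
  pt := (OperadAlg.lift S).obj Q
  ι :=
    { app := L.operadAlgι Q
      naturality := fun _ _ f => OperadAlg.Hom.ext
        ((L.operadCocone (Q ⋙ OperadAlg.fst C)).ι.naturality f)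
        ((L.map_ι (Q ⋙ OperadAlg.snd C) f).trans (Category.comp_id _).symm) }

lemma operadAlg_ι_desc (Q : I ⥤ OperadAlg C) (s : Cocone Q) (i : I) :
    L.ι (Q ⋙ OperadAlg.snd C) i ≫
      L.desc (Q ⋙ OperadAlg.snd C) (((OperadAlg.snd C).mapCocone s).ι) = (s.ι.app i).map :=
  L.ι_desc _ _ i

/-- The morphism from a colimit of operad algebras. -/
def operadAlgDesc (Q : I ⥤ OperadAlg C) (s : Cocone Q) : (OperadAlg.lift S).obj Q ⟶ s.pt :=
  OperadAlg.Hom.mk' (L.operadDesc (Q ⋙ OperadAlg.fst C) ((OperadAlg.fst C).mapCocone s))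
    (L.desc (Q ⋙ OperadAlg.snd C) (((OperadAlg.snd C).mapCocone s).ι)) fun l T h =>
      L.tensor_hom_ext (Operad.comps (Q ⋙ OperadAlg.fst C) l)
          (fun _ : Unit => Q ⋙ OperadAlg.snd C) T fun i => by
        refine (Category.assoc _ _ _).symm.trans ?_
        refine (congrArg (· ≫ _) (OperadAlg.Hom.act (L.operadAlgι Q i) l T h).symm).trans ?_
        refine (Category.assoc _ _ _).trans ((congrArg _ (L.operadAlg_ι_desc Q s i)).trans ?_)
        refine (OperadAlg.Hom.act (s.ι.app i) l T h).trans (Eq.trans ?_ (Category.assoc _ _ _))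
        refine congrArg (· ≫ s.pt.alg.act l T h) (Eq.symm ?_)
        refine (tensorHom_comp_tensorHom _ _ _ _).trans ?_
        refine congrArg₂ (· ⊗ₘ ·)
          (L.operad_ι_desc (Q ⋙ OperadAlg.fst C) ((OperadAlg.fst C).mapCocone s) l i)
          ((tlMap_comp _ _ T).trans ?_)
        exact congrArg (fun f => tlMap f T) (funext fun _ => L.operadAlg_ι_desc Q s i)

/-- The universal property of filtered colimits of operad algebras. -/
def operadAlgIsColimit (Q : I ⥤ OperadAlg C) : IsColimit (L.operadAlgCocone Q) where
  desc s := L.operadAlgDesc Q s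
  fac s i := OperadAlg.Hom.ext
    ((L.operadIsColimit (Q ⋙ OperadAlg.fst C)).fac ((OperadAlg.fst C).mapCocone s) i)
    (L.operadAlg_ι_desc Q s i)
  uniq s m hm := OperadAlg.Hom.ext
    ((L.operadIsColimit (Q ⋙ OperadAlg.fst C)).uniq ((OperadAlg.fst C).mapCocone s)
      ((OperadAlg.fst C).map m) fun i => congrArg (OperadAlg.fst C).map (hm i))
    (L.hom_ext fun i => (congrArg (OperadAlg.snd C).map (hm i)).trans
      (L.operadAlg_ι_desc Q s i).symm)

lemma preservesColimit_snd (L : ColimitFunctor S) (Q : I ⥤ OperadAlg C) :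
    PreservesColimit Q (OperadAlg.snd C) :=
  preservesColimit_of_preserves_colimit_cocone (L.operadAlgIsColimit Q)
    (L.isColimit (Q ⋙ OperadAlg.snd C))

lemma preservesColimit_fst_ev (L : ColimitFunctor S) (Q : I ⥤ OperadAlg C) (l : ℕ+) :
    PreservesColimit Q (OperadAlg.fst C ⋙ Operad.ev l) :=
  preservesColimit_of_preserves_colimit_cocone (L.operadAlgIsColimit Q)
    (L.isColimit (Q ⋙ OperadAlg.fst C ⋙ Operad.ev l))

variable {P : Operad C}

/-- The inclusions in a colimit of algebras. -/
noncomputable def algι (A : I ⥤ AlgOver P) (i : I) :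
    A.obj i ⟶ (AlgOver.lift P S L.diag).obj A where
  map := L.ι (A ⋙ AlgOver.forget P) i
  act l T h := by
    refine (OperadAlg.Hom.act (L.operadAlgι (A ⋙ AlgOver.incl P) i) l T h).trans
      (Eq.trans ?_ (Category.assoc _ _ _))
    refine congrArg
      (· ≫ ((OperadAlg.lift S).obj (A ⋙ AlgOver.incl P)).alg.act l T h) (Eq.symm ?_)
    refine (congrArg (· ≫ _) (id_tensorHom _ _).symm).trans ?_
    refine (congrArg _ (tensorHom_id _ _).symm).trans ((tensorHom_comp_tensorHom _ _ _ _).trans ?_)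
    exact congrArg₂ (· ⊗ₘ ·) ((Category.id_comp _).trans (L.diag_eq (P.obj l) i))
      (Category.comp_id _)

/-- The cocone under a diagram of algebras. -/
noncomputable def algCocone (A : I ⥤ AlgOver P) : Cocone A where
  pt := (AlgOver.lift P S L.diag).obj A
  ι :=
    { app := L.algι A
      naturality := fun _ _ f => AlgOver.hom_ext
        ((L.map_ι (A ⋙ AlgOver.forget P) f).trans (Category.comp_id _).symm) }

lemma alg_ι_desc (A : I ⥤ AlgOver P) (s : Cocone A) (i : I) :
    L.ι (A ⋙ AlgOver.forget P) i ≫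
      L.desc (A ⋙ AlgOver.forget P) (((AlgOver.forget P).mapCocone s).ι) = (s.ι.app i).map :=
  L.ι_desc _ _ i

/-- The morphism from a colimit of algebras. -/
noncomputable def algDesc (A : I ⥤ AlgOver P) (s : Cocone A) :
    (AlgOver.lift P S L.diag).obj A ⟶ s.pt where
  map := L.desc (A ⋙ AlgOver.forget P) (((AlgOver.forget P).mapCocone s).ι)
  act l T h := L.tensor_hom_ext' (P.obj l) (fun _ : Unit => A ⋙ AlgOver.forget P) T fun i => by
    refine (Category.assoc _ _ _).symm.trans ?_
    refine (congrArg (· ≫ _) ((L.algι A i).act l T h).symm).trans ?_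
    refine (Category.assoc _ _ _).trans ((congrArg _ (L.alg_ι_desc A s i)).trans ?_)
    refine ((s.ι.app i).act l T h).trans (Eq.trans ?_ (Category.assoc _ _ _))
    refine congrArg (· ≫ s.pt.act l T h) (Eq.symm ?_)
    refine (whiskerLeft_comp _ _ _).symm.trans (congrArg _ ((tlMap_comp _ _ T).trans ?_))
    exact congrArg (fun f => tlMap f T) (funext fun _ => L.alg_ι_desc A s i)

/-- The universal property of filtered colimits of algebras. -/
noncomputable def algIsColimit (A : I ⥤ AlgOver P) : IsColimit (L.algCocone A) where
  desc s := L.algDesc A s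
  fac s i := AlgOver.hom_ext (L.alg_ι_desc A s i)
  uniq s _ hm := AlgOver.hom_ext (L.hom_ext fun i =>
    (congrArg AlgOver.Hom.map (hm i)).trans (L.alg_ι_desc A s i).symm)

lemma preservesColimit_forget (L : ColimitFunctor S) (A : I ⥤ AlgOver P) :
    PreservesColimit A (AlgOver.forget P) :=
  preservesColimit_of_preserves_colimit_cocone (L.algIsColimit A)
    (L.isColimit (A ⋙ AlgOver.forget P))

end ColimitFunctor

end OperadSheaf

namespace OperadSheaf

open Functor.LaxMonoidal

variable {C : Type u} [Category.{v} C] [MonoidalCategory C] [SymmetricCategory C]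
variable (I : Type w) [SmallCategory I]

section Lim

variable [HasLimitsOfShape I C]

/-- The limit functor is lax symmetric monoidal. -/
noncomputable instance limLaxBraided : (lim : (I ⥤ C) ⥤ C).LaxBraided where
  braided X Y := limit.hom_ext fun i => by
    have h₁ : lim.map (β_ X Y).hom ≫ limit.π (Y ⊗ X) i = limit.π (X ⊗ Y) i ≫ (β_ X Y).hom.app i :=
      limMap_π _ _
    refine (Category.assoc _ _ _).trans ((congrArg _ h₁).trans ?_)
    refine (Category.assoc _ _ _).symm.trans ((congrArg (· ≫ (β_ X Y).hom.app i)
      (lim_μ_π X Y i)).trans ?_)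
    refine Eq.trans ?_ (Category.assoc _ _ _).symm
    refine Eq.trans ?_ (congrArg _ (lim_μ_π Y X i).symm)
    exact BraidedCategory.braiding_naturality _ _

/-- The limit functor computes limits. -/
noncomputable def limitFunctorLim : LimitFunctor (lim : (I ⥤ C) ⥤ C) where
  proj :=
    { app := fun X => (limit.cone X).π
      naturality := fun X Y f => by
        ext i
        exact limMap_π f i }
  isLimit X := limit.isLimit X
  unit i := lim_ε_π i
  tensor X Y i := lim_μ_π X Y i

end Lim

section Colim

variable [IsFiltered I] [HasColimitsOfShape I C]
  [∀ A : C, PreservesColimitsOfShape I (tensorLeft A)]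

variable {I}

/-- Tensor products of filtered colimits are colimits of tensor products. -/
noncomputable def isColimitTensor {X Y : I ⥤ C} {c : Cocone X} {d : Cocone Y} (hc : IsColimit c)
    (hd : IsColimit d) : IsColimit (c.tensor d) := by
  have h₁ (A : C) : PreservesColimit X ((curriedTensor C).flip.obj A) :=
    inferInstanceAs (PreservesColimit X (tensorRight A))
  have h₂ (A : C) : PreservesColimit Y ((curriedTensor C).obj A) :=
    inferInstanceAs (PreservesColimit Y (tensorLeft A))
  have : IsSifted I := IsFiltered.isSifted
  exact IsColimit.tensor hc hd

/-- The comparison of the tensor product of colimits with the colimit of tensor products. -/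
noncomputable def colimμ (X Y : I ⥤ C) : colimit X ⊗ colimit Y ⟶ colimit (X ⊗ Y) :=
  (isColimitTensor (colimit.isColimit X) (colimit.isColimit Y)).desc (colimit.cocone (X ⊗ Y))

lemma ι_colimμ (X Y : I ⥤ C) (i : I) :
    (colimit.ι X i ⊗ₘ colimit.ι Y i) ≫ colimμ X Y = colimit.ι (X ⊗ Y) i :=
  (isColimitTensor (colimit.isColimit X) (colimit.isColimit Y)).fac _ i

lemma ι_colimμ_assoc (X Y : I ⥤ C) (i : I) {Z : C} (f : colimit (X ⊗ Y) ⟶ Z) :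
    (colimit.ι X i ⊗ₘ colimit.ι Y i) ≫ colimμ X Y ≫ f = colimit.ι (X ⊗ Y) i ≫ f :=
  (Category.assoc _ _ _).symm.trans (congrArg (· ≫ f) (ι_colimμ X Y i))

lemma colimit_tensor_hom_ext {X Y : I ⥤ C} {c : Cocone X} {d : Cocone Y} (hc : IsColimit c)
    (hd : IsColimit d) {Z : C} {f g : c.pt ⊗ d.pt ⟶ Z}
    (h : ∀ i, (c.ι.app i ⊗ₘ d.ι.app i) ≫ f = (c.ι.app i ⊗ₘ d.ι.app i) ≫ g) : f = g :=
  (isColimitTensor hc hd).hom_ext h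

instance isIso_colimμ (X Y : I ⥤ C) : IsIso (colimμ X Y) :=
  ((isColimitTensor (colimit.isColimit X) (colimit.isColimit Y)).coconePointUniqueUpToIso
    (colimit.isColimit (X ⊗ Y))).isIso_hom

/-- The unit of the filtered colimit functor. -/
noncomputable def colimε : 𝟙_ C ⟶ colimit (𝟙_ (I ⥤ C)) :=
  colimit.ι (𝟙_ (I ⥤ C)) (Classical.choice IsFiltered.nonempty)

lemma colimε_eq (i : I) : colimε = colimit.ι (𝟙_ (I ⥤ C)) i := by
  have h (i j : I) (f : i ⟶ j) : colimit.ι (𝟙_ (I ⥤ C)) i = colimit.ι (𝟙_ (I ⥤ C)) j :=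
    (colimit.w (𝟙_ (I ⥤ C)) f).symm.trans (Category.id_comp _)
  exact (h _ _ (IsFiltered.leftToMax _ i)).trans (h _ _ (IsFiltered.rightToMax _ i)).symm

lemma ι_colim_map {X Y : I ⥤ C} (f : X ⟶ Y) (i : I) :
    colimit.ι X i ≫ colim.map f = f.app i ≫ colimit.ι Y i :=
  ι_colimMap f i

lemma colimμ_natural {X Y X' Y' : I ⥤ C} (f : X ⟶ Y) (g : X' ⟶ Y') :
    (colim.map f ⊗ₘ colim.map g) ≫ colimμ Y Y' = colimμ X X' ≫ colim.map (f ⊗ₘ g) := by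
  refine colimit_tensor_hom_ext (colimit.isColimit X) (colimit.isColimit X') fun i => ?_
  refine (Category.assoc _ _ _).symm.trans ?_
  refine (congrArg (· ≫ colimμ Y Y') ((tensorHom_comp_tensorHom _ _ _ _).trans
    ((congrArg₂ (· ⊗ₘ ·) (ι_colim_map f i) (ι_colim_map g i)).trans
      (tensorHom_comp_tensorHom _ _ _ _).symm))).trans ?_
  refine (Category.assoc _ _ _).trans ((congrArg _ (ι_colimμ Y Y' i)).trans ?_)
  exact (ι_colim_map (f ⊗ₘ g) i).symm.trans (ι_colimμ_assoc X X' i _).symm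

lemma colimμ_associativity (X Y Z : I ⥤ C) :
    (colimμ X Y ⊗ₘ 𝟙 (colimit Z)) ≫ colimμ (X ⊗ Y) Z ≫ colim.map (α_ X Y Z).hom =
      (α_ (colimit X) (colimit Y) (colimit Z)).hom ≫ (𝟙 (colimit X) ⊗ₘ colimμ Y Z) ≫
        colimμ X (Y ⊗ Z) := by
  refine colimit_tensor_hom_ext (isColimitTensor (colimit.isColimit X) (colimit.isColimit Y))
    (colimit.isColimit Z) fun i => ?_
  change ((colimit.ι X i ⊗ₘ colimit.ι Y i) ⊗ₘ colimit.ι Z i) ≫ _ =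
    ((colimit.ι X i ⊗ₘ colimit.ι Y i) ⊗ₘ colimit.ι Z i) ≫ _
  rw [associator_naturality_assoc, tensorHom_comp_tensorHom_assoc, tensorHom_comp_tensorHom_assoc,
    Category.comp_id, Category.comp_id]
  refine (congrArg (fun k => (k ⊗ₘ colimit.ι Z i) ≫ _) (ι_colimμ X Y i)).trans ?_
  refine (ι_colimμ_assoc (X ⊗ Y) Z i _).trans ((ι_colim_map (α_ X Y Z).hom i).trans ?_)
  refine congrArg (fun k => (α_ (X.obj i) (Y.obj i) (Z.obj i)).hom ≫ k) ?_
  refine (ι_colimμ X (Y ⊗ Z) i).symm.trans ?_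
  exact congrArg (fun k => (colimit.ι X i ⊗ₘ k) ≫ colimμ X (Y ⊗ Z)) (ι_colimμ Y Z i).symm

lemma colim_left_unitality (X : I ⥤ C) :
    (λ_ (colimit X)).hom = (colimε ⊗ₘ 𝟙 (colimit X)) ≫ colimμ (𝟙_ (I ⥤ C)) X ≫
      colim.map (λ_ X).hom := by
  refine (isColimitOfPreserves (tensorLeft (𝟙_ C)) (colimit.isColimit X)).hom_ext fun i => ?_
  change 𝟙_ C ◁ colimit.ι X i ≫ _ = 𝟙_ C ◁ colimit.ι X i ≫ _
  rw [leftUnitor_naturality, ← id_tensorHom, tensorHom_comp_tensorHom_assoc, Category.id_comp,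
    Category.comp_id, colimε_eq i]
  exact ((ι_colimμ_assoc (𝟙_ (I ⥤ C)) X i _).trans (ι_colim_map (λ_ X).hom i)).symm

lemma colim_right_unitality (X : I ⥤ C) :
    (ρ_ (colimit X)).hom = (𝟙 (colimit X) ⊗ₘ colimε) ≫ colimμ X (𝟙_ (I ⥤ C)) ≫
      colim.map (ρ_ X).hom := by
  refine (isColimitOfPreserves (tensorRight (𝟙_ C)) (colimit.isColimit X)).hom_ext fun i => ?_
  change colimit.ι X i ▷ 𝟙_ C ≫ _ = colimit.ι X i ▷ 𝟙_ C ≫ _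
  rw [rightUnitor_naturality, ← tensorHom_id, tensorHom_comp_tensorHom_assoc, Category.id_comp,
    Category.comp_id, colimε_eq i]
  exact ((ι_colimμ_assoc X (𝟙_ (I ⥤ C)) i _).trans (ι_colim_map (ρ_ X).hom i)).symm

lemma colimμ_braided (X Y : I ⥤ C) :
    colimμ X Y ≫ colim.map (β_ X Y).hom =
      (β_ (colimit X) (colimit Y)).hom ≫ colimμ Y X := by
  refine colimit_tensor_hom_ext (colimit.isColimit X) (colimit.isColimit Y) fun i => ?_
  refine (ι_colimμ_assoc X Y i _).trans ((ι_colim_map (β_ X Y).hom i).trans ?_)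
  refine (congrArg (fun k => (β_ (X.obj i) (Y.obj i)).hom ≫ k) (ι_colimμ Y X i).symm).trans ?_
  refine (Category.assoc _ _ _).symm.trans (Eq.trans ?_ (Category.assoc _ _ _))
  exact congrArg (· ≫ colimμ Y X) (BraidedCategory.braiding_naturality _ _).symm

variable (I C)

/-- The filtered colimit functor is lax symmetric monoidal. -/
noncomputable abbrev colimLaxBraided : (colim : (I ⥤ C) ⥤ C).LaxBraided where
  toLaxMonoidal := Functor.LaxMonoidal.ofTensorHom (F := (colim : (I ⥤ C) ⥤ C)) colimε colimμ
    colimμ_natural colimμ_associativity colim_left_unitality colim_right_unitality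
  braided := colimμ_braided

/-- The filtered colimit functor computes colimits. -/
noncomputable def colimitFunctorColim :
    letI := colimLaxBraided C I
    ColimitFunctor (colim : (I ⥤ C) ⥤ C) :=
  letI := colimLaxBraided C I
  { incl :=
      { app := fun X => (colimit.cocone X).ι
        naturality := fun X Y f => by
          ext i
          exact (ι_colim_map f i).symm }
    isColimit := fun X => colimit.isColimit X
    unit := fun i => (colimε_eq i).symm
    tensor := fun X Y i => ι_colimμ X Y i
    isIso_μ := fun X Y => isIso_colimμ X Y }

end Colim

end OperadSheaf

namespace OperadSheaf

section Instances

variable {D : Type u} [Category.{v} D] [MonoidalCategory D] [SymmetricCategory D]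

section Products

variable [HasProducts.{w} D]

instance : HasProducts.{w} (Operad D) := fun I =>
  ⟨fun Q => ⟨⟨⟨_, (limitFunctorLim (C := D) (Discrete I)).operadIsLimit Q⟩⟩⟩⟩

instance : HasProducts.{w} (OperadAlg D) := fun I =>
  ⟨fun Q => ⟨⟨⟨_, (limitFunctorLim (C := D) (Discrete I)).operadAlgIsLimit Q⟩⟩⟩⟩

instance (P : Operad D) : HasProducts.{w} (AlgOver P) := fun I =>
  ⟨fun Q => ⟨⟨⟨_, (limitFunctorLim (C := D) (Discrete I)).algIsLimit Q⟩⟩⟩⟩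

lemma preservesProducts_ev (l : ℕ+) (I : Type w) :
    PreservesLimitsOfShape (Discrete I) (Operad.ev (C := D) l) :=
  ⟨fun {Q} => (limitFunctorLim (C := D) (Discrete I)).preservesLimit_ev Q l⟩

lemma preservesProducts_fst_ev (l : ℕ+) (I : Type w) :
    PreservesLimitsOfShape (Discrete I) (OperadAlg.fst D ⋙ Operad.ev l) :=
  ⟨fun {Q} => (limitFunctorLim (C := D) (Discrete I)).preservesLimit_fst_ev Q l⟩

lemma preservesProducts_snd (I : Type w) : PreservesLimitsOfShape (Discrete I) (OperadAlg.snd D) :=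
  ⟨fun {Q} => (limitFunctorLim (C := D) (Discrete I)).preservesLimit_snd Q⟩

lemma preservesProducts_forget (P : Operad D) (I : Type w) :
    PreservesLimitsOfShape (Discrete I) (AlgOver.forget P) :=
  ⟨fun {Q} => (limitFunctorLim (C := D) (Discrete I)).preservesLimit_forget Q⟩

end Products

section FilteredColimits

variable [HasFilteredColimitsOfSize.{w, w} D]

/-- Filtered colimits in a symmetric monoidal category in which tensor products preserve them are
computed by a lax symmetric monoidal functor. -/
lemma exists_colimitFunctor (tensor : ∀ A : D, PreservesFilteredColimitsOfSize.{w, w} (tensorLeft A))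
    (I : Type w) [SmallCategory I] [IsFiltered I] :
    ∃ (S : (I ⥤ D) ⥤ D) (_ : S.LaxBraided), Nonempty (ColimitFunctor S) := by
  have : HasColimitsOfShape I D := HasFilteredColimitsOfSize.HasColimitsOfShape I
  exact ⟨colim, colimLaxBraided D I, ⟨colimitFunctorColim D I⟩⟩

variable (tensor : ∀ A : D, PreservesFilteredColimitsOfSize.{w, w} (tensorLeft A))
include tensor

lemma hasFilteredColimits_operad : HasFilteredColimitsOfSize.{w, w} (Operad D) := by
  refine ⟨fun I _ _ => ⟨fun Q => ?_⟩⟩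
  obtain ⟨S, _, ⟨L⟩⟩ := exists_colimitFunctor tensor I
  exact ⟨⟨_, L.operadIsColimit Q⟩⟩

lemma hasFilteredColimits_operadAlg : HasFilteredColimitsOfSize.{w, w} (OperadAlg D) := by
  refine ⟨fun I _ _ => ⟨fun Q => ?_⟩⟩
  obtain ⟨S, _, ⟨L⟩⟩ := exists_colimitFunctor tensor I
  exact ⟨⟨_, L.operadAlgIsColimit Q⟩⟩

lemma hasFilteredColimits_algOver (P : Operad D) :
    HasFilteredColimitsOfSize.{w, w} (AlgOver P) := by
  refine ⟨fun I _ _ => ⟨fun Q => ?_⟩⟩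
  obtain ⟨S, _, ⟨L⟩⟩ := exists_colimitFunctor tensor I
  exact ⟨⟨_, L.algIsColimit Q⟩⟩

lemma preservesFilteredColimits_ev (l : ℕ+) :
    PreservesFilteredColimitsOfSize.{w, w} (Operad.ev (C := D) l) := by
  refine ⟨fun I _ _ => ⟨fun {Q} => ?_⟩⟩
  obtain ⟨S, _, ⟨L⟩⟩ := exists_colimitFunctor tensor I
  exact L.preservesColimit_ev Q l

lemma preservesFilteredColimits_fst_ev (l : ℕ+) :
    PreservesFilteredColimitsOfSize.{w, w} (OperadAlg.fst D ⋙ Operad.ev l) := by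
  refine ⟨fun I _ _ => ⟨fun {Q} => ?_⟩⟩
  obtain ⟨S, _, ⟨L⟩⟩ := exists_colimitFunctor tensor I
  exact L.preservesColimit_fst_ev Q l

lemma preservesFilteredColimits_snd :
    PreservesFilteredColimitsOfSize.{w, w} (OperadAlg.snd D) := by
  refine ⟨fun I _ _ => ⟨fun {Q} => ?_⟩⟩
  obtain ⟨S, _, ⟨L⟩⟩ := exists_colimitFunctor tensor I
  exact L.preservesColimit_snd Q

lemma preservesFilteredColimits_forget (P : Operad D) :
    PreservesFilteredColimitsOfSize.{w, w} (AlgOver.forget P) := by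
  refine ⟨fun I _ _ => ⟨fun {Q} => ?_⟩⟩
  obtain ⟨S, _, ⟨L⟩⟩ := exists_colimitFunctor tensor I
  exact L.preservesColimit_forget Q

end FilteredColimits

end Instances

end OperadSheaf

theorem mainTheorem8 {C : Type w} [SmallCategory C] {J : GrothendieckTopology C}
    {X : Type w} (pt : X → GrothendieckTopology.Point.{w} J)
    (enough : (ObjectProperty.ofObj pt).IsConservativeFamilyOfPoints)
    {D : Type u} [Category.{v} D] [MonoidalCategory D] [SymmetricCategory D]
    [HasFiniteProducts D] [HasFilteredColimitsOfSize.{w, w} D] [HasProducts.{w} D]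
    (M : OperadSheaf.MonoidalDescentStructure D)
    (exact_colimits : M.FilteredColimitsExact) (exact_products : M.ProductsExact)
    (tensor : ∀ A : D, PreservesFilteredColimitsOfSize.{w, w} (tensorLeft A))
    (compatible : M.coefficients.Compatible pt) :
    (∃ (_ : HasFilteredColimitsOfSize.{w, w} (OperadSheaf.Operad D))
      (_ : HasProducts.{w} (OperadSheaf.Operad D)), M.operads.DerivedFunctors pt) ∧
    (∃ (_ : HasFilteredColimitsOfSize.{w, w} (OperadSheaf.OperadAlg D))
      (_ : HasProducts.{w} (OperadSheaf.OperadAlg D)), M.operadAlgebras.DerivedFunctors pt) ∧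
    ∀ P : OperadSheaf.Operad D,
      ∃ (_ : HasFilteredColimitsOfSize.{w, w} (OperadSheaf.AlgOver P))
        (_ : HasProducts.{w} (OperadSheaf.AlgOver P)), (M.algebrasOver P).DerivedFunctors pt := by
  have key (A : D) : M.lam.app A ≫ 𝟙 (M.simple.obj ((Functor.const SimplexCategory).obj A)) =
      M.lam.app A ≫ M.simple.map (𝟙 ((Functor.const SimplexCategory).obj A)) :=
    congrArg _ (M.simple.map_id _).symm
  refine ⟨⟨OperadSheaf.hasFilteredColimits_operad tensor, inferInstance, ?_⟩,
    ⟨OperadSheaf.hasFilteredColimits_operadAlg tensor, inferInstance, ?_⟩,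
    fun P => ⟨OperadSheaf.hasFilteredColimits_algOver tensor P, inferInstance, ?_⟩⟩
  · have := OperadSheaf.hasFilteredColimits_operad tensor
    have (l : M.operads.Idx) : PreservesFilteredColimitsOfSize.{w, w} (M.operads.forget l) :=
      OperadSheaf.preservesFilteredColimits_ev tensor l
    have (l : M.operads.Idx) (I : Type w) :
        PreservesLimitsOfShape (Discrete I) (M.operads.forget l) :=
      OperadSheaf.preservesProducts_ev l I
    exact OperadSheaf.Coefficients.derivedFunctors_of_components M.toDescentStructure M.operads rfl
      (fun l => Iso.refl _) (fun l P => key (P.obj l)) exact_colimits pt compatible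
  · have := OperadSheaf.hasFilteredColimits_operadAlg tensor
    have (i : M.operadAlgebras.Idx) :
        PreservesFilteredColimitsOfSize.{w, w} (M.operadAlgebras.forget i) := by
      cases i with
      | none => exact OperadSheaf.preservesFilteredColimits_snd tensor
      | some l => exact OperadSheaf.preservesFilteredColimits_fst_ev tensor l
    have (i : M.operadAlgebras.Idx) (I : Type w) :
        PreservesLimitsOfShape (Discrete I) (M.operadAlgebras.forget i) := by
      cases i with
      | none => exact OperadSheaf.preservesProducts_snd I
      | some l => exact OperadSheaf.preservesProducts_fst_ev l I
    let c (i : M.operadAlgebras.Idx) : M.operadAlgebras.simple ⋙ M.operadAlgebras.forget i ≅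
        (Functor.whiskeringRight _ _ _).obj (M.operadAlgebras.forget i) ⋙ M.simple :=
      match i with
      | none => Iso.refl _
      | some l => Iso.refl _
    refine OperadSheaf.Coefficients.derivedFunctors_of_components M.toDescentStructure
      M.operadAlgebras rfl c (fun i A => ?_) exact_colimits pt compatible
    cases i with
    | none => exact key A.alg.carrier
    | some l => exact key (A.opd.obj l)
  · have := OperadSheaf.hasFilteredColimits_algOver tensor P
    have (i : (M.algebrasOver P).Idx) :
        PreservesFilteredColimitsOfSize.{w, w} ((M.algebrasOver P).forget i) :=
      OperadSheaf.preservesFilteredColimits_forget tensor P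
    have (i : (M.algebrasOver P).Idx) (I : Type w) :
        PreservesLimitsOfShape (Discrete I) ((M.algebrasOver P).forget i) :=
      OperadSheaf.preservesProducts_forget P I
    exact OperadSheaf.Coefficients.derivedFunctors_of_components M.toDescentStructure
      (M.algebrasOver P) rfl (fun _ => Iso.refl _) (fun _ A => key A.carrier) exact_colimits pt
      compatible
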